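/- Let $k$ be a field, $N\ge 1$, $q\in k$ with $q\neq 0$, $q^2\neq 1$, and let $z\in k$ satisfy $z^N=q^{-1}$. Let $U_q^{\rm ext}(sl_N)$ be the Hopf algebra with algebra generators $\widehat K_i^{\pm1}$ ($1\le i\le N$), $E_s,F_s$ ($1\le s\le N-1$) and relations $$\widehat K_i\widehat K_j=\widehat K_j\widehat K_i,\quad \widehat K_i\widehat K_i^{-1}=\widehat K_i^{-1}\widehat K_i=1,\quad \widehat K_1\cdots\widehat K_N=1,$$ $$\widehat K_iE_t\widehat K_i^{-1}=q^{\delta_{i,t}-\delta_{i,t+1}}E_t,\qquad \widehat K_iF_t\widehat K_i^{-1}=q^{\delta_{i,t+1}-\delta_{i,t}}F_t,$$ $$E_tE_s=E_sE_t,\quad F_tF_s=F_sF_t\quad(|s-t|>1),$$ $$E_s^2E_t-(q+q^{-1})E_sE_tE_s+E_tE_s^2=0,\quad F_s^2F_t-(q+q^{-1})F_sF_tF_s+F_tF_s^2=0\quad(|s-t|=1),$$ $$E_sF_t-F_tE_s=\delta_{s,t}(q-q^{-1})^{-1}\bigl(\widehat K_s\widehat K_{s+1}^{-1}-\widehat K_s^{-1}\widehat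 K_{s+1}\bigr),$$ and with $$\Delta(\widehat K_i^{\pm1})=\widehat K_i^{\pm1}\otimes\widehat K_i^{\pm1},\quad \Delta(E_s)=1\otimes E_s+E_s\otimes\widehat K_s\widehat K_{s+1}^{-1},\quad \Delta(F_s)=F_s\otimes1+\widehat K_{s+1}\widehat K_s^{-1}\otimes F_s,$$ $$\varepsilon(\widehat K_i^{\pm1})=1,\ \varepsilon(E_s)=\varepsilon(F_s)=0,\quad S(\widehat K_i^{\pm1})=\widehat K_i^{\mp1},\ S(E_s)=-E_s\widehat K_s^{-1}\widehat K_{s+1},\ S(F_s)=-\widehat K_s\widehat K_{s+1}^{-1}F_s.$$ Let $U_q(\mathfrak b_-)$ (respectively $U_q(\mathfrak b_+)$) be the Hopf algebra with generators $\widehat K_i^{\pm1},E_s$ (respectively $\widehat K_i^{\pm1},F_s$), with those of the above relations that involve only these generators, and with the same formulas for $\Delta,\varepsilon,S$. A duality between Hopf algebras $U$ and $V$ is a bilinear form $\langle\,,\rangle:U\otimes V\to k$ with $\langle mn,x\rangle=\langle m,x_1\rangle\langle n,x_2\rangle$, $\langle m,xy\rangle=\langle m_1,x\rangle\langle m_2,y\rangle$,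 $\langle1,x\rangle=\varepsilon(x)$, $\langle m,1\rangle=\varepsilon(m)$. A skew pairing $\wp$ between $B$ and $H$ is a duality between $B^{\rm cop}$ and $H$; it defines the generalized quantum double $D(B,H)$, the Hopf algebra which is $B\otimes H$ as a coalgebra, with multiplication $$(b\otimes h)(b'\otimes h')=\wp(b'_1,h_1)\,\wp^{-1}(b'_3,h_3)\;bb'_2\otimes h_2h',$$ where $\wp^{-1}$ is the convolution inverse, $\wp^{-1}(b,h)=\wp(S(b),h)$. (1) There is one and only one bilinear form on $U_q(\mathfrak b_+)\otimes U_q(\mathfrak b_-)$ that is a duality between $U_q(\mathfrak b_+)^{\rm cop}$ and $U_q(\mathfrak b_-)$ and satisfies, for all $i,j,s,t$, $$\langle\widehat K_i,\widehat K_j\rangle=\langle\widehat K_i^{-1},\widehat K_j^{-1}\rangle=zq^{\delta_{i,j}},\qquad \langle\widehat K_i,\widehat K_j^{-1}\rangle=\langle\widehat K_i^{-1},\widehat K_j\rangle=z^{-1}q^{-\delta_{i,j}},$$ $$\langle\widehat K_i^{\pm1},E_s\rangle=0,\qquad \langle F_s,\widehat K_j^{\pm1}\rangle=0,\qquad \langle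 F_s,E_t\rangle=(q-q^{-1})^{-1}\delta_{s,t}.$$ (2) $U_q(\mathfrak b_-)$ is self-dual: there is one and only one duality between $U_q(\mathfrak b_-)$ and itself that satisfies, for all $i,j,s,t$, $$\langle\widehat K_i,\widehat K_j\rangle=\langle\widehat K_i^{-1},\widehat K_j^{-1}\rangle=z^{-1}q^{-\delta_{i,j}},\qquad \langle\widehat K_i,\widehat K_j^{-1}\rangle=\langle\widehat K_i^{-1},\widehat K_j\rangle=zq^{\delta_{i,j}},$$ $$\langle\widehat K_i^{\pm1},E_s\rangle=\langle E_s,\widehat K_i^{\pm1}\rangle=0,\qquad \langle E_s,E_t\rangle=(q-q^{-1})^{-1}\delta_{s,t}.$$ (3) Let $D(U_q(\mathfrak b_+),U_q(\mathfrak b_-))$ and $D(U_q(\mathfrak b_-)^{\rm cop},U_q(\mathfrak b_-))$ be the generalized quantum doubles defined by the forms in (1) and (2). There is a surjective Hopf algebra homomorphism $D(U_q(\mathfrak b_+),U_q(\mathfrak b_-))\to U_q^{\rm ext}(sl_N)$ with $\widehat K_i\otimes1\mapsto\widehat K_i$, $F_s\otimes1\mapsto F_s$, $1\otimes\widehat K_i\mapsto\widehat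 K_i$, $1\otimes E_s\mapsto E_s$; so $U_q^{\rm ext}(sl_N)$ is isomorphic to a factor of the double. Moreover there is a Hopf algebra isomorphism $D(U_q(\mathfrak b_+),U_q(\mathfrak b_-))\cong D(U_q(\mathfrak b_-)^{\rm cop},U_q(\mathfrak b_-))$ with $\widehat K_i\otimes1\mapsto\widehat K_i^{-1}\otimes1$, $F_s\otimes1\mapsto E_s\otimes1$ and $1\otimes h\mapsto1\otimes h$ for $h\in U_q(\mathfrak b_-)$. -/

import Mathlib

open scoped TensorProduct
open Coalgebra WithConv

noncomputable section

section Convolution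

variable {k C D A A' : Type*} [CommRing k] [AddCommMonoid C] [Module k C] [Coalgebra k C]
  [AddCommMonoid D] [Module k D] [Coalgebra k D] [Ring A] [Algebra k A] [Ring A'] [Algebra k A']

/-- A linear functional on a coalgebra, viewed as an element of a convolution algebra. -/
def convScalar (A : Type*) [Ring A] [Algebra k A] (u : C →ₗ[k] k) : WithConv (C →ₗ[k] A) :=
  toConv (Algebra.linearMap k A ∘ₗ u)

lemma convScalar_mul (u v : C →ₗ[k] k) :
    convScalar A u * convScalar A v = convScalar A (toConv u * toConv v).ofConv :=
  (ofConv_injective (LinearMap.algHom_comp_convMul_distrib (Algebra.ofId k A)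
    (toConv u) (toConv v))).symm

lemma convScalar_one : convScalar A (1 : WithConv (C →ₗ[k] k)).ofConv = 1 := by
  ext; simp [convScalar]

lemma comp_convScalar_mul (u : C →ₗ[k] k) (f : C →ₗ[k] A) (l : A →ₗ[k] A') :
    l ∘ₗ (convScalar A u * toConv f).ofConv = (convScalar A' u * toConv (l ∘ₗ f)).ofConv := by
  ext c
  have h1 := (ℛ k c).convMul_apply (convScalar A u) (toConv f)
  have h2 := (ℛ k c).convMul_apply (convScalar A' u) (toConv (l ∘ₗ f))
  change l ((convScalar A u * toConv f) c) = (convScalar A' u * toConv (l ∘ₗ f)) c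
  rw [h1, h2]
  simp [convScalar, ← Algebra.smul_def]

lemma comp_mul_convScalar (u : C →ₗ[k] k) (f : C →ₗ[k] A) (l : A →ₗ[k] A') :
    l ∘ₗ (toConv f * convScalar A u).ofConv = (toConv (l ∘ₗ f) * convScalar A' u).ofConv := by
  ext c
  have h1 := (ℛ k c).convMul_apply (toConv f) (convScalar A u)
  have h2 := (ℛ k c).convMul_apply (toConv (l ∘ₗ f)) (convScalar A' u)
  change l ((toConv f * convScalar A u) c) = (toConv (l ∘ₗ f) * convScalar A' u) c
  rw [h1, h2]
  simp [convScalar, ← Algebra.commutes, ← Algebra.smul_def]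

lemma comp_conj (u v : C →ₗ[k] k) (f : C →ₗ[k] A) (l : A →ₗ[k] A') :
    l ∘ₗ (convScalar A u * toConv f * convScalar A v).ofConv =
      (convScalar A' u * toConv (l ∘ₗ f) * convScalar A' v).ofConv := by
  have := comp_mul_convScalar v (convScalar A u * toConv f).ofConv l
  rw [comp_convScalar_mul] at this
  exact this

lemma conv_comp_mul (f g : WithConv (D →ₗ[k] A)) (φ : C →ₗc[k] D) :
    toConv ((f * g).ofConv ∘ₗ φ.toLinearMap) =
      toConv (f.ofConv ∘ₗ φ.toLinearMap) * toConv (g.ofConv ∘ₗ φ.toLinearMap) :=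
  ofConv_injective (LinearMap.convMul_comp_coalgHom_distrib f g φ)

lemma conv_comp_one (φ : C →ₗc[k] D) :
    toConv ((1 : WithConv (D →ₗ[k] A)).ofConv ∘ₗ φ.toLinearMap) = 1 := by
  ext c; simp [LinearMap.convOne_def]

end Convolution

/-- A convolution-invertible unital 2-cocycle on a bialgebra, that is, a bilinear form `τ` with
`τ(a₁,b₁) τ(a₂b₂,c) = τ(b₁,c₁) τ(a,b₂c₂)` and `τ(a,1) = τ(1,a) = ε(a)`. -/
structure TwoCocycle (k A : Type*) [CommRing k] [Ring A] [Bialgebra k A] where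
  form : A ⊗[k] A →ₗ[k] k
  inv : A ⊗[k] A →ₗ[k] k
  mul_inv : toConv form * toConv inv = 1
  inv_mul : toConv inv * toConv form = 1
  cocycle :
    toConv (LinearMap.mul' k k ∘ₗ TensorProduct.map form (counit (R := k) (A := A))) *
        toConv (form ∘ₗ (LinearMap.mul' k A).rTensor A) =
      toConv ((toConv (LinearMap.mul' k k ∘ₗ TensorProduct.map (counit (R := k) (A := A)) form) *
        toConv (form ∘ₗ (LinearMap.mul' k A).lTensor A)).ofConv ∘ₗ
          (TensorProduct.assoc k A A A).toLinearMap)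
  one_left : ∀ a, form (1 ⊗ₜ a) = counit (R := k) a
  one_right : ∀ a, form (a ⊗ₜ 1) = counit (R := k) a

namespace TwoCocycle

variable {k A : Type*} [CommRing k] [Ring A] [Bialgebra k A] (τ : TwoCocycle k A)

/-- The twisted multiplication `a ⊗ b ↦ τ(a₁,b₁) a₂b₂ τ⁻¹(a₃,b₃)`. -/
def mulMap : A ⊗[k] A →ₗ[k] A :=
  (convScalar A τ.form * toConv (LinearMap.mul' k A) * convScalar A τ.inv).ofConv

lemma scalar_mul_inv : convScalar A τ.form * convScalar A τ.inv = 1 := by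
  rw [convScalar_mul, τ.mul_inv, convScalar_one]

lemma scalar_inv_mul (A' : Type*) [Ring A'] [Algebra k A'] :
    convScalar A' τ.inv * convScalar A' τ.form = 1 := by
  rw [convScalar_mul, τ.inv_mul, convScalar_one]

/-- A coalgebra map is an element of the convolution algebra on which the comultiplication of the
target splits. -/
lemma comul_comp_eq {C : Type*} [AddCommMonoid C] [Module k C] [Coalgebra k C] (f : C →ₗ[k] A) :
    TensorProduct.map f f ∘ₗ comul =
      (toConv ((Algebra.TensorProduct.includeLeft (R := k) (S := k) (A := A) (B := A)).toLinearMap ∘ₗ f) *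
       toConv ((Algebra.TensorProduct.includeRight (R := k) (A := A) (B := A)).toLinearMap ∘ₗ f)).ofConv := by
  ext c
  refine Eq.trans ?_ ((ℛ k c).convMul_apply _ _).symm
  simp only [LinearMap.comp_apply, ← (ℛ k c).eq, map_sum]
  simp

lemma comul_comp_mulMap :
    TensorProduct.map τ.mulMap τ.mulMap ∘ₗ comul = comul ∘ₗ τ.mulMap := by
  have hm : TensorProduct.map (LinearMap.mul' k A) (LinearMap.mul' k A) ∘ₗ comul =
      comul ∘ₗ LinearMap.mul' k A := (Bialgebra.mulCoalgHom k A).map_comp_comul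
  rw [comul_comp_eq] at hm ⊢
  rw [mulMap, comp_conj, comp_conj, comp_conj, ← hm]
  simp only [toConv_ofConv]
  congr 1
  set a := convScalar (A ⊗[k] A) τ.form
  set b := convScalar (A ⊗[k] A) τ.inv
  have hba : b * a = 1 := τ.scalar_inv_mul _
  generalize toConv ((Algebra.TensorProduct.includeLeft (R := k) (S := k) (A := A) (B := A)).toLinearMap ∘ₗ LinearMap.mul' k A) = x
  generalize toConv ((Algebra.TensorProduct.includeRight (R := k) (A := A) (B := A)).toLinearMap ∘ₗ LinearMap.mul' k A) = y
  calc a * x * b * (a * y * b) = a * x * (b * a) * y * b := by simp only [mul_assoc]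
    _ = _ := by rw [hba]; simp only [mul_assoc, one_mul]

lemma counit_comp_mulMap : counit ∘ₗ τ.mulMap = counit (R := k) (A := A ⊗[k] A) := by
  rw [mulMap, comp_conj]
  have : toConv (counit ∘ₗ LinearMap.mul' k A) = (1 : WithConv (A ⊗[k] A →ₗ[k] k)) := by
    ext; simp [mul_comm]
  rw [this, mul_one, convScalar_mul, τ.mul_inv, convScalar_one]
  rfl

/-- The twisted multiplication as a coalgebra map. -/
def mulCoalgHom : A ⊗[k] A →ₗc[k] A where
  toLinearMap := τ.mulMap
  counit_comp := τ.counit_comp_mulMap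
  map_comp_comul := τ.comul_comp_mulMap


lemma rTensor_mulMap : τ.mulMap.rTensor A =
    (convScalar (A ⊗[k] A) (LinearMap.mul' k k ∘ₗ TensorProduct.map τ.form counit) *
      toConv ((LinearMap.mul' k A).rTensor A) *
      convScalar (A ⊗[k] A) (LinearMap.mul' k k ∘ₗ TensorProduct.map τ.inv counit)).ofConv := by
  have key : ∀ u : A ⊗[k] A →ₗ[k] k,
      convScalar (A ⊗[k] A) (LinearMap.mul' k k ∘ₗ TensorProduct.map u counit) =
      toConv (TensorProduct.map (convScalar A u).ofConv
        (1 : WithConv (A →ₗ[k] A)).ofConv) := by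
    intro u
    ext x y z
    simp [convScalar, LinearMap.convOne_def, Algebra.algebraMap_eq_smul_one,
      ← TensorProduct.smul_tmul', smul_smul, mul_comm, Algebra.TensorProduct.one_def]
  have hm : toConv ((LinearMap.mul' k A).rTensor A) =
      toConv (TensorProduct.map (toConv (LinearMap.mul' k A)).ofConv
        (toConv (LinearMap.id : A →ₗ[k] A)).ofConv) := rfl
  rw [key, key, hm, TensorProduct.map_convMul_map, TensorProduct.map_convMul_map, one_mul, mul_one]
  rfl

lemma lTensor_mulMap : τ.mulMap.lTensor A =
    (convScalar (A ⊗[k] A) (LinearMap.mul' k k ∘ₗ TensorProduct.map counit τ.form) *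
      toConv ((LinearMap.mul' k A).lTensor A) *
      convScalar (A ⊗[k] A) (LinearMap.mul' k k ∘ₗ TensorProduct.map counit τ.inv)).ofConv := by
  have key : ∀ u : A ⊗[k] A →ₗ[k] k,
      convScalar (A ⊗[k] A) (LinearMap.mul' k k ∘ₗ TensorProduct.map counit u) =
      toConv (TensorProduct.map (1 : WithConv (A →ₗ[k] A)).ofConv (convScalar A u).ofConv) := by
    intro u
    ext x y z
    simp [convScalar, LinearMap.convOne_def, Algebra.algebraMap_eq_smul_one,
      ← TensorProduct.smul_tmul', smul_smul, mul_comm, Algebra.TensorProduct.one_def]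
  have hm : toConv ((LinearMap.mul' k A).lTensor A) =
      toConv (TensorProduct.map (toConv (LinearMap.id : A →ₗ[k] A)).ofConv
        (toConv (LinearMap.mul' k A)).ofConv) := rfl
  rw [key, key, hm, TensorProduct.map_convMul_map, TensorProduct.map_convMul_map, one_mul, mul_one]
  rfl

lemma conv_map_mul {C D : Type*} [AddCommMonoid C] [Module k C] [Coalgebra k C]
    [AddCommMonoid D] [Module k D] [Coalgebra k D]
    (f f' : WithConv (C →ₗ[k] k)) (g g' : WithConv (D →ₗ[k] k)) :
    toConv (LinearMap.mul' k k ∘ₗ TensorProduct.map f.ofConv g.ofConv) *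
      toConv (LinearMap.mul' k k ∘ₗ TensorProduct.map f'.ofConv g'.ofConv) =
    toConv (LinearMap.mul' k k ∘ₗ TensorProduct.map (f * f').ofConv (g * g').ofConv) := by
  have h := LinearMap.algHom_comp_convMul_distrib (Algebra.TensorProduct.lmul' k (S := k))
    (toConv (TensorProduct.map f.ofConv g.ofConv)) (toConv (TensorProduct.map f'.ofConv g'.ofConv))
  rw [TensorProduct.map_convMul_map] at h
  exact (ofConv_injective h).symm

lemma inv_form_left : 
    toConv (LinearMap.mul' k k ∘ₗ TensorProduct.map τ.inv (counit (R := k) (A := A))) *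
    toConv (LinearMap.mul' k k ∘ₗ TensorProduct.map τ.form (counit (R := k) (A := A)))
      = 1 := by
  have := conv_map_mul (toConv τ.inv) (toConv τ.form) (1 : WithConv (A →ₗ[k] k)) 1
  rw [τ.inv_mul, one_mul] at this
  refine Eq.trans this ?_
  ext; simp [mul_comm]

lemma form_inv_left : 
    toConv (LinearMap.mul' k k ∘ₗ TensorProduct.map τ.form (counit (R := k) (A := A))) *
    toConv (LinearMap.mul' k k ∘ₗ TensorProduct.map τ.inv (counit (R := k) (A := A)))
      = 1 := by
  have := conv_map_mul (toConv τ.form) (toConv τ.inv) (1 : WithConv (A →ₗ[k] k)) 1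
  rw [τ.mul_inv, one_mul] at this
  refine Eq.trans this ?_
  ext; simp [mul_comm]

lemma inv_form_right : 
    toConv (LinearMap.mul' k k ∘ₗ TensorProduct.map (counit (R := k) (A := A)) τ.inv) *
    toConv (LinearMap.mul' k k ∘ₗ TensorProduct.map (counit (R := k) (A := A)) τ.form)
      = 1 := by
  have := conv_map_mul (1 : WithConv (A →ₗ[k] k)) 1 (toConv τ.inv) (toConv τ.form)
  rw [τ.inv_mul, one_mul] at this
  refine Eq.trans this ?_
  ext; simp [mul_comm]

lemma form_inv_right : 
    toConv (LinearMap.mul' k k ∘ₗ TensorProduct.map (counit (R := k) (A := A)) τ.form) *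
    toConv (LinearMap.mul' k k ∘ₗ TensorProduct.map (counit (R := k) (A := A)) τ.inv)
      = 1 := by
  have := conv_map_mul (1 : WithConv (A →ₗ[k] k)) 1 (toConv τ.form) (toConv τ.inv)
  rw [τ.mul_inv, one_mul] at this
  refine Eq.trans this ?_
  ext; simp [mul_comm]

/-- Ring bookkeeping behind the associativity of the twisted multiplication. -/
lemma twist_comp {C : Type*} [AddCommMonoid C] [Module k C] [Coalgebra k C]
    (φ : C →ₗc[k] A ⊗[k] A) (m : C →ₗ[k] A ⊗[k] A) (u v : C →ₗ[k] k)
    (hvu : toConv v * toConv u = 1)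
    (hφ : φ.toLinearMap = (convScalar (A ⊗[k] A) u * toConv m * convScalar (A ⊗[k] A) v).ofConv) :
    toConv (τ.mulMap ∘ₗ φ.toLinearMap) =
      convScalar A (toConv u * toConv (τ.form ∘ₗ m)).ofConv * toConv (LinearMap.mul' k A ∘ₗ m) *
      convScalar A (toConv (τ.inv ∘ₗ m) * toConv v).ofConv := by
  have hS : ∀ w : C →ₗ[k] k, convScalar k w = toConv w := fun w => by ext; simp [convScalar]
  have hs : ∀ w : A ⊗[k] A →ₗ[k] k, toConv ((convScalar A w).ofConv ∘ₗ φ.toLinearMap) =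
      convScalar A u * convScalar A (w ∘ₗ m) * convScalar A v := by
    intro w
    have h1 : (convScalar A w).ofConv ∘ₗ φ.toLinearMap = (convScalar A (w ∘ₗ φ.toLinearMap)).ofConv := rfl
    rw [h1, hφ, comp_conj, hS, hS, toConv_ofConv, ← hS, convScalar_mul, convScalar_mul]
    simp [hS]
  have hvu' : convScalar A v * convScalar A u = 1 := by
    rw [convScalar_mul, hvu, convScalar_one]
  have hm : toConv (LinearMap.mul' k A ∘ₗ φ.toLinearMap) =
      convScalar A u * toConv (LinearMap.mul' k A ∘ₗ m) * convScalar A v := by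
    rw [hφ, comp_conj]
  rw [mulMap, conv_comp_mul, conv_comp_mul, hs, hs]
  erw [hm]
  rw [← convScalar_mul, ← convScalar_mul]
  set a := convScalar A u
  set b := convScalar A v
  generalize convScalar A (τ.form ∘ₗ m) = x
  generalize convScalar A (τ.inv ∘ₗ m) = y
  generalize toConv (LinearMap.mul' k A ∘ₗ m) = z
  calc a * x * b * (a * z * b) * (a * y * b) = a * x * (b * a) * z * (b * a) * y * b := by
        simp only [mul_assoc]
    _ = _ := by rw [hvu']; simp only [mul_assoc, one_mul]

lemma mulMap_assoc : τ.mulMap ∘ₗ τ.mulMap.rTensor A =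
    τ.mulMap ∘ₗ τ.mulMap.lTensor A ∘ₗ (TensorProduct.assoc k A A A).toLinearMap := by
  let φ := Coalgebra.TensorProduct.map τ.mulCoalgHom (CoalgHom.id k A)
  let ψ := Coalgebra.TensorProduct.map (CoalgHom.id k A) τ.mulCoalgHom
  let φ₀ := Coalgebra.TensorProduct.map (Bialgebra.mulCoalgHom k A) (CoalgHom.id k A)
  let ψ₀ := Coalgebra.TensorProduct.map (CoalgHom.id k A) (Bialgebra.mulCoalgHom k A)
  let α : (A ⊗[k] A) ⊗[k] A →ₗc[k] A ⊗[k] (A ⊗[k] A) :=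
    (Coalgebra.TensorProduct.assoc k k A A A).toCoalgHom
  have h1 := τ.twist_comp φ _ _ _ τ.inv_form_left τ.rTensor_mulMap
  have h2 := τ.twist_comp ψ _ _ _ τ.inv_form_right τ.lTensor_mulMap
  have h2' : toConv ((τ.mulMap ∘ₗ ψ.toLinearMap) ∘ₗ α.toLinearMap) = _ :=
    congrArg (fun x => toConv (x.ofConv ∘ₗ α.toLinearMap)) h2
  rw [conv_comp_mul, conv_comp_mul] at h2'
  have hc : ∀ w : A ⊗[k] (A ⊗[k] A) →ₗ[k] k, toConv ((convScalar A w).ofConv ∘ₗ α.toLinearMap) =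
      convScalar A (w ∘ₗ α.toLinearMap) := fun _ => rfl
  rw [hc, hc] at h2'
  have e1 : (toConv (τ.inv ∘ₗ (LinearMap.mul' k A).rTensor A) *
        toConv (LinearMap.mul' k k ∘ₗ TensorProduct.map τ.inv (counit (R := k) (A := A)))) *
      (toConv (LinearMap.mul' k k ∘ₗ TensorProduct.map τ.form (counit (R := k) (A := A))) *
        toConv (τ.form ∘ₗ (LinearMap.mul' k A).rTensor A)) = 1 := by
    have := conv_comp_mul (toConv τ.inv) (toConv τ.form) φ₀
    rw [τ.inv_mul, conv_comp_one] at this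
    rw [mul_assoc, ← mul_assoc _ _ (toConv (τ.form ∘ₗ (LinearMap.mul' k A).rTensor A)),
      τ.inv_form_left, one_mul]
    exact this.symm
  have e2 : (toConv (LinearMap.mul' k k ∘ₗ TensorProduct.map (counit (R := k) (A := A)) τ.form) *
        toConv (τ.form ∘ₗ (LinearMap.mul' k A).lTensor A)) *
      (toConv (τ.inv ∘ₗ (LinearMap.mul' k A).lTensor A) *
        toConv (LinearMap.mul' k k ∘ₗ TensorProduct.map (counit (R := k) (A := A)) τ.inv)) = 1 := by
    have := conv_comp_mul (toConv τ.form) (toConv τ.inv) ψ₀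
    rw [τ.mul_inv, conv_comp_one] at this
    rw [mul_assoc, ← mul_assoc (toConv (τ.form ∘ₗ (LinearMap.mul' k A).lTensor A))]
    erw [← this]
    rw [one_mul, τ.form_inv_right]
  have e3 := congrArg (fun x => toConv (x.ofConv ∘ₗ α.toLinearMap)) e2
  simp only [conv_comp_mul _ _ α, conv_comp_one] at e3
  rw [← conv_comp_mul _ _ α, ← conv_comp_mul _ _ α] at e3
  have hcc := τ.cocycle
  have e4 : _ = toConv _ := left_inv_eq_right_inv e1 (hcc.symm ▸ e3)
  have e5 : toConv (LinearMap.mul' k A ∘ₗ (LinearMap.mul' k A).rTensor A) =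
      toConv ((LinearMap.mul' k A ∘ₗ (LinearMap.mul' k A).lTensor A) ∘ₗ α.toLinearMap) := by
    congr 1
    ext x y z
    exact mul_assoc x y z
  apply toConv_injective
  refine h1.trans (Eq.trans ?_ h2'.symm)
  rw [hcc, e4, e5]
  rfl

/-- The coalgebra map `h ↦ 1 ⊗ h`. -/
def oneTmul (k B H : Type*) [CommRing k] [Ring B] [Bialgebra k B] [Ring H] [Bialgebra k H] :
    H →ₗc[k] B ⊗[k] H where
  toLinearMap := TensorProduct.mk k B H 1
  counit_comp := by ext; simp
  map_comp_comul := by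
    ext x
    simp only [LinearMap.comp_apply, TensorProduct.mk_apply, TensorProduct.comul_tmul,
      Bialgebra.comul_one, Algebra.TensorProduct.one_def]
    induction comul (R := k) x with
    | zero => simp
    | add x y hx hy => simp only [map_add, TensorProduct.tmul_add, hx, hy]
    | tmul x y => simp

/-- The coalgebra map `b ↦ b ⊗ 1`. -/
def tmulOne (k B H : Type*) [CommRing k] [Ring B] [Bialgebra k B] [Ring H] [Bialgebra k H] :
    B →ₗc[k] B ⊗[k] H where
  toLinearMap := (TensorProduct.mk k B H).flip 1
  counit_comp := by ext; simp
  map_comp_comul := by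
    ext x
    simp only [LinearMap.comp_apply, LinearMap.flip_apply, TensorProduct.mk_apply,
      TensorProduct.comul_tmul, Bialgebra.comul_one, Algebra.TensorProduct.one_def]
    induction comul (R := k) x with
    | zero => simp
    | add x y hx hy => simp only [map_add, TensorProduct.add_tmul, hx, hy]
    | tmul x y => simp

lemma mulMap_comp_of_trivial {C : Type*} [AddCommMonoid C] [Module k C] [Coalgebra k C]
    (φ : C →ₗc[k] A ⊗[k] A) (h1 : toConv (τ.form ∘ₗ φ.toLinearMap) = 1) (c : C) :
    τ.mulMap (φ c) = LinearMap.mul' k A (φ c) := by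
  have h2 : toConv (τ.inv ∘ₗ φ.toLinearMap) = 1 := by
    have h := conv_comp_mul (toConv τ.form) (toConv τ.inv) φ
    rw [τ.mul_inv, conv_comp_one] at h
    erw [h1] at h
    rw [one_mul] at h
    exact h.symm
  have hs : ∀ w : A ⊗[k] A →ₗ[k] k, toConv (w ∘ₗ φ.toLinearMap) = 1 →
      toConv ((convScalar A w).ofConv ∘ₗ φ.toLinearMap) = 1 := by
    intro w hw
    rw [← convScalar_one, ← hw]
    rfl
  have h3 := conv_comp_mul (convScalar A τ.form * toConv (LinearMap.mul' k A))
    (convScalar A τ.inv) φ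
  rw [conv_comp_mul (convScalar A τ.form), hs _ h1, hs _ h2, mul_one, one_mul] at h3
  exact congrArg (fun f => f.ofConv c) h3

lemma mulMap_one_left (a : A) : τ.mulMap (1 ⊗ₜ a) = a :=
  (τ.mulMap_comp_of_trivial (oneTmul k A A)
    (by ext x; simpa [oneTmul] using τ.one_left x) a).trans (one_mul a)

lemma mulMap_one_right (a : A) : τ.mulMap (a ⊗ₜ 1) = a :=
  (τ.mulMap_comp_of_trivial (tmulOne k A A)
    (by ext x; simpa [tmulOne] using τ.one_right x) a).trans (mul_one a)

end TwoCocycle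

/-- The bialgebra `A^τ`: the coalgebra `A` with the multiplication twisted by the 2-cocycle `τ`. -/
def CocycleTwist {k A : Type*} [CommRing k] [Ring A] [Bialgebra k A] (_τ : TwoCocycle k A) :
    Type _ := A

namespace CocycleTwist

variable {k A : Type*} [CommRing k] [Ring A] [Bialgebra k A] (τ : TwoCocycle k A)

instance : AddCommGroup (CocycleTwist τ) := inferInstanceAs (AddCommGroup A)

instance : Module k (CocycleTwist τ) := inferInstanceAs (Module k A)

instance : Coalgebra k (CocycleTwist τ) := inferInstanceAs (Coalgebra k A)

/-- The identity map `A → A^τ`. -/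
def of : A ≃ₗ[k] CocycleTwist τ := LinearEquiv.refl k A

instance : Mul (CocycleTwist τ) where
  mul x y := of τ (τ.mulMap ((of τ).symm x ⊗ₜ (of τ).symm y))

instance : One (CocycleTwist τ) where
  one := of τ 1

lemma of_mul_of (x y : A) : of τ x * of τ y = of τ (τ.mulMap (x ⊗ₜ y)) := rfl

instance : Ring (CocycleTwist τ) :=
  { (inferInstance : AddCommGroup (CocycleTwist τ)),
    (inferInstance : Mul (CocycleTwist τ)), (inferInstance : One (CocycleTwist τ)) with
    left_distrib := fun x y z => by
      change τ.mulMap _ = τ.mulMap _ + τ.mulMap _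
      rw [← map_add, ← TensorProduct.tmul_add]; rfl
    right_distrib := fun x y z => by
      change τ.mulMap _ = τ.mulMap _ + τ.mulMap _
      rw [← map_add, ← TensorProduct.add_tmul]; rfl
    zero_mul := fun x => by
      change τ.mulMap ((0 : A) ⊗ₜ (show A from x)) = (0 : A)
      rw [TensorProduct.zero_tmul, map_zero]
    mul_zero := fun x => by
      change τ.mulMap ((show A from x) ⊗ₜ (0 : A)) = (0 : A)
      rw [TensorProduct.tmul_zero, map_zero]
    mul_assoc := fun x y z =>
      LinearMap.congr_fun τ.mulMap_assoc (((show A from x) ⊗ₜ (show A from y)) ⊗ₜ (show A from z))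
    one_mul := fun x => τ.mulMap_one_left x
    mul_one := fun x => τ.mulMap_one_right x }

instance : Algebra k (CocycleTwist τ) :=
  Algebra.ofModule
    (fun r x y => by
      change τ.mulMap ((r • (show A from x)) ⊗ₜ (show A from y)) = r • τ.mulMap _
      rw [← map_smul, TensorProduct.smul_tmul']; rfl)
    (fun r x y => by
      change τ.mulMap ((show A from x) ⊗ₜ (r • (show A from y))) = r • τ.mulMap _
      rw [← map_smul, TensorProduct.tmul_smul]; rfl)

lemma map_of_mulMap (X Y : A ⊗[k] A) :
    TensorProduct.map (of τ).toLinearMap (of τ).toLinearMap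
      (TensorProduct.map τ.mulMap τ.mulMap
        (TensorProduct.AlgebraTensorModule.tensorTensorTensorComm k k k k A A A A (X ⊗ₜ Y))) =
      TensorProduct.map (of τ).toLinearMap (of τ).toLinearMap X *
        TensorProduct.map (of τ).toLinearMap (of τ).toLinearMap Y := by
  induction X with
  | zero => simp
  | add x y hx hy => simp only [map_add, TensorProduct.add_tmul, add_mul, hx, hy]
  | tmul a b =>
    induction Y with
    | zero => simp
    | add x y hx hy => simp only [map_add, TensorProduct.tmul_add, mul_add, hx, hy]
    | tmul c d => simp [of_mul_of]

lemma comul_of (x : A) : comul (R := k) (of τ x) =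
    TensorProduct.map (of τ).toLinearMap (of τ).toLinearMap (comul (R := k) x) := by
  have h : TensorProduct.map (of τ).toLinearMap (of τ).toLinearMap =
    (LinearMap.id : A ⊗[k] A →ₗ[k] A ⊗[k] A) := TensorProduct.map_id
  exact (LinearMap.congr_fun h (comul (R := k) x)).symm

instance : Bialgebra k (CocycleTwist τ) :=
  Bialgebra.mk' k (CocycleTwist τ)
    (Bialgebra.counit_one (R := k) (A := A))
    (fun {x y} => by
      have := LinearMap.congr_fun τ.counit_comp_mulMap ((show A from x) ⊗ₜ (show A from y))
      rw [TensorProduct.counit_tmul, smul_eq_mul, mul_comm] at this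
      exact this)
    (Bialgebra.comul_one (R := k) (A := A))
    (fun {x y} => by
      obtain ⟨x, rfl⟩ := (of τ).surjective x
      obtain ⟨y, rfl⟩ := (of τ).surjective y
      have := LinearMap.congr_fun τ.comul_comp_mulMap (x ⊗ₜ y)
      simp only [LinearMap.comp_apply, TensorProduct.comul_tmul] at this
      rw [of_mul_of, comul_of, comul_of, comul_of, ← this, map_of_mulMap])

end CocycleTwist

/-- The underlying algebra of a bialgebra, to be equipped with the opposite comultiplication. -/
def Cop (A : Type*) : Type _ := A

namespace Cop

variable (k : Type*) {A : Type*} [CommRing k] [Ring A]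

instance : Ring (Cop A) := inferInstanceAs (Ring A)

instance [Algebra k A] : Algebra k (Cop A) := inferInstanceAs (Algebra k A)

/-- The identity map `A → A^cop`, an isomorphism of algebras. -/
def of [Algebra k A] : A ≃ₐ[k] Cop A := AlgEquiv.refl

variable [Bialgebra k A]

/-- The comultiplication `a ↦ a₂ ⊗ a₁`. -/
instance : CoalgebraStruct k (Cop A) where
  comul := TensorProduct.map (of k (A := A)).toLinearMap (of k (A := A)).toLinearMap ∘ₗ
    (TensorProduct.comm k A A).toLinearMap ∘ₗ comul ∘ₗ (of k (A := A)).symm.toLinearMap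
  counit := counit ∘ₗ (of k (A := A)).symm.toLinearMap

lemma comul_of (a : A) : comul (R := k) (of k a) =
    TensorProduct.map (of k (A := A)).toLinearMap (of k (A := A)).toLinearMap
      (TensorProduct.comm k A A (comul (R := k) a)) := rfl

lemma counit_of (a : A) : counit (R := k) (of k a) = counit (R := k) a := rfl

instance : Coalgebra k (Cop A) where
  coassoc := by
    ext x
    obtain ⟨a, rfl⟩ := (of k (A := A)).surjective x
    let e : A →ₗ[k] Cop A := (of k (A := A)).toLinearMap
    let rev : A ⊗[k] (A ⊗[k] A) →ₗ[k] Cop A ⊗[k] (Cop A ⊗[k] Cop A) :=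
      TensorProduct.map e (TensorProduct.map e e) ∘ₗ
      (TensorProduct.assoc k A A A).toLinearMap ∘ₗ
        (TensorProduct.comm k A (A ⊗[k] A)).toLinearMap ∘ₗ
          (TensorProduct.comm k A A).toLinearMap.lTensor A
    have h := congrArg rev (Coalgebra.coassoc_apply (R := k) a)
    refine Eq.trans ?_ (h.symm.trans ?_)
    · simp only [LinearMap.comp_apply, comul_of]
      induction comul (R := k) a with
      | zero => simp
      | add x y hx hy => simp only [map_add, hx, hy]
      | tmul x y =>
        simp only [TensorProduct.comm_tmul, TensorProduct.map_tmul, LinearMap.rTensor_tmul,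
          LinearMap.lTensor_tmul, AlgEquiv.toLinearMap_apply, comul_of]
        induction comul (R := k) y with
        | zero => simp
        | add x y hx hy => simp only [map_add, TensorProduct.tmul_add, TensorProduct.add_tmul, hx, hy]
        | tmul z w => simp [rev, e]
    · simp only [LinearMap.comp_apply, comul_of]
      induction comul (R := k) a with
      | zero => simp
      | add x y hx hy => simp only [map_add, hx, hy]
      | tmul x y =>
        simp only [TensorProduct.comm_tmul, TensorProduct.map_tmul, LinearMap.rTensor_tmul,
          LinearMap.lTensor_tmul, AlgEquiv.toLinearMap_apply, comul_of]
        induction comul (R := k) x with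
        | zero => simp
        | add x y hx hy => simp only [map_add, TensorProduct.tmul_add, TensorProduct.add_tmul, hx, hy]
        | tmul z w => simp [rev, e]
  rTensor_counit_comp_comul := by
    ext x
    obtain ⟨a, rfl⟩ := (of k (A := A)).surjective x
    have h := congrArg (TensorProduct.map LinearMap.id (of k (A := A)).toLinearMap ∘ₗ (TensorProduct.comm k A k).toLinearMap)
      (Coalgebra.lTensor_counit_comul (R := k) a)
    refine Eq.trans ?_ (h.trans ?_)
    · simp only [LinearMap.comp_apply, comul_of]
      induction comul (R := k) a with
      | zero => simp
      | add x y hx hy => simp only [map_add, hx, hy]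
      | tmul x y => simp [counit_of]
    · simp
  lTensor_counit_comp_comul := by
    ext x
    obtain ⟨a, rfl⟩ := (of k (A := A)).surjective x
    have h := congrArg (TensorProduct.map (of k (A := A)).toLinearMap LinearMap.id ∘ₗ (TensorProduct.comm k k A).toLinearMap)
      (Coalgebra.rTensor_counit_comul (R := k) a)
    refine Eq.trans ?_ (h.trans ?_)
    · simp only [LinearMap.comp_apply, comul_of]
      induction comul (R := k) a with
      | zero => simp
      | add x y hx hy => simp only [map_add, hx, hy]
      | tmul x y => simp [counit_of]
    · simp

instance : Bialgebra k (Cop A) :=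
  Bialgebra.mk' k (Cop A)
    (Bialgebra.counit_one (R := k) (A := A))
    (fun {x y} => Bialgebra.counit_mul (R := k) (A := A) x y)
    (by
      have := comul_of k (1 : A)
      rw [map_one] at this
      rw [this]
      simp [Algebra.TensorProduct.one_def])
    (fun {x y} => by
      obtain ⟨a, rfl⟩ := (of k (A := A)).surjective x
      obtain ⟨b, rfl⟩ := (of k (A := A)).surjective y
      rw [← map_mul, comul_of, comul_of, comul_of, Bialgebra.comul_mul]
      generalize comul (R := k) a = X
      generalize comul (R := k) b = Y
      induction X with
      | zero => simp
      | add x y hx hy => simp only [map_add, add_mul, hx, hy]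
      | tmul a b =>
        induction Y with
        | zero => simp
        | add x y hx hy => simp only [map_add, mul_add, hx, hy]
        | tmul c d => simp)

end Cop

/-- A Hopf algebra with bijective antipode. -/
class BijectiveAntipode (k A : Type*) [CommRing k] [Ring A] [HopfAlgebra k A] : Prop where
  bijective : Function.Bijective (HopfAlgebra.antipode k (A := A))

namespace Cop

variable (k : Type*) {A : Type*} [CommRing k] [Ring A] [HopfAlgebra k A] [BijectiveAntipode k A]

/-- The inverse of a bijective antipode. -/
def antipodeInv (k A : Type*) [CommRing k] [Ring A] [HopfAlgebra k A] [BijectiveAntipode k A] :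
    A →ₗ[k] A :=
  (LinearEquiv.ofBijective (HopfAlgebra.antipode k (A := A))
    BijectiveAntipode.bijective).symm.toLinearMap

lemma antipode_antipodeInv (a : A) : HopfAlgebra.antipode k (antipodeInv k A a) = a :=
  LinearEquiv.apply_symm_apply (LinearEquiv.ofBijective (HopfAlgebra.antipode k (A := A))
    BijectiveAntipode.bijective) a

lemma antipode_algebraMap (k : Type*) {A : Type*} [CommRing k] [Ring A] [HopfAlgebra k A] (r : k) :
    HopfAlgebra.antipode k (algebraMap k A r) = algebraMap k A r := by
  rw [Algebra.algebraMap_eq_smul_one, map_smul, HopfAlgebra.antipode_one]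

/-- The antipode of `A^cop` is the inverse of the antipode of `A`. -/
instance : HopfAlgebra k (Cop A) where
  antipode := (of k (A := A)).toLinearMap ∘ₗ antipodeInv k A ∘ₗ (of k (A := A)).symm.toLinearMap
  mul_antipode_rTensor_comul := by
    ext x
    obtain ⟨a, rfl⟩ := (of k (A := A)).surjective x
    apply (of k (A := A)).symm.injective
    apply (BijectiveAntipode.bijective (k := k) (A := A)).1
    have h := HopfAlgebra.mul_antipode_rTensor_comul_apply (R := k) a
    refine Eq.trans ?_ (h.trans ?_)
    · simp only [LinearMap.comp_apply, comul_of]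
      induction comul (R := k) a with
      | zero => simp
      | add x y hx hy => simp only [map_add, hx, hy]
      | tmul x y =>
        simp [HopfAlgebra.antipode_mul_antidistrib, antipode_antipodeInv]
    · exact (antipode_algebraMap k _).symm
  mul_antipode_lTensor_comul := by
    ext x
    obtain ⟨a, rfl⟩ := (of k (A := A)).surjective x
    apply (of k (A := A)).symm.injective
    apply (BijectiveAntipode.bijective (k := k) (A := A)).1
    have h := HopfAlgebra.mul_antipode_lTensor_comul_apply (R := k) a
    refine Eq.trans ?_ (h.trans ?_)
    · simp only [LinearMap.comp_apply, comul_of]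
      induction comul (R := k) a with
      | zero => simp
      | add x y hx hy => simp only [map_add, hx, hy]
      | tmul x y =>
        simp [HopfAlgebra.antipode_mul_antidistrib, antipode_antipodeInv]
    · exact (antipode_algebraMap k _).symm

end Cop

/-- A pairing of two bialgebras `U` and `V`: a bilinear form with
`⟨mn, x⟩ = ⟨m, x₁⟩⟨n, x₂⟩`, `⟨m, xy⟩ = ⟨m₁, x⟩⟨m₂, y⟩`, `⟨1, x⟩ = ε(x)` and `⟨m, 1⟩ = ε(m)`.
If such a form is given, `U` and `V` are said to be in duality. -/
structure HopfPairing (k U V : Type*) [CommRing k] [Ring U] [Ring V] [Bialgebra k U]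
    [Bialgebra k V] where
  form : U →ₗ[k] V →ₗ[k] k
  mul_left : ∀ (m n : U) (x : V), form (m * n) x =
    LinearMap.mul' k k (TensorProduct.map (form m) (form n) (comul (R := k) x))
  mul_right : ∀ (m : U) (x y : V), form m (x * y) =
    LinearMap.mul' k k (TensorProduct.map (form.flip x) (form.flip y) (comul (R := k) m))
  one_left : ∀ x : V, form 1 x = counit (R := k) x
  one_right : ∀ m : U, form m 1 = counit (R := k) m

/-- A skew pairing of `B` and `H` is a pairing of `B^cop` and `H`. -/
abbrev SkewPairing (k B H : Type*) [CommRing k] [Ring B] [Ring H] [Bialgebra k B]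
    [Bialgebra k H] : Type _ :=
  HopfPairing k (Cop B) H

/-- A pairing of `U` and `V` is a skew pairing of `U^cop` and `V`. -/
def HopfPairing.toSkew {k U V : Type*} [CommRing k] [Ring U] [Ring V] [Bialgebra k U]
    [Bialgebra k V] (p : HopfPairing k U V) : SkewPairing k (Cop U) V where
  form := p.form ∘ₗ (Cop.of k (A := U)).symm.toLinearMap ∘ₗ
    (Cop.of k (A := Cop U)).symm.toLinearMap
  mul_left m n x := p.mul_left _ _ x
  mul_right m x y := by
    obtain ⟨m, rfl⟩ := (Cop.of k (A := Cop U)).surjective m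
    obtain ⟨m, rfl⟩ := (Cop.of k (A := U)).surjective m
    refine (p.mul_right m x y).trans ?_
    rw [Cop.comul_of, Cop.comul_of]
    induction comul (R := k) m with
    | zero => simp
    | add x y hx hy => simp only [map_add, hx, hy]
    | tmul a b => simp
  one_left x := p.one_left x
  one_right m := p.one_right _

namespace SkewPairing

variable {k B H : Type*} [CommRing k] [Ring B] [Ring H]

section
variable [Bialgebra k B] [Bialgebra k H] (p : SkewPairing k B H)

/-- The bilinear form `℘(b, h)` of a skew pairing. -/
def val : B →ₗ[k] H →ₗ[k] k := p.form ∘ₗ (Cop.of k (A := B)).toLinearMap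

lemma val_mul_left (b b' : B) (h : H) : p.val (b * b') h =
    LinearMap.mul' k k (TensorProduct.map (p.val b) (p.val b') (comul (R := k) h)) :=
  p.mul_left _ _ h

lemma val_mul_right (b : B) (h h' : H) : p.val b (h * h') =
    LinearMap.mul' k k (TensorProduct.map (p.val.flip h') (p.val.flip h) (comul (R := k) b)) := by
  refine (p.mul_right (Cop.of k b) h h').trans ?_
  rw [Cop.comul_of]
  induction comul (R := k) b with
  | zero => simp
  | add x y hx hy => simp only [map_add, hx, hy]
  | tmul a b => simp [val, mul_comm]

lemma val_one_left (h : H) : p.val 1 h = counit (R := k) h := p.one_left h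

lemma val_one_right (b : B) : p.val b 1 = counit (R := k) b := p.one_right _

variable (k B H) in
/-- The projection `ε ⊗ id : B ⊗ H → H`. -/
def projRight : B ⊗[k] H →ₐc[k] H :=
  (Bialgebra.TensorProduct.lid k H : k ⊗[k] H →ₐc[k] H).comp
    (Bialgebra.TensorProduct.map (Bialgebra.counitBialgHom k B) (BialgHom.id k H))

variable (k B H) in
/-- The projection `id ⊗ ε : B ⊗ H → B`. -/
def projLeft : B ⊗[k] H →ₐc[k] B :=
  (Bialgebra.TensorProduct.rid k k B : B ⊗[k] k →ₐc[k] B).comp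
    (Bialgebra.TensorProduct.map (BialgHom.id k B) (Bialgebra.counitBialgHom k H))

@[simp] lemma projRight_tmul (b : B) (h : H) :
    projRight k B H (b ⊗ₜ h) = counit (R := k) b • h := rfl

@[simp] lemma projLeft_tmul (b : B) (h : H) :
    projLeft k B H (b ⊗ₜ h) = counit (R := k) h • b := rfl

/-- The form `(b ⊗ h) ⊗ (b' ⊗ h') ↦ ε(b) φ(b', h) ε(h')` attached to a bilinear form `φ`. -/
def tauForm (φ : B →ₗ[k] H →ₗ[k] k) : (B ⊗[k] H) ⊗[k] (B ⊗[k] H) →ₗ[k] k :=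
  TensorProduct.lift φ.flip ∘ₗ
    TensorProduct.map (projRight k B H).toCoalgHom.toLinearMap
      (projLeft k B H).toCoalgHom.toLinearMap

lemma tauForm_tmul (φ : B →ₗ[k] H →ₗ[k] k) (b b' : B) (h h' : H) :
    tauForm φ ((b ⊗ₜ h) ⊗ₜ (b' ⊗ₜ h')) =
      counit (R := k) b * φ b' h * counit (R := k) h' := by
  have h1 : (projRight k B H).toCoalgHom (b ⊗ₜ h) = counit (R := k) b • h := rfl
  have h2 : (projLeft k B H).toCoalgHom (b' ⊗ₜ h') = counit (R := k) h' • b' := rfl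
  simp [tauForm, h1, h2, mul_comm, mul_left_comm]

lemma tauForm_conv (φ ψ : B →ₗ[k] H →ₗ[k] k)
    (hφψ : toConv (TensorProduct.lift φ.flip) * toConv (TensorProduct.lift ψ.flip) = 1) :
    toConv (tauForm φ) * toConv (tauForm ψ) = 1 := by
  let π := Coalgebra.TensorProduct.map (projRight k B H).toCoalgHom (projLeft k B H).toCoalgHom
  have h := conv_comp_mul (toConv (TensorProduct.lift φ.flip)) (toConv (TensorProduct.lift ψ.flip)) π
  rw [hφψ, conv_comp_one] at h
  exact h.symm

/-- Projection of the triple tensor product onto the factors seen by the cocycle identity. -/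
def tripleProj (k B H : Type*) [CommRing k] [Ring B] [Ring H] [Bialgebra k B] [Bialgebra k H] :
    ((B ⊗[k] H) ⊗[k] (B ⊗[k] H)) ⊗[k] (B ⊗[k] H) →ₗc[k] (H ⊗[k] (B ⊗[k] H)) ⊗[k] B :=
  Coalgebra.TensorProduct.map
    (Coalgebra.TensorProduct.map (projRight k B H).toCoalgHom (CoalgHom.id k (B ⊗[k] H)))
    (projLeft k B H).toCoalgHom

set_option linter.unusedSimpArgs false in
lemma cocycle_left (F G : (H ⊗[k] (B ⊗[k] H)) ⊗[k] B →ₗ[k] k)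
    (hF : ∀ h y g z, F ((h ⊗ₜ (y ⊗ₜ g)) ⊗ₜ z) = p.val y h * counit (R := k) g * counit (R := k) z)
    (hG : ∀ h y g z, G ((h ⊗ₜ (y ⊗ₜ g)) ⊗ₜ z) = counit (R := k) y * p.val z (h * g))
    (X : H ⊗[k] H) (Y : B ⊗[k] B) (V : H ⊗[k] H) (Z : B ⊗[k] B) :
    LinearMap.mul' k k (TensorProduct.map F G
      (TensorProduct.AlgebraTensorModule.tensorTensorTensorComm k k k k _ _ _ _
        (TensorProduct.AlgebraTensorModule.tensorTensorTensorComm k k k k _ _ _ _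
          (X ⊗ₜ TensorProduct.AlgebraTensorModule.tensorTensorTensorComm k k k k _ _ _ _
            (Y ⊗ₜ V)) ⊗ₜ Z))) =
    LinearMap.mul' k k (TensorProduct.map
      (p.val (TensorProduct.rid k B ((counit (R := k) (A := B)).lTensor B Y)))
      (p.val (TensorProduct.lid k B ((counit (R := k) (A := B)).rTensor B Z)) ∘ₗ
        (LinearMap.mul k H).flip
          (TensorProduct.lid k H ((counit (R := k) (A := H)).rTensor H V))) X) := by
  induction X with
  | zero => simp only [LinearEquiv.map_zero, LinearMap.map_zero, TensorProduct.tmul_zero,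
      TensorProduct.zero_tmul, TensorProduct.map_zero_left, TensorProduct.map_zero_right,
      LinearMap.zero_apply, LinearMap.comp_zero, LinearMap.zero_comp]
  | add x y hx hy => simp only [LinearMap.map_add, LinearEquiv.map_add, TensorProduct.add_tmul, TensorProduct.tmul_add, hx, hy,
        TensorProduct.map_add_left, TensorProduct.map_add_right, LinearMap.add_apply,
        LinearMap.comp_add, LinearMap.add_comp]
  | tmul a b =>
  induction Y with
  | zero => simp only [LinearEquiv.map_zero, LinearMap.map_zero, TensorProduct.tmul_zero,
      TensorProduct.zero_tmul, TensorProduct.map_zero_left, TensorProduct.map_zero_right,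
      LinearMap.zero_apply, LinearMap.comp_zero, LinearMap.zero_comp]
  | add x y hx hy => simp only [LinearMap.map_add, LinearEquiv.map_add, TensorProduct.add_tmul, TensorProduct.tmul_add, hx, hy,
        TensorProduct.map_add_left, TensorProduct.map_add_right, LinearMap.add_apply,
        LinearMap.comp_add, LinearMap.add_comp]
  | tmul c d =>
  induction V with
  | zero => simp only [LinearEquiv.map_zero, LinearMap.map_zero, TensorProduct.tmul_zero,
      TensorProduct.zero_tmul, TensorProduct.map_zero_left, TensorProduct.map_zero_right,
      LinearMap.zero_apply, LinearMap.comp_zero, LinearMap.zero_comp]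
  | add x y hx hy => simp only [LinearMap.map_add, LinearEquiv.map_add, TensorProduct.add_tmul, TensorProduct.tmul_add, hx, hy,
        TensorProduct.map_add_left, TensorProduct.map_add_right, LinearMap.add_apply,
        LinearMap.comp_add, LinearMap.add_comp]
  | tmul e f =>
  induction Z with
  | zero => simp only [LinearEquiv.map_zero, LinearMap.map_zero, TensorProduct.tmul_zero,
      TensorProduct.zero_tmul, TensorProduct.map_zero_left, TensorProduct.map_zero_right,
      LinearMap.zero_apply, LinearMap.comp_zero, LinearMap.zero_comp]
  | add x y hx hy => simp only [LinearMap.map_add, LinearEquiv.map_add, TensorProduct.add_tmul, TensorProduct.tmul_add, hx, hy,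
        TensorProduct.map_add_left, TensorProduct.map_add_right, LinearMap.add_apply,
        LinearMap.comp_add, LinearMap.add_comp]
  | tmul u v =>
  simp [hF, hG]
  ring

set_option linter.unusedSimpArgs false in
lemma cocycle_right (F G : (H ⊗[k] (B ⊗[k] H)) ⊗[k] B →ₗ[k] k)
    (hF : ∀ h y g z, F ((h ⊗ₜ (y ⊗ₜ g)) ⊗ₜ z) = counit (R := k) h * counit (R := k) y * p.val z g)
    (hG : ∀ h y g z, G ((h ⊗ₜ (y ⊗ₜ g)) ⊗ₜ z) = p.val (y * z) h * counit (R := k) g)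
    (X : H ⊗[k] H) (Y : B ⊗[k] B) (V : H ⊗[k] H) (Z : B ⊗[k] B) :
    LinearMap.mul' k k (TensorProduct.map F G
      (TensorProduct.AlgebraTensorModule.tensorTensorTensorComm k k k k _ _ _ _
        (TensorProduct.AlgebraTensorModule.tensorTensorTensorComm k k k k _ _ _ _
          (X ⊗ₜ TensorProduct.AlgebraTensorModule.tensorTensorTensorComm k k k k _ _ _ _
            (Y ⊗ₜ V)) ⊗ₜ Z))) =
    LinearMap.mul' k k (TensorProduct.map
      (p.val.flip (TensorProduct.rid k H ((counit (R := k) (A := H)).lTensor H V)))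
      (p.val.flip (TensorProduct.lid k H ((counit (R := k) (A := H)).rTensor H X)) ∘ₗ
        LinearMap.mul k B
          (TensorProduct.lid k B ((counit (R := k) (A := B)).rTensor B Y))) Z) := by
  induction X with
  | zero => simp only [LinearEquiv.map_zero, LinearMap.map_zero, TensorProduct.tmul_zero,
      TensorProduct.zero_tmul, TensorProduct.map_zero_left, TensorProduct.map_zero_right,
      LinearMap.zero_apply, LinearMap.comp_zero, LinearMap.zero_comp]
  | add x y hx hy => simp only [LinearMap.map_add, LinearEquiv.map_add, TensorProduct.add_tmul, TensorProduct.tmul_add, hx, hy,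
        TensorProduct.map_add_left, TensorProduct.map_add_right, LinearMap.add_apply,
        LinearMap.comp_add, LinearMap.add_comp]
  | tmul a b =>
  induction Y with
  | zero => simp only [LinearEquiv.map_zero, LinearMap.map_zero, TensorProduct.tmul_zero,
      TensorProduct.zero_tmul, TensorProduct.map_zero_left, TensorProduct.map_zero_right,
      LinearMap.zero_apply, LinearMap.comp_zero, LinearMap.zero_comp]
  | add x y hx hy => simp only [LinearMap.map_add, LinearEquiv.map_add, TensorProduct.add_tmul, TensorProduct.tmul_add, hx, hy,
        TensorProduct.map_add_left, TensorProduct.map_add_right, LinearMap.add_apply,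
        LinearMap.comp_add, LinearMap.add_comp]
  | tmul c d =>
  induction V with
  | zero => simp only [LinearEquiv.map_zero, LinearMap.map_zero, TensorProduct.tmul_zero,
      TensorProduct.zero_tmul, TensorProduct.map_zero_left, TensorProduct.map_zero_right,
      LinearMap.zero_apply, LinearMap.comp_zero, LinearMap.zero_comp]
  | add x y hx hy => simp only [LinearMap.map_add, LinearEquiv.map_add, TensorProduct.add_tmul, TensorProduct.tmul_add, hx, hy,
        TensorProduct.map_add_left, TensorProduct.map_add_right, LinearMap.add_apply,
        LinearMap.comp_add, LinearMap.add_comp]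
  | tmul e f =>
  induction Z with
  | zero => simp only [LinearEquiv.map_zero, LinearMap.map_zero, TensorProduct.tmul_zero,
      TensorProduct.zero_tmul, TensorProduct.map_zero_left, TensorProduct.map_zero_right,
      LinearMap.zero_apply, LinearMap.comp_zero, LinearMap.zero_comp]
  | add x y hx hy => simp only [LinearMap.map_add, LinearEquiv.map_add, TensorProduct.add_tmul, TensorProduct.tmul_add, hx, hy,
        TensorProduct.map_add_left, TensorProduct.map_add_right, LinearMap.add_apply,
        LinearMap.comp_add, LinearMap.add_comp]
  | tmul u v =>
  simp [hF, hG]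
  ring

lemma cocycle_middle (h g : H) (y z : B) :
    LinearMap.mul' k k (TensorProduct.map (p.val y)
      (p.val z ∘ₗ (LinearMap.mul k H).flip g) (comul (R := k) h)) =
    LinearMap.mul' k k (TensorProduct.map (p.val.flip g)
      (p.val.flip h ∘ₗ LinearMap.mul k B y) (comul (R := k) z)) := by
  simp only [← (ℛ k h).eq, ← (ℛ k z).eq, map_sum, TensorProduct.map_tmul, LinearMap.mul'_apply,
    LinearMap.comp_apply, LinearMap.flip_apply, LinearMap.mul_apply', val_mul_left,
    val_mul_right, Finset.mul_sum]
  rw [Finset.sum_comm]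
  refine Finset.sum_congr rfl fun i _ => Finset.sum_congr rfl fun j _ => ?_
  ring

lemma cocycle_aux (F G F' G' : (H ⊗[k] (B ⊗[k] H)) ⊗[k] B →ₗ[k] k)
    (hF : ∀ h y g z, F ((h ⊗ₜ (y ⊗ₜ g)) ⊗ₜ z) = p.val y h * counit (R := k) g * counit (R := k) z)
    (hG : ∀ h y g z, G ((h ⊗ₜ (y ⊗ₜ g)) ⊗ₜ z) = counit (R := k) y * p.val z (h * g))
    (hF' : ∀ h y g z, F' ((h ⊗ₜ (y ⊗ₜ g)) ⊗ₜ z) =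
      counit (R := k) h * counit (R := k) y * p.val z g)
    (hG' : ∀ h y g z, G' ((h ⊗ₜ (y ⊗ₜ g)) ⊗ₜ z) = p.val (y * z) h * counit (R := k) g) :
    toConv F * toConv G = toConv F' * toConv G' := by
  ext h y g z
  refine (p.cocycle_left F G hF hG (comul h) (comul y) (comul g) (comul z)).trans
    (Eq.trans ?_ (p.cocycle_right F' G' hF' hG' (comul h) (comul y) (comul g) (comul z)).symm)
  simp only [lTensor_counit_comul, rTensor_counit_comul, TensorProduct.lid_tmul,
    TensorProduct.rid_tmul, one_smul]
  exact p.cocycle_middle h g y z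

/-- A section of `tripleProj`. -/
def tripleSec (k B H : Type*) [CommRing k] [Ring B] [Ring H] [Bialgebra k B] [Bialgebra k H] :
    (H ⊗[k] (B ⊗[k] H)) ⊗[k] B →ₗ[k] ((B ⊗[k] H) ⊗[k] (B ⊗[k] H)) ⊗[k] (B ⊗[k] H) :=
  TensorProduct.map ((TensorProduct.mk k B H 1).rTensor (B ⊗[k] H))
    ((TensorProduct.mk k B H).flip 1)

lemma tauForm_cocycle :
    toConv (LinearMap.mul' k k ∘ₗ
        TensorProduct.map (tauForm p.val) (counit (R := k) (A := B ⊗[k] H))) *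
        toConv (tauForm p.val ∘ₗ (LinearMap.mul' k (B ⊗[k] H)).rTensor (B ⊗[k] H)) =
      toConv ((toConv (LinearMap.mul' k k ∘ₗ
          TensorProduct.map (counit (R := k) (A := B ⊗[k] H)) (tauForm p.val)) *
        toConv (tauForm p.val ∘ₗ (LinearMap.mul' k (B ⊗[k] H)).lTensor (B ⊗[k] H))).ofConv ∘ₗ
          (TensorProduct.assoc k (B ⊗[k] H) (B ⊗[k] H) (B ⊗[k] H)).toLinearMap) := by
  let α := (Coalgebra.TensorProduct.assoc k k (B ⊗[k] H) (B ⊗[k] H) (B ⊗[k] H)).toCoalgHom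
  let π := tripleProj k B H
  let s := tripleSec k B H
  let F₁ := LinearMap.mul' k k ∘ₗ
    TensorProduct.map (tauForm p.val) (counit (R := k) (A := B ⊗[k] H))
  let G₁ := tauForm p.val ∘ₗ (LinearMap.mul' k (B ⊗[k] H)).rTensor (B ⊗[k] H)
  let F₂ := (LinearMap.mul' k k ∘ₗ
    TensorProduct.map (counit (R := k) (A := B ⊗[k] H)) (tauForm p.val)) ∘ₗ α.toLinearMap
  let G₂ := (tauForm p.val ∘ₗ (LinearMap.mul' k (B ⊗[k] H)).lTensor (B ⊗[k] H)) ∘ₗ α.toLinearMap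
  have hπ : ∀ x h y g z w, π ((((x : B) ⊗ₜ (h : H)) ⊗ₜ ((y : B) ⊗ₜ (g : H))) ⊗ₜ ((z : B) ⊗ₜ (w : H))) =
    ((counit (R := k) x • h) ⊗ₜ (y ⊗ₜ g)) ⊗ₜ (counit (R := k) w • z) := fun _ _ _ _ _ _ => rfl
  have hα : ∀ a b c : B ⊗[k] H, α ((a ⊗ₜ b) ⊗ₜ c) = a ⊗ₜ (b ⊗ₜ c) := fun _ _ _ => rfl
  have main := p.cocycle_aux (F₁ ∘ₗ s) (G₁ ∘ₗ s) (F₂ ∘ₗ s) (G₂ ∘ₗ s)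
    (by intros; simp [F₁, s, tripleSec, tauForm_tmul])
    (by intros; simp [G₁, s, tripleSec, tauForm_tmul])
    (by intros; simp [F₂, hα, s, tripleSec, tauForm_tmul]; ring)
    (by intros; simp [G₂, hα, s, tripleSec, tauForm_tmul])
  have key : ∀ K : ((B ⊗[k] H) ⊗[k] (B ⊗[k] H)) ⊗[k] (B ⊗[k] H) →ₗ[k] k,
      (∀ x h y g z w, K ((((x : B) ⊗ₜ (h : H)) ⊗ₜ ((y : B) ⊗ₜ (g : H))) ⊗ₜ ((z : B) ⊗ₜ (w : H))) =
        counit (R := k) x * counit (R := k) w *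
          K ((((1 : B) ⊗ₜ h) ⊗ₜ (y ⊗ₜ g)) ⊗ₜ (z ⊗ₜ (1 : H)))) →
      (K ∘ₗ s) ∘ₗ π.toLinearMap = K := by
    intro K hK
    ext x h y g z w
    refine Eq.trans ?_ (hK x h y g z w).symm
    change K (s (π (((x ⊗ₜ h) ⊗ₜ (y ⊗ₜ g)) ⊗ₜ (z ⊗ₜ w)))) = _
    rw [hπ]
    simp [s, tripleSec, ← TensorProduct.smul_tmul', mul_left_comm, mul_assoc]
  have h₁ := conv_comp_mul (toConv (F₁ ∘ₗ s)) (toConv (G₁ ∘ₗ s)) π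
  have h₂ := conv_comp_mul (toConv (F₂ ∘ₗ s)) (toConv (G₂ ∘ₗ s)) π
  rw [main] at h₁
  have h₃ := h₁.symm.trans h₂
  simp only at h₃
  rw [key F₁, key G₁, key F₂, key G₂] at h₃
  · exact h₃.trans (conv_comp_mul _ _ α).symm
  · intros; simp [G₂, hα, tauForm_tmul]; ring
  · intros; simp [F₂, hα, tauForm_tmul]; ring
  · intros; simp [G₁, tauForm_tmul]; ring
  · intros; simp [F₁, tauForm_tmul]; ring

end

variable [HopfAlgebra k B] [HopfAlgebra k H] (p : SkewPairing k B H)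

/-- The convolution inverse `℘⁻¹(b, h) = ℘(S b, h)`. -/
def valInv : B →ₗ[k] H →ₗ[k] k := p.val ∘ₗ HopfAlgebra.antipode k

lemma lift_conv_lift_apply (φ ψ : B →ₗ[k] H →ₗ[k] k) (X : H ⊗[k] H) (b b' : B) :
    LinearMap.mul' k k (TensorProduct.map (TensorProduct.lift φ.flip) (TensorProduct.lift ψ.flip)
      (TensorProduct.AlgebraTensorModule.tensorTensorTensorComm k k k k H H B B
        (X ⊗ₜ (b ⊗ₜ b')))) =
    LinearMap.mul' k k (TensorProduct.map (φ b) (ψ b') X) := by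
  induction X with
  | zero => simp
  | add x y hx hy => simp only [map_add, TensorProduct.add_tmul, hx, hy]
  | tmul c d => simp

lemma val_conv_valInv :
    toConv (TensorProduct.lift p.val.flip) * toConv (TensorProduct.lift p.valInv.flip) = 1 := by
  have key : ∀ (h : H) (Y : B ⊗[k] B),
      LinearMap.mul' k k (TensorProduct.map (TensorProduct.lift p.val.flip)
        (TensorProduct.lift p.valInv.flip)
        (TensorProduct.AlgebraTensorModule.tensorTensorTensorComm k k k k H H B B
          (comul (R := k) h ⊗ₜ Y))) =
      p.val (LinearMap.mul' k B ((HopfAlgebra.antipode k).lTensor B Y)) h := by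
    intro h Y
    induction Y with
    | zero => simp
    | add x y hx hy => simp only [map_add, TensorProduct.tmul_add, hx, hy, LinearMap.add_apply]
    | tmul c d => rw [lift_conv_lift_apply]; exact (p.val_mul_left _ _ _).symm
  ext h b
  refine (key h (comul b)).trans ?_
  rw [HopfAlgebra.mul_antipode_lTensor_comul_apply, Algebra.algebraMap_eq_smul_one]
  simp [val_one_left]

lemma valInv_conv_val :
    toConv (TensorProduct.lift p.valInv.flip) * toConv (TensorProduct.lift p.val.flip) = 1 := by
  have key : ∀ (h : H) (Y : B ⊗[k] B),
      LinearMap.mul' k k (TensorProduct.map (TensorProduct.lift p.valInv.flip)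
        (TensorProduct.lift p.val.flip)
        (TensorProduct.AlgebraTensorModule.tensorTensorTensorComm k k k k H H B B
          (comul (R := k) h ⊗ₜ Y))) =
      p.val (LinearMap.mul' k B ((HopfAlgebra.antipode k).rTensor B Y)) h := by
    intro h Y
    induction Y with
    | zero => simp
    | add x y hx hy => simp only [map_add, TensorProduct.tmul_add, hx, hy, LinearMap.add_apply]
    | tmul c d => rw [lift_conv_lift_apply]; exact (p.val_mul_left _ _ _).symm
  ext h b
  refine (key h (comul b)).trans ?_
  rw [HopfAlgebra.mul_antipode_rTensor_comul_apply, Algebra.algebraMap_eq_smul_one]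
  simp [val_one_left]

/-- The 2-cocycle `τ(b ⊗ h, b' ⊗ h') = ε(b) ℘(b', h) ε(h')` on `B ⊗ H`. -/
def cocycle : TwoCocycle k (B ⊗[k] H) where
  form := tauForm p.val
  inv := tauForm p.valInv
  mul_inv := tauForm_conv _ _ p.val_conv_valInv
  inv_mul := tauForm_conv _ _ p.valInv_conv_val
  cocycle := p.tauForm_cocycle
  one_left a := by
    induction a with
    | zero => simp
    | add x y hx hy => simp only [map_add, TensorProduct.tmul_add, hx, hy]
    | tmul b h => simp [Algebra.TensorProduct.one_def, tauForm_tmul, val_one_right, mul_comm]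
  one_right a := by
    induction a with
    | zero => simp
    | add x y hx hy => simp only [map_add, TensorProduct.add_tmul, hx, hy]
    | tmul b h => simp [Algebra.TensorProduct.one_def, tauForm_tmul, val_one_left, mul_comm]

end SkewPairing

/-- The generalized quantum double `D(B, H) = (B ⊗ H)^τ` of two Hopf algebras with a skew pairing
`℘`, where `τ(b ⊗ h, b' ⊗ h') = ε(b) ℘(b', h) ε(h')`.  Its multiplication is
`(b ⊗ h)(b' ⊗ h') = ℘(b'₁, h₁) ℘⁻¹(b'₃, h₃) b b'₂ ⊗ h₂ h'`. -/
abbrev GenDouble {k B H : Type*} [CommRing k] [Ring B] [Ring H] [HopfAlgebra k B]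
    [HopfAlgebra k H] (p : SkewPairing k B H) : Type _ :=
  CocycleTwist p.cocycle

namespace GenDouble

variable {k B H : Type*} [CommRing k] [Ring B] [Ring H] [HopfAlgebra k B] [HopfAlgebra k H]
  (p : SkewPairing k B H)

/-- The element `b ⊗ h` of the double. -/
def tmul (b : B) (h : H) : GenDouble p := CocycleTwist.of p.cocycle (b ⊗ₜ[k] h)

lemma tmul_one_mul (b b' : B) (h : H) : tmul p b 1 * tmul p b' h = tmul p (b * b') h := by
  have := p.cocycle.mulMap_comp_of_trivial
    (Coalgebra.TensorProduct.map (TwoCocycle.tmulOne k B H) (CoalgHom.id k (B ⊗[k] H)))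
    (by
      ext b b' h
      simp [TwoCocycle.tmulOne, SkewPairing.cocycle, SkewPairing.tauForm_tmul,
        SkewPairing.val_one_right, mul_comm, mul_assoc]) (b ⊗ₜ (b' ⊗ₜ h))
  refine this.trans ?_
  change (b ⊗ₜ[k] (1 : H)) * (b' ⊗ₜ[k] h) = _
  rw [Algebra.TensorProduct.tmul_mul_tmul, one_mul]
  rfl

lemma mul_one_tmul (b : B) (h h' : H) : tmul p b h * tmul p 1 h' = tmul p b (h * h') := by
  have := p.cocycle.mulMap_comp_of_trivial
    (Coalgebra.TensorProduct.map (CoalgHom.id k (B ⊗[k] H)) (TwoCocycle.oneTmul k B H))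
    (by
      ext b h h'
      simp [TwoCocycle.oneTmul, SkewPairing.cocycle, SkewPairing.tauForm_tmul,
        SkewPairing.val_one_left, mul_comm, mul_left_comm]) ((b ⊗ₜ h) ⊗ₜ h')
  refine this.trans ?_
  change (b ⊗ₜ[k] h) * ((1 : B) ⊗ₜ[k] h') = _
  rw [Algebra.TensorProduct.tmul_mul_tmul, mul_one]
  rfl

/-- The inclusion `b ↦ b ⊗ 1` of `B` into the double. -/
def inl : B →ₐ[k] GenDouble p :=
  AlgHom.ofLinearMap ((CocycleTwist.of p.cocycle).toLinearMap ∘ₗ (TensorProduct.mk k B H).flip 1)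
    rfl (fun x y => (tmul_one_mul p x y 1).symm)

/-- The inclusion `h ↦ 1 ⊗ h` of `H` into the double. -/
def inr : H →ₐ[k] GenDouble p :=
  AlgHom.ofLinearMap ((CocycleTwist.of p.cocycle).toLinearMap ∘ₗ TensorProduct.mk k B H 1)
    rfl (fun x y => (mul_one_tmul p 1 x y).symm)

lemma inl_mul_inr (b : B) (h : H) : inl p b * inr p h = tmul p b h :=
  (tmul_one_mul p b 1 h).trans (by rw [mul_one])

/-- The antipode `b ⊗ h ↦ (1 ⊗ S h)(S b ⊗ 1)`. -/
def antipodeMap : B ⊗[k] H →ₗ[k] GenDouble p :=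
  TensorProduct.lift ((LinearMap.mul k (GenDouble p)).flip.compl₁₂
    ((inl p).toLinearMap ∘ₗ HopfAlgebra.antipode k)
    ((inr p).toLinearMap ∘ₗ HopfAlgebra.antipode k))

open SkewPairing in
lemma conv_proj {D : Type*} [Ring D] [Algebra k D] (f : B →ₗ[k] D) (g : H →ₗ[k] D) :
    toConv (f ∘ₗ (projLeft k B H).toCoalgHom.toLinearMap) *
      toConv (g ∘ₗ (projRight k B H).toCoalgHom.toLinearMap) =
    toConv (TensorProduct.lift ((LinearMap.mul k D).compl₁₂ f g)) := by
  have h1 : ∀ b h, (projRight k B H).toCoalgHom (b ⊗ₜ h) = counit (R := k) b • h := fun _ _ => rfl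
  have h2 : ∀ b h, (projLeft k B H).toCoalgHom (b ⊗ₜ h) = counit (R := k) h • b := fun _ _ => rfl
  have key : ∀ (X : B ⊗[k] B) (Y : H ⊗[k] H),
      LinearMap.mul' k D (TensorProduct.map (f ∘ₗ (projLeft k B H).toCoalgHom.toLinearMap)
        (g ∘ₗ (projRight k B H).toCoalgHom.toLinearMap)
        (TensorProduct.AlgebraTensorModule.tensorTensorTensorComm k k k k B B H H (X ⊗ₜ Y))) =
      f (TensorProduct.rid k B ((counit (R := k) (A := B)).lTensor B X)) *
        g (TensorProduct.lid k H ((counit (R := k) (A := H)).rTensor H Y)) := by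
    intro X Y
    induction X with
    | zero => simp
    | add x y hx hy => simp only [map_add, TensorProduct.add_tmul, hx, hy, add_mul]
    | tmul a b =>
      induction Y with
      | zero => simp
      | add x y hx hy => simp only [map_add, TensorProduct.tmul_add, hx, hy, mul_add]
      | tmul c d => simp [h1, h2, smul_smul, mul_comm]
  ext b h
  refine (key (comul b) (comul h)).trans ?_
  simp

open SkewPairing in
lemma conv_proj' {D : Type*} [Ring D] [Algebra k D] (f : B →ₗ[k] D) (g : H →ₗ[k] D) :
    toConv (g ∘ₗ (projRight k B H).toCoalgHom.toLinearMap) *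
      toConv (f ∘ₗ (projLeft k B H).toCoalgHom.toLinearMap) =
    toConv (TensorProduct.lift ((LinearMap.mul k D).flip.compl₁₂ f g)) := by
  have h1 : ∀ b h, (projRight k B H).toCoalgHom (b ⊗ₜ h) = counit (R := k) b • h := fun _ _ => rfl
  have h2 : ∀ b h, (projLeft k B H).toCoalgHom (b ⊗ₜ h) = counit (R := k) h • b := fun _ _ => rfl
  have key : ∀ (X : B ⊗[k] B) (Y : H ⊗[k] H),
      LinearMap.mul' k D (TensorProduct.map (g ∘ₗ (projRight k B H).toCoalgHom.toLinearMap)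
        (f ∘ₗ (projLeft k B H).toCoalgHom.toLinearMap)
        (TensorProduct.AlgebraTensorModule.tensorTensorTensorComm k k k k B B H H (X ⊗ₜ Y))) =
      g (TensorProduct.rid k H ((counit (R := k) (A := H)).lTensor H Y)) *
      f (TensorProduct.lid k B ((counit (R := k) (A := B)).rTensor B X)) := by
    intro X Y
    induction X with
    | zero => simp
    | add x y hx hy => simp only [map_add, TensorProduct.add_tmul, hx, hy, mul_add]
    | tmul a b =>
      induction Y with
      | zero => simp
      | add x y hx hy => simp only [map_add, TensorProduct.tmul_add, hx, hy, add_mul]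
      | tmul c d => simp [h1, h2, smul_smul, mul_comm]
  ext b h
  refine (key (comul b) (comul h)).trans ?_
  simp

lemma conv_algHom_comp {A D C : Type*} [Ring A] [HopfAlgebra k A] [Ring D] [Algebra k D]
    [AddCommMonoid C] [Module k C] [Coalgebra k C] (f : A →ₐ[k] D) (π : C →ₗc[k] A)
    (u v : A →ₗ[k] A) (huv : toConv u * toConv v = 1) :
    toConv ((f.toLinearMap ∘ₗ u) ∘ₗ π.toLinearMap) *
      toConv ((f.toLinearMap ∘ₗ v) ∘ₗ π.toLinearMap) = 1 := by
  have h1 := LinearMap.algHom_comp_convMul_distrib f (toConv u) (toConv v)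
  have h2 := conv_comp_mul (toConv (f.toLinearMap ∘ₗ u)) (toConv (f.toLinearMap ∘ₗ v)) π
  refine h2.symm.trans ?_
  have h3 : toConv (f.toLinearMap ∘ₗ u) * toConv (f.toLinearMap ∘ₗ v) = 1 := by
    refine (ofConv_injective h1).symm.trans ?_
    rw [huv]
    ext a
    simp [LinearMap.convOne_def]
  rw [h3, conv_comp_one]

instance : HopfAlgebra k (GenDouble p) :=
  have hS : toConv (antipodeMap p) = _ := (conv_proj' _ _).symm
  have hid : toConv (CocycleTwist.of p.cocycle).toLinearMap =
      toConv (((inl p).toLinearMap ∘ₗ LinearMap.id) ∘ₗ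
          (SkewPairing.projLeft k B H).toCoalgHom.toLinearMap) *
        toConv (((inr p).toLinearMap ∘ₗ LinearMap.id) ∘ₗ
          (SkewPairing.projRight k B H).toCoalgHom.toLinearMap) := by
    rw [conv_proj]
    ext b h
    exact (inl_mul_inr p b h).symm
  have l₁ := conv_algHom_comp (inl p) (SkewPairing.projLeft k B H).toCoalgHom _ _
    (LinearMap.antipode_mul_id (R := k) (C := B))
  have l₂ := conv_algHom_comp (inl p) (SkewPairing.projLeft k B H).toCoalgHom _ _
    (LinearMap.id_mul_antipode (R := k) (C := B))
  have r₁ := conv_algHom_comp (inr p) (SkewPairing.projRight k B H).toCoalgHom _ _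
    (LinearMap.antipode_mul_id (R := k) (C := H))
  have r₂ := conv_algHom_comp (inr p) (SkewPairing.projRight k B H).toCoalgHom _ _
    (LinearMap.id_mul_antipode (R := k) (C := H))
  HopfAlgebra.ofConvInverse (antipodeMap p ∘ₗ (CocycleTwist.of p.cocycle).symm.toLinearMap)
    (by
      have : toConv (antipodeMap p) * toConv (CocycleTwist.of p.cocycle).toLinearMap = 1 := by
        rw [hS, hid, mul_assoc, ← mul_assoc _ _ (toConv (((inr p).toLinearMap ∘ₗ _) ∘ₗ _)), l₁,
          one_mul, r₁]
      exact this)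
    (by
      have : toConv (CocycleTwist.of p.cocycle).toLinearMap * toConv (antipodeMap p) = 1 := by
        rw [hS, hid, mul_assoc, ← mul_assoc _ _ (toConv (((inl p).toLinearMap ∘ₗ _) ∘ₗ _)), r₂,
          one_mul, l₂]
      exact this)

end GenDouble

/-- Generators `K̂_i^{±1}` for `1 ≤ i ≤ N`, where `N = n + 1`, together with `E_s` (if `e` holds)
and `F_s` (if `f` holds) for `1 ≤ s ≤ N - 1`. -/
inductive QGen (n : ℕ) (e f : Prop) : Type
  | K (i : Fin (n + 1))
  | Kinv (i : Fin (n + 1))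
  | E (he : e) (s : Fin n)
  | F (hf : f) (s : Fin n)

/-- The integer `δ_{i,s} - δ_{i,s+1}`. -/
def qWeight {n : ℕ} (i : Fin (n + 1)) (s : Fin n) : ℤ :=
  (if i = s.castSucc then 1 else 0) - (if i = s.succ then 1 else 0)

section Relations

variable (k : Type*) [Field k] {n : ℕ} {e f : Prop}

/-- The generator `K̂_i` in the free algebra. -/
abbrev fK (i : Fin (n + 1)) : FreeAlgebra k (QGen n e f) := FreeAlgebra.ι k (QGen.K i)

/-- The generator `K̂_i⁻¹` in the free algebra. -/
abbrev fKinv (i : Fin (n + 1)) : FreeAlgebra k (QGen n e f) := FreeAlgebra.ι k (QGen.Kinv i)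

/-- The generator `E_s` in the free algebra. -/
abbrev fE (he : e) (s : Fin n) : FreeAlgebra k (QGen n e f) := FreeAlgebra.ι k (QGen.E he s)

/-- The generator `F_s` in the free algebra. -/
abbrev fF (hf : f) (s : Fin n) : FreeAlgebra k (QGen n e f) := FreeAlgebra.ι k (QGen.F hf s)

/-- The defining relations of the extended quantized enveloping algebra of `sl_N`, `N = n + 1`,
restricted to the generators that are present. -/
inductive QRel (q : kˣ) : FreeAlgebra k (QGen n e f) → FreeAlgebra k (QGen n e f) → Prop
  | K_comm (i j : Fin (n + 1)) : QRel q (fK k i * fK k j) (fK k j * fK k i)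
  | K_Kinv (i : Fin (n + 1)) : QRel q (fK k i * fKinv k i) 1
  | Kinv_K (i : Fin (n + 1)) : QRel q (fKinv k i * fK k i) 1
  | K_prod : QRel q (List.ofFn fun i : Fin (n + 1) => fK k i).prod 1
  | K_E (he : e) (i : Fin (n + 1)) (t : Fin n) :
      QRel q (fK k i * fE k he t * fKinv k i) (((q ^ qWeight i t : kˣ) : k) • fE k he t)
  | E_comm (he : e) (s t : Fin n) (h : 1 < |(s : ℤ) - (t : ℤ)|) :
      QRel q (fE k he t * fE k he s) (fE k he s * fE k he t)
  | E_serre (he : e) (s t : Fin n) (h : |(s : ℤ) - (t : ℤ)| = 1) :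
      QRel q (fE k he s ^ 2 * fE k he t
        - ((q : k) + (q : k)⁻¹) • (fE k he s * fE k he t * fE k he s)
        + fE k he t * fE k he s ^ 2) 0
  | K_F (hf : f) (i : Fin (n + 1)) (t : Fin n) :
      QRel q (fK k i * fF k hf t * fKinv k i) (((q ^ (-qWeight i t) : kˣ) : k) • fF k hf t)
  | F_comm (hf : f) (s t : Fin n) (h : 1 < |(s : ℤ) - (t : ℤ)|) :
      QRel q (fF k hf t * fF k hf s) (fF k hf s * fF k hf t)
  | F_serre (hf : f) (s t : Fin n) (h : |(s : ℤ) - (t : ℤ)| = 1) :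
      QRel q (fF k hf s ^ 2 * fF k hf t
        - ((q : k) + (q : k)⁻¹) • (fF k hf s * fF k hf t * fF k hf s)
        + fF k hf t * fF k hf s ^ 2) 0
  | E_F_same (he : e) (hf : f) (s : Fin n) :
      QRel q (fE k he s * fF k hf s - fF k hf s * fE k he s)
        (((q : k) - (q : k)⁻¹)⁻¹ • (fK k s.castSucc * fKinv k s.succ
          - fKinv k s.castSucc * fK k s.succ))
  | E_F_ne (he : e) (hf : f) (s t : Fin n) (h : s ≠ t) :
      QRel q (fE k he s * fF k hf t - fF k hf t * fE k he s) 0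

end Relations

/-- The algebra with generators `QGen n e f` and relations `QRel`. -/
def QAlg (k : Type*) [Field k] (q : kˣ) (n : ℕ) (e f : Prop) : Type _ :=
  RingQuot (QRel k q (n := n) (e := e) (f := f))

instance (k : Type*) [Field k] (q : kˣ) (n : ℕ) (e f : Prop) : Ring (QAlg k q n e f) :=
  inferInstanceAs (Ring (RingQuot _))

instance (k : Type*) [Field k] (q : kˣ) (n : ℕ) (e f : Prop) : Algebra k (QAlg k q n e f) :=
  inferInstanceAs (Algebra k (RingQuot _))

section Families

variable {k : Type*} [Field k] {n : ℕ} {A : Type*} [Ring A] [Algebra k A]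

/-- A commuting family of invertible elements with product one. -/
structure IsTorus (K Kinv : Fin (n + 1) → A) : Prop where
  comm : ∀ i j, K i * K j = K j * K i
  mul_inv : ∀ i, K i * Kinv i = 1
  inv_mul : ∀ i, Kinv i * K i = 1
  prod : (List.ofFn K).prod = 1

/-- The relations involving one family of root vectors. -/
structure IsBorel (q : kˣ) (K Kinv : Fin (n + 1) → A) (X : Fin n → A) : Prop where
  weight : ∀ i t, K i * X t * Kinv i = ((q ^ qWeight i t : kˣ) : k) • X t
  comm : ∀ s t : Fin n, 1 < |(s : ℤ) - (t : ℤ)| → X t * X s = X s * X t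
  serre : ∀ s t : Fin n, |(s : ℤ) - (t : ℤ)| = 1 →
    X s ^ 2 * X t - ((q : k) + (q : k)⁻¹) • (X s * X t * X s) + X t * X s ^ 2 = 0

/-- The relations between the two families of root vectors. -/
structure IsCross (q : kˣ) (K Kinv : Fin (n + 1) → A) (E F : Fin n → A) : Prop where
  same : ∀ s, E s * F s - F s * E s = ((q : k) - (q : k)⁻¹)⁻¹ •
    (K s.castSucc * Kinv s.succ - Kinv s.castSucc * K s.succ)
  ne : ∀ s t, s ≠ t → E s * F t - F t * E s = 0

/-- Images of the generators in an algebra, satisfying the defining relations. -/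
structure QRep (k : Type*) [Field k] (q : kˣ) (n : ℕ) (e f : Prop) (A : Type*) [Ring A]
    [Algebra k A] where
  K : Fin (n + 1) → A
  Kinv : Fin (n + 1) → A
  E : e → Fin n → A
  F : f → Fin n → A
  torus : IsTorus K Kinv
  borelE : ∀ he, IsBorel q K Kinv (E he)
  borelF : ∀ hf, IsBorel q⁻¹ K Kinv (F hf)
  cross : ∀ he hf, IsCross q K Kinv (E he) (F hf)

/-- The value of a family of images on a generator. -/
def QRep.eval {q : kˣ} {e f : Prop} (r : QRep k q n e f A) : QGen n e f → A
  | .K i => r.K i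
  | .Kinv i => r.Kinv i
  | .E he s => r.E he s
  | .F hf s => r.F hf s

end Families

namespace QAlg

variable (k : Type*) [Field k] (q : kˣ) {n : ℕ} {e f : Prop}

/-- The quotient map from the free algebra. -/
def mk : FreeAlgebra k (QGen n e f) →ₐ[k] QAlg k q n e f := RingQuot.mkAlgHom k (QRel k q)

/-- The generator `K̂_i`. -/
def K (i : Fin (n + 1)) : QAlg k q n e f := mk k q (fK k i)

/-- The generator `K̂_i⁻¹`. -/
def Kinv (i : Fin (n + 1)) : QAlg k q n e f := mk k q (fKinv k i)

/-- The generator `E_s`. -/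
def E (he : e) (s : Fin n) : QAlg k q n e f := mk k q (fE k he s)

/-- The generator `F_s`. -/
def F (hf : f) (s : Fin n) : QAlg k q n e f := mk k q (fF k hf s)

lemma mk_rel {x y : FreeAlgebra k (QGen n e f)} (h : QRel k q x y) : mk k q x = mk k q y :=
  RingQuot.mkAlgHom_rel k h

variable (n e f) in
/-- The defining relations hold in the quotient. -/
def gens : QRep k q n e f (QAlg k q n e f) where
  K := K k q
  Kinv := Kinv k q
  E := E k q
  F := F k q
  torus :=
    { comm := fun i j => by simpa [K] using mk_rel k q (QRel.K_comm i j)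
      mul_inv := fun i => by simpa [K, Kinv] using mk_rel k q (QRel.K_Kinv i)
      inv_mul := fun i => by simpa [K, Kinv] using mk_rel k q (QRel.Kinv_K i)
      prod := by
        have := mk_rel k q (QRel.K_prod (e := e) (f := f) (n := n))
        rw [map_list_prod, List.map_ofFn, map_one] at this
        exact this }
  borelE he :=
    { weight := fun i t => by simpa [K, Kinv, E] using mk_rel k q (QRel.K_E he i t)
      comm := fun s t h => by simpa [E] using mk_rel k q (QRel.E_comm he s t h)
      serre := fun s t h => by simpa [E] using mk_rel k q (QRel.E_serre he s t h) }
  borelF hf :=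
    { weight := fun i t => by simpa [K, Kinv, F] using mk_rel k q (QRel.K_F hf i t)
      comm := fun s t h => by simpa [F] using mk_rel k q (QRel.F_comm hf s t h)
      serre := fun s t h => by
        simpa [F, add_comm (q : k)⁻¹] using mk_rel k q (QRel.F_serre hf s t h) }
  cross he hf :=
    { same := fun s => by simpa [K, Kinv, E, F] using mk_rel k q (QRel.E_F_same he hf s)
      ne := fun s t h => by simpa [E, F] using mk_rel k q (QRel.E_F_ne he hf s t h) }

variable {k q} {A : Type*} [Ring A] [Algebra k A]

/-- The universal property of the presentation. -/
def lift (r : QRep k q n e f A) : QAlg k q n e f →ₐ[k] A :=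
  RingQuot.liftAlgHom k ⟨FreeAlgebra.lift k r.eval, by
    intro x y h
    induction h with
    | K_comm i j => simpa [QRep.eval] using r.torus.comm i j
    | K_Kinv i => simpa [QRep.eval] using r.torus.mul_inv i
    | Kinv_K i => simpa [QRep.eval] using r.torus.inv_mul i
    | K_prod =>
      rw [map_list_prod, List.map_ofFn, map_one]
      refine Eq.trans ?_ r.torus.prod
      congr 2
      ext i
      simp [QRep.eval]
    | K_E he i t => simpa [QRep.eval] using (r.borelE he).weight i t
    | E_comm he s t h => simpa [QRep.eval] using (r.borelE he).comm s t h
    | E_serre he s t h => simpa [QRep.eval] using (r.borelE he).serre s t h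
    | K_F hf i t => simpa [QRep.eval] using (r.borelF hf).weight i t
    | F_comm hf s t h => simpa [QRep.eval] using (r.borelF hf).comm s t h
    | F_serre hf s t h => simpa [QRep.eval, add_comm (q : k)⁻¹] using (r.borelF hf).serre s t h
    | E_F_same he hf s => simpa [QRep.eval] using (r.cross he hf).same s
    | E_F_ne he hf s t h => simpa [QRep.eval] using (r.cross he hf).ne s t h⟩

lemma lift_mk (r : QRep k q n e f A) (x : FreeAlgebra k (QGen n e f)) :
    lift r (mk k q x) = FreeAlgebra.lift k r.eval x :=
  RingQuot.liftAlgHom_mkAlgHom_apply k _ _ x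

@[simp] lemma lift_K (r : QRep k q n e f A) (i : Fin (n + 1)) : lift r (K k q i) = r.K i := by
  rw [K, lift_mk]; exact FreeAlgebra.lift_ι_apply _ _

@[simp] lemma lift_Kinv (r : QRep k q n e f A) (i : Fin (n + 1)) :
    lift r (Kinv k q i) = r.Kinv i := by
  rw [Kinv, lift_mk]; exact FreeAlgebra.lift_ι_apply _ _

@[simp] lemma lift_E (r : QRep k q n e f A) (he : e) (s : Fin n) :
    lift r (E k q he s) = r.E he s := by
  rw [E, lift_mk]; exact FreeAlgebra.lift_ι_apply _ _

@[simp] lemma lift_F (r : QRep k q n e f A) (hf : f) (s : Fin n) :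
    lift r (F k q hf s) = r.F hf s := by
  rw [F, lift_mk]; exact FreeAlgebra.lift_ι_apply _ _

/-- A subalgebra that contains the generators is everything. -/
lemma mem_of_gens (S : Subalgebra k (QAlg k q n e f)) (hK : ∀ i, K k q i ∈ S)
    (hKinv : ∀ i, Kinv k q i ∈ S) (hE : ∀ he s, E k q he s ∈ S) (hF : ∀ hf s, F k q hf s ∈ S)
    (x : QAlg k q n e f) : x ∈ S := by
  obtain ⟨y, rfl⟩ : ∃ y, mk k q y = x := RingQuot.mkAlgHom_surjective k _ x
  induction y using FreeAlgebra.induction with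
  | grade0 r => rw [AlgHom.commutes]; exact S.algebraMap_mem r
  | grade1 g => cases g with
    | K i => exact hK i
    | Kinv i => exact hKinv i
    | E he s => exact hE he s
    | F hf s => exact hF hf s
  | mul a b ha hb => rw [map_mul]; exact S.mul_mem ha hb
  | add a b ha hb => rw [map_add]; exact S.add_mem ha hb

lemma algHom_ext {φ ψ : QAlg k q n e f →ₐ[k] A} (hK : ∀ i, φ (K k q i) = ψ (K k q i))
    (hKinv : ∀ i, φ (Kinv k q i) = ψ (Kinv k q i)) (hE : ∀ he s, φ (E k q he s) = ψ (E k q he s))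
    (hF : ∀ hf s, φ (F k q hf s) = ψ (F k q hf s)) : φ = ψ :=
  AlgHom.ext fun x => mem_of_gens (AlgHom.equalizer φ ψ) hK hKinv hE hF x

end QAlg

section Families

variable {k : Type*} [Field k] {n : ℕ} {A : Type*} [Ring A] [Algebra k A]

/-- The entries of the Cartan matrix of `sl_N`. -/
def qCartan {n : ℕ} (s t : Fin n) : ℤ := qWeight s.castSucc t - qWeight s.succ t

lemma qCartan_self (s : Fin n) : qCartan s s = 2 := by
  simp only [qCartan, qWeight, Fin.ext_iff, Fin.val_castSucc, Fin.val_succ]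
  split_ifs <;> omega

lemma qCartan_comm (s t : Fin n) : qCartan s t = qCartan t s := by
  simp only [qCartan, qWeight, Fin.ext_iff, Fin.val_castSucc, Fin.val_succ]
  split_ifs <;> omega

lemma qCartan_near {s t : Fin n} (h : |(s : ℤ) - (t : ℤ)| = 1) : qCartan s t = -1 := by
  simp only [qCartan, qWeight, Fin.ext_iff, Fin.val_castSucc, Fin.val_succ]
  rcases (abs_eq one_pos.le).1 h with h | h <;> split_ifs <;> omega

lemma qCartan_far {s t : Fin n} (h : 1 < |(s : ℤ) - (t : ℤ)|) : qCartan s t = 0 := by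
  simp only [qCartan, qWeight, Fin.ext_iff, Fin.val_castSucc, Fin.val_succ]
  rcases lt_abs.1 h with h | h <;> split_ifs <;> omega

namespace IsTorus

variable {K Kinv : Fin (n + 1) → A}

lemma commute (hK : IsTorus K Kinv) (i j : Fin (n + 1)) : Commute (K i) (K j) := hK.comm i j

lemma commute_inv_left (hK : IsTorus K Kinv) (i j : Fin (n + 1)) : Commute (Kinv i) (K j) := by
  let u : Aˣ := ⟨K i, Kinv i, hK.mul_inv i, hK.inv_mul i⟩
  have : Commute (u : A) (K j) := hK.comm i j
  exact this.units_inv_left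

lemma commute_inv (hK : IsTorus K Kinv) (i j : Fin (n + 1)) : Commute (Kinv i) (Kinv j) := by
  let u : Aˣ := ⟨K j, Kinv j, hK.mul_inv j, hK.inv_mul j⟩
  have : Commute (Kinv i) (u : A) := hK.commute_inv_left i j
  exact this.units_inv_right

end IsTorus

/-- The element `K̂_s K̂_{s+1}⁻¹`. -/
def kd (K Kinv : Fin (n + 1) → A) (s : Fin n) : A := K s.castSucc * Kinv s.succ

/-- The element `K̂_s⁻¹ K̂_{s+1}`. -/
def ld (K Kinv : Fin (n + 1) → A) (s : Fin n) : A := Kinv s.castSucc * K s.succ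

namespace IsTorus

variable {K Kinv : Fin (n + 1) → A}

lemma kd_mul_ld (hK : IsTorus K Kinv) (s : Fin n) : kd K Kinv s * ld K Kinv s = 1 := by
  rw [kd, ld, mul_assoc, ← mul_assoc (Kinv s.succ), (hK.commute_inv _ _).eq, mul_assoc,
    hK.inv_mul, mul_one, hK.mul_inv]

lemma ld_mul_kd (hK : IsTorus K Kinv) (s : Fin n) : ld K Kinv s * kd K Kinv s = 1 := by
  rw [kd, ld, mul_assoc, ← mul_assoc (K s.succ), (hK.commute _ _).eq, mul_assoc,
    hK.mul_inv, mul_one, hK.inv_mul]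

lemma commute_K_kd (hK : IsTorus K Kinv) (i : Fin (n + 1)) (s : Fin n) :
    Commute (K i) (kd K Kinv s) :=
  (hK.commute _ _).mul_right (hK.commute_inv_left _ _).symm

lemma commute_K_ld (hK : IsTorus K Kinv) (i : Fin (n + 1)) (s : Fin n) :
    Commute (K i) (ld K Kinv s) :=
  (hK.commute_inv_left _ _).symm.mul_right (hK.commute _ _)

lemma commute_Kinv_kd (hK : IsTorus K Kinv) (i : Fin (n + 1)) (s : Fin n) :
    Commute (Kinv i) (kd K Kinv s) :=
  (hK.commute_inv_left _ _).mul_right (hK.commute_inv _ _)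

lemma commute_Kinv_ld (hK : IsTorus K Kinv) (i : Fin (n + 1)) (s : Fin n) :
    Commute (Kinv i) (ld K Kinv s) :=
  (hK.commute_inv _ _).mul_right (hK.commute_inv_left _ _)

lemma commute_kd_kd (hK : IsTorus K Kinv) (s t : Fin n) :
    Commute (kd K Kinv s) (kd K Kinv t) :=
  (hK.commute_K_kd _ _).mul_left (hK.commute_Kinv_kd _ _)

lemma commute_ld_ld (hK : IsTorus K Kinv) (s t : Fin n) :
    Commute (ld K Kinv s) (ld K Kinv t) :=
  (hK.commute_Kinv_ld _ _).mul_left (hK.commute_K_ld _ _)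

lemma commute_kd_ld (hK : IsTorus K Kinv) (s t : Fin n) :
    Commute (kd K Kinv s) (ld K Kinv t) :=
  (hK.commute_K_ld _ _).mul_left (hK.commute_Kinv_ld _ _)

end IsTorus

/-- If two families satisfy the quantum Serre relation and `q`-commute, so does their sum. -/
lemma serre_add (a : k) (ha : a ≠ 0) (x y u v : A) (h1 : x * u = (a ^ (-2 : ℤ)) • (u * x))
    (h2 : x * v = a • (v * x)) (h3 : y * u = a • (u * y))
    (hX : x ^ 2 * y - (a + a⁻¹) • (x * y * x) + y * x ^ 2 = 0)
    (hY : u ^ 2 * v - (a + a⁻¹) • (u * v * u) + v * u ^ 2 = 0) :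
    (x + u) ^ 2 * (y + v) - (a + a⁻¹) • ((x + u) * (y + v) * (x + u)) + (y + v) * (x + u) ^ 2
      = 0 := by
  have h1' : ∀ w, x * (u * w) = (a ^ (-2 : ℤ)) • (u * (x * w)) := fun w => by
    rw [← mul_assoc, h1, smul_mul_assoc, mul_assoc]
  have h2' : ∀ w, x * (v * w) = a • (v * (x * w)) := fun w => by
    rw [← mul_assoc, h2, smul_mul_assoc, mul_assoc]
  have h3' : ∀ w, y * (u * w) = a • (u * (y * w)) := fun w => by
    rw [← mul_assoc, h3, smul_mul_assoc, mul_assoc]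
  have hX' : x * (x * y) = (a + a⁻¹) • (x * (y * x)) - y * (x * x) := by
    rw [pow_two, mul_assoc, mul_assoc] at hX
    rw [← sub_eq_zero, ← hX]; abel
  have hY' : u * (u * v) = (a + a⁻¹) • (u * (v * u)) - v * (u * u) := by
    rw [pow_two, mul_assoc, mul_assoc] at hY
    rw [← sub_eq_zero, ← hY]; abel
  simp only [pow_two, mul_add, add_mul, mul_assoc, h1, h2, h3, h1', h2', h3', mul_smul_comm,
    smul_mul_assoc, hX', hY', smul_add]
  match_scalars <;> field_simp <;> ring

namespace IsBorel

variable {K Kinv : Fin (n + 1) → A} {q : kˣ} {X Y : Fin n → A}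

lemma K_mul (hK : IsTorus K Kinv) (h : IsBorel q K Kinv X) (i : Fin (n + 1)) (t : Fin n) :
    K i * X t = ((q ^ qWeight i t : kˣ) : k) • (X t * K i) := by
  rw [← smul_mul_assoc, ← h.weight, mul_assoc, hK.inv_mul, mul_one]

lemma Kinv_mul (hK : IsTorus K Kinv) (h : IsBorel q K Kinv X) (i : Fin (n + 1)) (t : Fin n) :
    Kinv i * X t = ((q ^ (-qWeight i t) : kˣ) : k) • (X t * Kinv i) := by
  have h1 : K i * X t * Kinv i = _ := h.weight i t
  have h2 : X t * Kinv i = ((q ^ qWeight i t : kˣ) : k) • (Kinv i * X t) := by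
    rw [← mul_smul_comm, ← h1, ← mul_assoc, ← mul_assoc, hK.inv_mul, one_mul]
  rw [h2, smul_smul, ← Units.val_mul, ← zpow_add]
  simp

lemma kd_mul (hK : IsTorus K Kinv) (h : IsBorel q K Kinv X) (s t : Fin n) :
    kd K Kinv s * X t = ((q ^ qCartan s t : kˣ) : k) • (X t * kd K Kinv s) := by
  rw [kd, mul_assoc, h.Kinv_mul hK, mul_smul_comm, ← mul_assoc, h.K_mul hK, smul_mul_assoc,
    smul_smul, ← Units.val_mul, ← zpow_add, mul_assoc,
    show -qWeight s.succ t + qWeight s.castSucc t = qCartan s t by rw [qCartan]; ring]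

lemma ld_mul (hK : IsTorus K Kinv) (h : IsBorel q K Kinv X) (s t : Fin n) :
    ld K Kinv s * X t = ((q ^ (-qCartan s t) : kˣ) : k) • (X t * ld K Kinv s) := by
  rw [ld, mul_assoc, h.K_mul hK, mul_smul_comm, ← mul_assoc, h.Kinv_mul hK, smul_mul_assoc,
    smul_smul, ← Units.val_mul, ← zpow_add, mul_assoc, qCartan]
  congr 4
  ring

lemma add (hX : IsBorel q K Kinv X) (hY : IsBorel q K Kinv Y)
    (hXY : ∀ s t, X s * Y t = ((q ^ (-qCartan s t) : kˣ) : k) • (Y t * X s)) :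
    IsBorel q K Kinv (fun s => X s + Y s) where
  weight i t := by rw [mul_add, add_mul, hX.weight, hY.weight, smul_add]
  comm s t h := by
    have h1 := hXY s t
    have h2 := hXY t s
    rw [qCartan_far h] at h1
    rw [qCartan_comm, qCartan_far h] at h2
    simp only [neg_zero, zpow_zero, Units.val_one, one_smul] at h1 h2
    simp only [mul_add, add_mul, h1, h2, hX.comm s t h, hY.comm s t h]
    abel
  serre s t h := by
    have h1 := hXY s s
    have h2 := hXY s t
    have h3 := hXY t s
    rw [qCartan_self] at h1
    rw [qCartan_near h] at h2
    rw [qCartan_comm, qCartan_near h] at h3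
    refine serre_add (q : k) q.ne_zero (X s) (X t) (Y s) (Y t) ?_ ?_ ?_ (hX.serre s t h)
      (hY.serre s t h)
    · rw [h1, Units.val_zpow_eq_zpow_val]
    · rw [h2]; simp
    · rw [h3]; simp

lemma smul (hX : IsBorel q K Kinv X) (c : k) : IsBorel q K Kinv (fun s => c • X s) where
  weight i t := by rw [mul_smul_comm, smul_mul_assoc, hX.weight, smul_comm]
  comm s t h := by simp only [smul_mul_smul_comm, hX.comm s t h]
  serre s t h := by
    have := congrArg (fun x => (c ^ 3) • x) (hX.serre s t h)
    simp only [smul_zero] at this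
    rw [← this]
    simp only [pow_two, smul_mul_assoc, mul_smul_comm, smul_smul, smul_add, smul_sub]
    match_scalars <;> ring

/-- Right multiplication by a commuting family that scales root vectors symmetrically. -/
lemma mul_right (hX : IsBorel q K Kinv X) (g : Fin n → A) (c : Fin n → Fin n → k)
    (hc : ∀ s t, c s t = c t s) (hg : ∀ s t, g s * g t = g t * g s)
    (hgX : ∀ s t, g s * X t = c s t • (X t * g s)) (hKg : ∀ i s, g s * Kinv i = Kinv i * g s) :
    IsBorel q K Kinv (fun s => X s * g s) where
  weight i t := by
    rw [← mul_assoc, mul_assoc _ (g t), hKg, ← mul_assoc, hX.weight, smul_mul_assoc]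
  comm s t h := by
    have e : ∀ a b, X a * g a * (X b * g b) = c a b • (X a * X b * (g a * g b)) := fun a b => by
      rw [mul_assoc, ← mul_assoc (g a), hgX, smul_mul_assoc, mul_smul_comm]; simp only [mul_assoc]
    simp only [e, hX.comm s t h, hc s t, hg s t]
  serre s t h := by
    have e : ∀ a b d, X a * g a * (X b * g b) * (X d * g d) =
        (c a b * c a d * c b d) • (X a * X b * X d * (g a * g b * g d)) := fun a b d => by
      have e1 : g a * (g b * (X d * g d)) = (c a d * c b d) • (X d * (g a * (g b * g d))) := by
        rw [← mul_assoc (g b), hgX b d, smul_mul_assoc, mul_smul_comm, mul_assoc, ← mul_assoc (g a),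
          hgX a d, smul_mul_assoc, smul_smul, mul_assoc, mul_comm (c b d)]
      rw [mul_assoc (X a), mul_assoc (X a), ← mul_assoc (g a), hgX a b, smul_mul_assoc,
        smul_mul_assoc, mul_smul_comm, mul_assoc (X b), mul_assoc (X b), mul_assoc (g a), e1]
      simp only [mul_smul_comm, smul_smul, mul_assoc]
    have e2 := congrArg (fun x => (c s s * c s t * c s t) • (x * (g s * g s * g t))) (hX.serre s t h)
    simp only [zero_mul, smul_zero] at e2
    rw [← e2]
    simp only [pow_two]
    rw [← mul_assoc (X t * g t) (X s * g s) (X s * g s)]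
    simp only [e]
    have g1 : g s * g t * g s = g s * g s * g t := by rw [mul_assoc, hg t s, mul_assoc]
    have g2 : g t * g s * g s = g s * g s * g t := by rw [hg t s, g1]
    rw [g1, g2, hc t s, add_mul, sub_mul, smul_mul_assoc, ← mul_assoc (X t)]
    simp only [smul_add, smul_sub, smul_smul]
    match_scalars <;> ring

lemma op (hX : IsBorel q K Kinv X) :
    IsBorel q (fun i => MulOpposite.op (Kinv i)) (fun i => MulOpposite.op (K i))
      (fun s => MulOpposite.op (X s)) where
  weight i t := by
    rw [← MulOpposite.op_mul, ← MulOpposite.op_mul, ← MulOpposite.op_smul, ← hX.weight, mul_assoc]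
  comm s t h := by rw [← MulOpposite.op_mul, ← MulOpposite.op_mul, hX.comm s t h]
  serre s t h := by
    have := congrArg MulOpposite.op (hX.serre s t h)
    rw [MulOpposite.op_zero] at this
    rw [← this]
    simp only [MulOpposite.op_add, MulOpposite.op_sub, MulOpposite.op_mul, MulOpposite.op_pow,
      MulOpposite.op_smul, mul_assoc]
    abel

end IsBorel
end Families

section Families

variable {k : Type*} [Field k] {n : ℕ} {A : Type*} [Ring A] [Algebra k A]

lemma ofFn_tmul_prod : ∀ (m : ℕ) (a b : Fin m → A),
    (List.ofFn fun i => (a i ⊗ₜ[k] b i : A ⊗[k] A)).prod = (List.ofFn a).prod ⊗ₜ (List.ofFn b).prod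
  | 0, a, b => by simp [Algebra.TensorProduct.one_def]
  | m + 1, a, b => by
    simp only [List.ofFn_succ, List.prod_cons]
    rw [ofFn_tmul_prod m (fun i => a i.succ) (fun i => b i.succ),
      Algebra.TensorProduct.tmul_mul_tmul]

lemma ofFn_op_prod : ∀ (m : ℕ) (a b : Fin m → A), (∀ i, a i * b i = 1) →
    (List.ofFn a).prod * (List.ofFn fun i => MulOpposite.op (b i)).prod.unop = 1
  | 0, a, b, _ => by simp
  | m + 1, a, b, h => by
    simp only [List.ofFn_succ, List.prod_cons, MulOpposite.unop_mul, MulOpposite.unop_op]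
    rw [mul_assoc, ← mul_assoc (List.ofFn fun i => a i.succ).prod,
      ofFn_op_prod m (fun i => a i.succ) (fun i => b i.succ) (fun i => h i.succ), one_mul, h]

namespace IsTorus

variable {K Kinv : Fin (n + 1) → A}

lemma tmul (hK : IsTorus K Kinv) :
    IsTorus (fun i => (K i ⊗ₜ[k] K i : A ⊗[k] A)) (fun i => Kinv i ⊗ₜ[k] Kinv i) where
  comm i j := by simp only [Algebra.TensorProduct.tmul_mul_tmul, hK.comm i j]
  mul_inv i := by
    simp only [Algebra.TensorProduct.tmul_mul_tmul, hK.mul_inv, Algebra.TensorProduct.one_def]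
  inv_mul i := by
    simp only [Algebra.TensorProduct.tmul_mul_tmul, hK.inv_mul, Algebra.TensorProduct.one_def]
  prod := by rw [ofFn_tmul_prod, hK.prod, Algebra.TensorProduct.one_def]

lemma op (hK : IsTorus K Kinv) :
    IsTorus (fun i => MulOpposite.op (Kinv i)) (fun i => MulOpposite.op (K i)) where
  comm i j := by rw [← MulOpposite.op_mul, ← MulOpposite.op_mul, (hK.commute_inv i j).eq]
  mul_inv i := by rw [← MulOpposite.op_mul, hK.mul_inv, MulOpposite.op_one]
  inv_mul i := by rw [← MulOpposite.op_mul, hK.inv_mul, MulOpposite.op_one]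
  prod := by
    have := ofFn_op_prod (n + 1) K Kinv hK.mul_inv
    rw [hK.prod, one_mul] at this
    exact MulOpposite.unop_injective this

end IsTorus

namespace IsBorel

variable {K Kinv : Fin (n + 1) → A} {q : kˣ} {X : Fin n → A}

lemma tmul_one (hK : IsTorus K Kinv) (hX : IsBorel q K Kinv X) :
    IsBorel q (fun i => (K i ⊗ₜ[k] K i : A ⊗[k] A)) (fun i => Kinv i ⊗ₜ[k] Kinv i)
      (fun s => X s ⊗ₜ[k] (1 : A)) where
  weight i t := by
    simp only [Algebra.TensorProduct.tmul_mul_tmul, hX.weight, mul_one, hK.mul_inv,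
      TensorProduct.smul_tmul']
  comm s t h := by simp only [Algebra.TensorProduct.tmul_mul_tmul, hX.comm s t h]
  serre s t h := by
    have := congrArg (Algebra.TensorProduct.includeLeft (R := k) (S := k) (A := A) (B := A))
      (hX.serre s t h)
    simpa only [map_add, map_sub, map_mul, map_pow, map_smul, map_zero,
      Algebra.TensorProduct.includeLeft_apply] using this

lemma one_tmul (hK : IsTorus K Kinv) (hX : IsBorel q K Kinv X) :
    IsBorel q (fun i => (K i ⊗ₜ[k] K i : A ⊗[k] A)) (fun i => Kinv i ⊗ₜ[k] Kinv i)
      (fun s => (1 : A) ⊗ₜ[k] X s) where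
  weight i t := by
    simp only [Algebra.TensorProduct.tmul_mul_tmul, hX.weight, mul_one, hK.mul_inv,
      TensorProduct.tmul_smul]
  comm s t h := by simp only [Algebra.TensorProduct.tmul_mul_tmul, hX.comm s t h]
  serre s t h := by
    have := congrArg (Algebra.TensorProduct.includeRight (R := k) (A := A) (B := A))
      (hX.serre s t h)
    simpa only [map_add, map_sub, map_mul, map_pow, map_smul, map_zero,
      Algebra.TensorProduct.includeRight_apply] using this

lemma tmul_left (hK : IsTorus K Kinv) (hX : IsBorel q K Kinv X) (g : Fin n → A)
    (hg : ∀ s t, g s * g t = g t * g s) (hKg : ∀ i s, g s * Kinv i = Kinv i * g s) :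
    IsBorel q (fun i => (K i ⊗ₜ[k] K i : A ⊗[k] A)) (fun i => Kinv i ⊗ₜ[k] Kinv i)
      (fun s => X s ⊗ₜ[k] g s) := by
  have := (hX.tmul_one hK).mul_right (fun s => (1 : A) ⊗ₜ[k] g s) (fun _ _ => 1)
    (fun _ _ => rfl) (fun s t => by simp only [Algebra.TensorProduct.tmul_mul_tmul, hg s t])
    (fun s t => by simp) (fun i s => by simp [hKg i s])
  simpa using this

lemma tmul_right (hK : IsTorus K Kinv) (hX : IsBorel q K Kinv X) (g : Fin n → A)
    (hg : ∀ s t, g s * g t = g t * g s) (hKg : ∀ i s, g s * Kinv i = Kinv i * g s) :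
    IsBorel q (fun i => (K i ⊗ₜ[k] K i : A ⊗[k] A)) (fun i => Kinv i ⊗ₜ[k] Kinv i)
      (fun s => g s ⊗ₜ[k] X s) := by
  have := (hX.one_tmul hK).mul_right (fun s => g s ⊗ₜ[k] (1 : A)) (fun _ _ => 1)
    (fun _ _ => rfl) (fun s t => by simp only [Algebra.TensorProduct.tmul_mul_tmul, hg s t])
    (fun s t => by simp) (fun i s => by simp [hKg i s])
  simpa using this

end IsBorel

namespace QRep

variable {q : kˣ} {e f : Prop}

/-- The trivial representation. -/
def counit (k : Type*) [Field k] (q : kˣ) (n : ℕ) (e f : Prop) : QRep k q n e f k where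
  K _ := 1
  Kinv _ := 1
  E _ _ := 0
  F _ _ := 0
  torus := ⟨fun _ _ => rfl, fun _ => mul_one 1, fun _ => mul_one 1, by simp⟩
  borelE _ := ⟨by simp, by simp, by simp⟩
  borelF _ := ⟨by simp, by simp, by simp⟩
  cross _ _ := ⟨by simp, by simp⟩

lemma cross_eq (r : QRep k q n e f A) (he : e) (hf : f) (s t : Fin n) :
    r.E he s * r.F hf t - r.F hf t * r.E he s =
      if s = t then ((q : k) - (q : k)⁻¹)⁻¹ • (kd r.K r.Kinv s - ld r.K r.Kinv s) else 0 := by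
  split_ifs with h
  · subst h
    exact (r.cross he hf).same s
  · exact (r.cross he hf).ne s t h

/-- Two representations with the same torus from the unified cross relation. -/
lemma isCross_of {K Kinv : Fin (n + 1) → A} {E F : Fin n → A}
    (h : ∀ s t, E s * F t - F t * E s =
      if s = t then ((q : k) - (q : k)⁻¹)⁻¹ • (kd K Kinv s - ld K Kinv s) else 0) :
    IsCross q K Kinv E F where
  same s := by rw [h, if_pos rfl]; rfl
  ne s t hst := by rw [h, if_neg hst]

/-- The images `K̂_i ⊗ K̂_i`, `1 ⊗ E_s + E_s ⊗ K̂_s K̂_{s+1}⁻¹` and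
`F_s ⊗ 1 + K̂_s⁻¹ K̂_{s+1} ⊗ F_s`. -/
def comul (r : QRep k q n e f A) : QRep k q n e f (A ⊗[k] A) where
  K i := r.K i ⊗ₜ r.K i
  Kinv i := r.Kinv i ⊗ₜ r.Kinv i
  E he s := 1 ⊗ₜ r.E he s + r.E he s ⊗ₜ (r.K s.castSucc * r.Kinv s.succ)
  F hf s := r.F hf s ⊗ₜ 1 + (r.K s.succ * r.Kinv s.castSucc) ⊗ₜ r.F hf s
  torus := r.torus.tmul
  borelE he := by
    have hb := r.borelE he
    refine (hb.one_tmul r.torus).add (hb.tmul_left r.torus (kd r.K r.Kinv)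
      (fun s t => (r.torus.commute_kd_kd s t).eq)
      (fun i s => (r.torus.commute_Kinv_kd i s).eq.symm)) (fun s t => ?_)
    have h := hb.kd_mul r.torus t s
    simp only [Algebra.TensorProduct.tmul_mul_tmul, one_mul, mul_one]
    rw [← kd, h, TensorProduct.tmul_smul, smul_smul, ← Units.val_mul, ← zpow_add, qCartan_comm]
    simp
  borelF hf := by
    have hb := r.borelF hf
    have hl : ∀ s : Fin n, r.K s.succ * r.Kinv s.castSucc = ld r.K r.Kinv s := fun s =>
      (r.torus.commute_inv_left _ _).eq.symm
    simp only [hl, add_comm (r.F hf _ ⊗ₜ[k] (1 : A))]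
    refine (hb.tmul_right r.torus (ld r.K r.Kinv)
      (fun s t => (r.torus.commute_ld_ld s t).eq)
      (fun i s => (r.torus.commute_Kinv_ld i s).eq.symm)).add (hb.tmul_one r.torus)
        (fun s t => ?_)
    have h := hb.ld_mul r.torus s t
    simp only [Algebra.TensorProduct.tmul_mul_tmul, one_mul, mul_one]
    rw [h, TensorProduct.smul_tmul']
  cross he hf := by
    refine isCross_of fun s t => ?_
    have hl : ∀ s : Fin n, r.K s.succ * r.Kinv s.castSucc = ld r.K r.Kinv s := fun s =>
      (r.torus.commute_inv_left _ _).eq.symm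
    have hk : ∀ s : Fin n, r.K s.castSucc * r.Kinv s.succ = kd r.K r.Kinv s := fun s => rfl
    have h1 := (r.borelE he).ld_mul r.torus t s
    have h2 := (r.borelF hf).kd_mul r.torus s t
    have hc := r.cross_eq he hf s t
    have hc1 := congrArg (fun x => ld r.K r.Kinv t ⊗ₜ[k] x) hc
    have hc2 := congrArg (fun x => x ⊗ₜ[k] kd r.K r.Kinv s) hc
    simp only [TensorProduct.tmul_sub, TensorProduct.sub_tmul] at hc1 hc2
    have key : (r.E he s * ld r.K r.Kinv t) ⊗ₜ[k] (kd r.K r.Kinv s * r.F hf t) =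
        (ld r.K r.Kinv t * r.E he s) ⊗ₜ[k] (r.F hf t * kd r.K r.Kinv s) := by
      rw [h1, h2, TensorProduct.tmul_smul, TensorProduct.smul_tmul', inv_zpow, zpow_neg,
        qCartan_comm]
    simp only [hl, hk]
    have lhs : ((1 : A) ⊗ₜ[k] r.E he s + r.E he s ⊗ₜ[k] kd r.K r.Kinv s) *
          (r.F hf t ⊗ₜ[k] (1 : A) + ld r.K r.Kinv t ⊗ₜ[k] r.F hf t) -
        (r.F hf t ⊗ₜ[k] (1 : A) + ld r.K r.Kinv t ⊗ₜ[k] r.F hf t) *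
          ((1 : A) ⊗ₜ[k] r.E he s + r.E he s ⊗ₜ[k] kd r.K r.Kinv s) =
        (ld r.K r.Kinv t ⊗ₜ[k] (r.E he s * r.F hf t) - ld r.K r.Kinv t ⊗ₜ[k] (r.F hf t * r.E he s))
        + ((r.E he s * r.F hf t) ⊗ₜ[k] kd r.K r.Kinv s -
          (r.F hf t * r.E he s) ⊗ₜ[k] kd r.K r.Kinv s) := by
      simp only [mul_add, add_mul, Algebra.TensorProduct.tmul_mul_tmul, one_mul, mul_one, key]
      abel
    rw [lhs, hc1, hc2]
    split_ifs with h
    · subst h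
      simp only [kd, ld, TensorProduct.tmul_smul, ← TensorProduct.smul_tmul',
        Algebra.TensorProduct.tmul_mul_tmul, TensorProduct.tmul_sub, TensorProduct.sub_tmul,
        smul_sub]
      abel
    · simp

/-- The images `K̂_i⁻¹`, `-E_s K̂_s⁻¹ K̂_{s+1}` and `-K̂_s K̂_{s+1}⁻¹ F_s` in the opposite algebra. -/
def op (r : QRep k q n e f A) : QRep k q n e f Aᵐᵒᵖ where
  K i := MulOpposite.op (r.Kinv i)
  Kinv i := MulOpposite.op (r.K i)
  E he s := MulOpposite.op (-(r.E he s * (r.Kinv s.castSucc * r.K s.succ)))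
  F hf s := MulOpposite.op (-(r.K s.castSucc * r.Kinv s.succ * r.F hf s))
  torus := r.torus.op
  borelE he := by
    have hb := r.borelE he
    have := ((hb.mul_right (ld r.K r.Kinv) (fun s t => ((q ^ (-qCartan s t) : kˣ) : k))
      (fun s t => by rw [qCartan_comm]) (fun s t => (r.torus.commute_ld_ld s t).eq)
      (fun s t => hb.ld_mul r.torus s t)
      (fun i s => (r.torus.commute_Kinv_ld i s).eq.symm)).smul (-1)).op
    simpa only [neg_smul, one_smul, ld] using this
  borelF hf := by
    have hb := r.borelF hf
    have := ((hb.mul_right (kd r.K r.Kinv) (fun s t => ((q⁻¹ ^ (qCartan s t) : kˣ) : k))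
      (fun s t => by rw [qCartan_comm]) (fun s t => (r.torus.commute_kd_kd s t).eq)
      (fun s t => hb.kd_mul r.torus s t)
      (fun i s => (r.torus.commute_Kinv_kd i s).eq.symm)).smul
        (-((q⁻¹ ^ (2 : ℤ) : kˣ) : k))).op
    have h2 : ∀ s, -(r.K s.castSucc * r.Kinv s.succ * r.F hf s) =
        (-((q⁻¹ ^ (2 : ℤ) : kˣ) : k)) • (r.F hf s * kd r.K r.Kinv s) := fun s => by
      have := hb.kd_mul r.torus s s
      rw [qCartan_self] at this
      rw [neg_smul, ← this, kd]
    simpa only [h2] using this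
  cross he hf := by
    refine isCross_of fun s t => ?_
    have h1 := (r.borelE he).kd_mul r.torus t s
    have h2 := (r.borelF hf).ld_mul r.torus s t
    have hc := r.cross_eq he hf s t
    have hl : ∀ s : Fin n, r.Kinv s.castSucc * r.K s.succ = ld r.K r.Kinv s := fun s => rfl
    have hk : ∀ s : Fin n, r.K s.castSucc * r.Kinv s.succ = kd r.K r.Kinv s := fun s => rfl
    have hl' : kd (fun i => MulOpposite.op (r.Kinv i)) (fun i => MulOpposite.op (r.K i)) s =
        MulOpposite.op (ld r.K r.Kinv s) := by
      rw [kd, ← MulOpposite.op_mul, ld, (r.torus.commute_inv_left _ _).eq]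
    have hk' : ld (fun i => MulOpposite.op (r.Kinv i)) (fun i => MulOpposite.op (r.K i)) s =
        MulOpposite.op (kd r.K r.Kinv s) := by
      rw [ld, ← MulOpposite.op_mul, kd, (r.torus.commute_inv_left _ _).eq]
    have key : r.E he s * ld r.K r.Kinv s * (kd r.K r.Kinv t * r.F hf t) =
        kd r.K r.Kinv t * (r.E he s * r.F hf t) * ld r.K r.Kinv s := by
      have e1 : kd r.K r.Kinv t * (r.E he s * r.F hf t) * ld r.K r.Kinv s =
          (kd r.K r.Kinv t * r.E he s) * (r.F hf t * ld r.K r.Kinv s) := by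
        simp only [mul_assoc]
      have e2 : r.E he s * ld r.K r.Kinv s * (kd r.K r.Kinv t * r.F hf t) =
          r.E he s * kd r.K r.Kinv t * (ld r.K r.Kinv s * r.F hf t) := by
        rw [mul_assoc, ← mul_assoc (ld r.K r.Kinv s), ← (r.torus.commute_kd_ld t s).eq]
        simp only [mul_assoc]
      rw [e1, e2, h1, h2, smul_mul_assoc, mul_smul_comm, inv_zpow, zpow_neg, inv_inv,
        qCartan_comm]
    rw [hl', hk', hl, hk]
    have e3 : MulOpposite.op (-(r.E he s * ld r.K r.Kinv s)) *
          MulOpposite.op (-(kd r.K r.Kinv t * r.F hf t)) -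
        MulOpposite.op (-(kd r.K r.Kinv t * r.F hf t)) *
          MulOpposite.op (-(r.E he s * ld r.K r.Kinv s)) =
        MulOpposite.op (-(kd r.K r.Kinv t * (r.E he s * r.F hf t - r.F hf t * r.E he s) *
          ld r.K r.Kinv s)) := by
      rw [← MulOpposite.op_mul, ← MulOpposite.op_mul, ← MulOpposite.op_sub, neg_mul_neg,
        neg_mul_neg, key, mul_sub, sub_mul]
      simp only [mul_assoc, neg_sub]
    rw [e3, hc]
    split_ifs with h
    · subst h
      rw [mul_smul_comm, smul_mul_assoc, mul_sub, sub_mul, mul_assoc, r.torus.kd_mul_ld, mul_one,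
        one_mul, ← smul_neg, neg_sub, MulOpposite.op_smul, MulOpposite.op_sub]
    · simp

/-- The images `K̂_i`, `c E_s` and `c⁻¹ F_s`. -/
def scale (r : QRep k q n e f A) (c : kˣ) : QRep k q n e f A where
  K := r.K
  Kinv := r.Kinv
  E he s := (c : k) • r.E he s
  F hf s := ((c⁻¹ : kˣ) : k) • r.F hf s
  torus := r.torus
  borelE he := (r.borelE he).smul _
  borelF hf := (r.borelF hf).smul _
  cross he hf :=
    { same := fun s => by
        rw [smul_mul_smul_comm, smul_mul_smul_comm, mul_comm _ (c : k), Units.mul_inv, one_smul,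
          one_smul, (r.cross he hf).same]
      ne := fun s t h => by
        rw [smul_mul_smul_comm, smul_mul_smul_comm, mul_comm _ (c : k), Units.mul_inv, one_smul,
          one_smul, (r.cross he hf).ne s t h] }

end QRep
end Families

namespace QAlg

variable (k : Type*) [Field k] (q : kˣ) (n : ℕ) (e f : Prop)

/-- The comultiplication as an algebra homomorphism. -/
def comulHom : QAlg k q n e f →ₐ[k] QAlg k q n e f ⊗[k] QAlg k q n e f := lift (gens k q n e f).comul

/-- The counit as an algebra homomorphism. -/
def counitHom : QAlg k q n e f →ₐ[k] k := lift (QRep.counit k q n e f)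

/-- The antipode as an algebra homomorphism into the opposite algebra. -/
def antipodeHom : QAlg k q n e f →ₐ[k] (QAlg k q n e f)ᵐᵒᵖ := lift (gens k q n e f).op

variable {k q n e f}

@[simp] lemma comulHom_K (i : Fin (n + 1)) :
    comulHom k q n e f (K k q i) = K k q i ⊗ₜ K k q i := lift_K _ _

@[simp] lemma comulHom_Kinv (i : Fin (n + 1)) :
    comulHom k q n e f (Kinv k q i) = Kinv k q i ⊗ₜ Kinv k q i := lift_Kinv _ _

@[simp] lemma comulHom_E (he : e) (s : Fin n) : comulHom k q n e f (E k q he s) =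
    1 ⊗ₜ E k q he s + E k q he s ⊗ₜ (K k q s.castSucc * Kinv k q s.succ) := lift_E _ _ _

@[simp] lemma comulHom_F (hf : f) (s : Fin n) : comulHom k q n e f (F k q hf s) =
    F k q hf s ⊗ₜ 1 + (K k q s.succ * Kinv k q s.castSucc) ⊗ₜ F k q hf s := lift_F _ _ _

@[simp] lemma counitHom_K (i : Fin (n + 1)) : counitHom k q n e f (K k q i) = 1 := lift_K _ _

@[simp] lemma counitHom_Kinv (i : Fin (n + 1)) : counitHom k q n e f (Kinv k q i) = 1 :=
  lift_Kinv _ _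

@[simp] lemma counitHom_E (he : e) (s : Fin n) : counitHom k q n e f (E k q he s) = 0 :=
  lift_E _ _ _

@[simp] lemma counitHom_F (hf : f) (s : Fin n) : counitHom k q n e f (F k q hf s) = 0 :=
  lift_F _ _ _

lemma K_mul_Kinv (i : Fin (n + 1)) : (K k q i * Kinv k q i : QAlg k q n e f) = 1 :=
  (gens k q n e f).torus.mul_inv i

lemma Kinv_mul_K (i : Fin (n + 1)) : (Kinv k q i * K k q i : QAlg k q n e f) = 1 :=
  (gens k q n e f).torus.inv_mul i

/-- The comultiplication is `K̂_i ↦ K̂_i ⊗ K̂_i`, `E_s ↦ 1 ⊗ E_s + E_s ⊗ K̂_s K̂_{s+1}⁻¹`,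
`F_s ↦ F_s ⊗ 1 + K̂_{s+1} K̂_s⁻¹ ⊗ F_s`; the counit is `1` on `K̂_i` and `0` on `E_s`, `F_s`. -/
instance : Bialgebra k (QAlg k q n e f) :=
  Bialgebra.ofAlgHom (comulHom k q n e f) (counitHom k q n e f)
    (by
      apply algHom_ext <;> intros <;>
        simp [TensorProduct.tmul_add, TensorProduct.add_tmul, Algebra.TensorProduct.one_def,
          add_assoc])
    (by apply algHom_ext <;> intros <;> simp)
    (by apply algHom_ext <;> intros <;> simp)

lemma comul_eq (x : QAlg k q n e f) : comul (R := k) x = comulHom k q n e f x := rfl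

lemma counit_eq (x : QAlg k q n e f) : counit (R := k) x = counitHom k q n e f x := rfl

/-- The antipode as a linear map. -/
def antipodeLin : QAlg k q n e f →ₗ[k] QAlg k q n e f :=
  (MulOpposite.opLinearEquiv k).symm.toLinearMap ∘ₗ (antipodeHom k q n e f).toLinearMap

lemma antipodeLin_apply (x : QAlg k q n e f) :
    antipodeLin x = (antipodeHom k q n e f x).unop := rfl

lemma antipodeLin_mul (x y : QAlg k q n e f) :
    antipodeLin (x * y) = antipodeLin y * antipodeLin x := by
  simp [antipodeLin_apply]

lemma antipodeLin_algebraMap (c : k) :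
    antipodeLin (algebraMap k (QAlg k q n e f) c) = algebraMap k _ c := by
  rw [antipodeLin_apply, AlgHom.commutes]; rfl

lemma antipodeLin_one : antipodeLin (1 : QAlg k q n e f) = 1 := by
  simp [antipodeLin_apply]

@[simp] lemma antipodeLin_K (i : Fin (n + 1)) :
    antipodeLin (K k q i : QAlg k q n e f) = Kinv k q i := by
  rw [antipodeLin_apply, antipodeHom, lift_K]; rfl

@[simp] lemma antipodeLin_Kinv (i : Fin (n + 1)) :
    antipodeLin (Kinv k q i : QAlg k q n e f) = K k q i := by
  rw [antipodeLin_apply, antipodeHom, lift_Kinv]; rfl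

@[simp] lemma antipodeLin_E (he : e) (s : Fin n) :
    antipodeLin (E k q he s : QAlg k q n e f) =
      -(E k q he s * (Kinv k q s.castSucc * K k q s.succ)) := by
  rw [antipodeLin_apply, antipodeHom, lift_E]; rfl

@[simp] lemma antipodeLin_F (hf : f) (s : Fin n) :
    antipodeLin (F k q hf s : QAlg k q n e f) =
      -(K k q s.castSucc * Kinv k q s.succ * F k q hf s) := by
  rw [antipodeLin_apply, antipodeHom, lift_F]; rfl

/-- The map `x ⊗ y ↦ S(x) y`. -/
def antiLeft : QAlg k q n e f ⊗[k] QAlg k q n e f →ₗ[k] QAlg k q n e f :=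
  LinearMap.mul' k _ ∘ₗ antipodeLin.rTensor _

/-- The map `x ⊗ y ↦ x S(y)`. -/
def antiRight : QAlg k q n e f ⊗[k] QAlg k q n e f →ₗ[k] QAlg k q n e f :=
  LinearMap.mul' k _ ∘ₗ antipodeLin.lTensor _

@[simp] lemma antiLeft_tmul (x y : QAlg k q n e f) :
    antiLeft (x ⊗ₜ[k] y) = antipodeLin x * y := by simp [antiLeft]

@[simp] lemma antiRight_tmul (x y : QAlg k q n e f) :
    antiRight (x ⊗ₜ[k] y) = x * antipodeLin y := by simp [antiRight]

lemma antiLeft_mul (X Y : QAlg k q n e f ⊗[k] QAlg k q n e f) (c : k)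
    (h : antiLeft X = algebraMap k _ c) : antiLeft (X * Y) = c • antiLeft Y := by
  have h1 : ∀ y z : QAlg k q n e f, antiLeft (X * y ⊗ₜ z) = antipodeLin y * antiLeft X * z := by
    intro y z
    clear h
    induction X with
    | zero => simp
    | add a b ha hb => rw [add_mul, map_add, ha, hb, map_add, mul_add, add_mul]
    | tmul a b => simp [antipodeLin_mul, mul_assoc]
  induction Y with
  | zero => simp
  | add a b ha hb => rw [mul_add, map_add, ha, hb, map_add, smul_add]
  | tmul a b =>
    rw [h1, h, antiLeft_tmul, ← Algebra.commutes, mul_assoc, Algebra.smul_def]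

lemma antiRight_mul (X Y : QAlg k q n e f ⊗[k] QAlg k q n e f) (c : k)
    (h : antiRight Y = algebraMap k _ c) : antiRight (X * Y) = c • antiRight X := by
  have h1 : ∀ y z : QAlg k q n e f, antiRight (y ⊗ₜ z * Y) = y * antiRight Y * antipodeLin z := by
    intro y z
    clear h
    induction Y with
    | zero => simp
    | add a b ha hb => rw [mul_add, map_add, ha, hb, map_add, mul_add, add_mul]
    | tmul a b => simp [antipodeLin_mul, mul_assoc]
  induction X with
  | zero => simp
  | add a b ha hb => rw [add_mul, map_add, ha, hb, map_add, smul_add]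
  | tmul a b =>
    rw [h1, h, antiRight_tmul, ← Algebra.commutes, mul_assoc, Algebra.smul_def]

lemma antiLeft_comul (x : QAlg k q n e f) :
    antiLeft (comulHom k q n e f x) = algebraMap k _ (counitHom k q n e f x) := by
  let S : Subalgebra k (QAlg k q n e f) :=
    { carrier := {x | antiLeft (comulHom k q n e f x) = algebraMap k _ (counitHom k q n e f x)}
      mul_mem' := fun {a b} ha hb => by
        rw [Set.mem_ofPred_eq] at ha hb ⊢
        rw [map_mul, antiLeft_mul _ _ _ ha, hb, map_mul, map_mul, Algebra.smul_def]
      add_mem' := fun {a b} ha hb => by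
        rw [Set.mem_ofPred_eq] at ha hb ⊢
        rw [map_add, map_add, ha, hb, map_add, map_add]
      algebraMap_mem' := fun c => by
        rw [Set.mem_ofPred_eq, AlgHom.commutes, AlgHom.commutes,
          Algebra.TensorProduct.algebraMap_apply, antiLeft_tmul, antipodeLin_algebraMap, mul_one]
        rfl }
  have ht := (gens k q n e f).torus
  refine mem_of_gens S ?_ ?_ ?_ ?_ x
  · intro i
    change antiLeft (comulHom k q n e f _) = algebraMap k _ (counitHom k q n e f _)
    simp [Kinv_mul_K]
  · intro i
    change antiLeft (comulHom k q n e f _) = algebraMap k _ (counitHom k q n e f _)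
    simp [K_mul_Kinv]
  · intro he s
    change antiLeft (comulHom k q n e f _) = algebraMap k _ (counitHom k q n e f _)
    have := ht.ld_mul_kd s
    simp only [ld, kd] at this
    change Kinv k q s.castSucc * K k q s.succ * (K k q s.castSucc * Kinv k q s.succ) = 1 at this
    simp only [comulHom_E, counitHom_E, map_add, antiLeft_tmul, antipodeLin_one, antipodeLin_E,
      neg_mul, mul_assoc (E k q he s), this, map_zero, one_mul, mul_one, add_neg_cancel]
  · intro hf s
    change antiLeft (comulHom k q n e f _) = algebraMap k _ (counitHom k q n e f _)
    simp [antipodeLin_mul]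

lemma antiRight_comul (x : QAlg k q n e f) :
    antiRight (comulHom k q n e f x) = algebraMap k _ (counitHom k q n e f x) := by
  let S : Subalgebra k (QAlg k q n e f) :=
    { carrier := {x | antiRight (comulHom k q n e f x) = algebraMap k _ (counitHom k q n e f x)}
      mul_mem' := fun {a b} ha hb => by
        rw [Set.mem_ofPred_eq] at ha hb ⊢
        rw [map_mul, antiRight_mul _ _ _ hb, ha, map_mul, map_mul, Algebra.smul_def,
          Algebra.commutes]
      add_mem' := fun {a b} ha hb => by
        rw [Set.mem_ofPred_eq] at ha hb ⊢
        rw [map_add, map_add, ha, hb, map_add, map_add]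
      algebraMap_mem' := fun c => by
        rw [Set.mem_ofPred_eq, AlgHom.commutes, AlgHom.commutes,
          Algebra.TensorProduct.algebraMap_apply, antiRight_tmul, antipodeLin_one, mul_one]
        rfl }
  have ht := (gens k q n e f).torus
  refine mem_of_gens S ?_ ?_ ?_ ?_ x
  · intro i
    change antiRight (comulHom k q n e f _) = algebraMap k _ (counitHom k q n e f _)
    simp [K_mul_Kinv]
  · intro i
    change antiRight (comulHom k q n e f _) = algebraMap k _ (counitHom k q n e f _)
    simp [Kinv_mul_K]
  · intro he s
    change antiRight (comulHom k q n e f _) = algebraMap k _ (counitHom k q n e f _)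
    have : Kinv k q s.castSucc * K k q s.succ = K k q s.succ * Kinv k q s.castSucc :=
      (ht.commute_inv_left _ _).eq
    simp [antipodeLin_mul, this]
  · intro hf s
    change antiRight (comulHom k q n e f _) = algebraMap k _ (counitHom k q n e f _)
    have := ht.ld_mul_kd s
    simp only [ld, kd] at this
    rw [(ht.commute_inv_left _ _).eq] at this
    change K k q s.succ * Kinv k q s.castSucc * (K k q s.castSucc * Kinv k q s.succ) = 1 at this
    simp only [comulHom_F, counitHom_F, map_add, antiRight_tmul, antipodeLin_one, antipodeLin_F,
      mul_neg, map_zero, mul_one]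
    rw [← mul_assoc, this, one_mul, add_neg_cancel]

instance : HopfAlgebra k (QAlg k q n e f) where
  antipode := antipodeLin
  mul_antipode_rTensor_comul := LinearMap.ext antiLeft_comul
  mul_antipode_lTensor_comul := LinearMap.ext antiRight_comul

/-- The automorphism `E_s ↦ c E_s`, `F_s ↦ c⁻¹ F_s`. -/
def scaleHom (c : kˣ) : QAlg k q n e f →ₐ[k] QAlg k q n e f := lift ((gens k q n e f).scale c)

lemma scaleHom_comp (c d : kˣ) (h : c * d = 1) (x : QAlg k q n e f) :
    scaleHom c (scaleHom d x) = x := by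
  have h1 : (d : k) * (c : k) = 1 := by rw [mul_comm, ← Units.val_mul, h, Units.val_one]
  have h2 : ((d⁻¹ : kˣ) : k) * ((c⁻¹ : kˣ) : k) = 1 := by
    rw [← Units.val_mul, ← mul_inv_rev, h, inv_one, Units.val_one]
  have hE : ∀ c : kˣ, ∀ he s, scaleHom c (E k q he s : QAlg k q n e f) = (c : k) • E k q he s :=
    fun c he s => lift_E _ _ _
  have hF : ∀ c : kˣ, ∀ hf s, scaleHom c (F k q hf s : QAlg k q n e f) =
      ((c⁻¹ : kˣ) : k) • F k q hf s := fun c he s => lift_F _ _ _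
  have hK : ∀ c : kˣ, ∀ i, scaleHom c (K k q i : QAlg k q n e f) = K k q i :=
    fun c i => lift_K _ _
  have hKinv : ∀ c : kˣ, ∀ i, scaleHom c (Kinv k q i : QAlg k q n e f) = Kinv k q i :=
    fun c i => lift_Kinv _ _
  have : (scaleHom c).comp (scaleHom d) = AlgHom.id k (QAlg k q n e f) := by
    apply algHom_ext
    · intro i; simp only [AlgHom.comp_apply, hK, AlgHom.id_apply]
    · intro i; simp only [AlgHom.comp_apply, hKinv, AlgHom.id_apply]
    · intro he s
      simp only [AlgHom.comp_apply, hE, AlgHom.id_apply, map_smul, smul_smul, h1, one_smul]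
    · intro hf s
      simp only [AlgHom.comp_apply, hF, AlgHom.id_apply, map_smul, smul_smul, h2, one_smul]
  exact DFunLike.congr_fun this x

/-- The square of the antipode is the automorphism `E_s ↦ q² E_s`, `F_s ↦ q⁻² F_s`. -/
lemma antipodeLin_sq (x : QAlg k q n e f) : antipodeLin (antipodeLin x) = scaleHom (q ^ 2) x := by
  let S : Subalgebra k (QAlg k q n e f) :=
    { carrier := {x | antipodeLin (antipodeLin x) = scaleHom (q ^ 2) x}
      mul_mem' := fun {a b} ha hb => by
        rw [Set.mem_ofPred_eq] at ha hb ⊢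
        rw [antipodeLin_mul, antipodeLin_mul, ha, hb, map_mul]
      add_mem' := fun {a b} ha hb => by
        rw [Set.mem_ofPred_eq] at ha hb ⊢
        rw [map_add, map_add, map_add, ha, hb]
      algebraMap_mem' := fun c => by
        rw [Set.mem_ofPred_eq, antipodeLin_algebraMap, antipodeLin_algebraMap, AlgHom.commutes] }
  have ht := (gens k q n e f).torus
  have hkl := ht.kd_mul_ld
  refine mem_of_gens S ?_ ?_ ?_ ?_ x
  · intro i
    change antipodeLin (antipodeLin (K k q i)) = scaleHom (q ^ 2) (K k q i)
    rw [antipodeLin_K, antipodeLin_Kinv]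
    exact (lift_K ((gens k q n e f).scale (q ^ 2)) i).symm
  · intro i
    change antipodeLin (antipodeLin (Kinv k q i)) = scaleHom (q ^ 2) (Kinv k q i)
    rw [antipodeLin_Kinv, antipodeLin_K]
    exact (lift_Kinv ((gens k q n e f).scale (q ^ 2)) i).symm
  · intro he s
    change antipodeLin (antipodeLin (E k q he s)) = scaleHom (q ^ 2) (E k q he s)
    refine Eq.trans ?_ (lift_E ((gens k q n e f).scale (q ^ 2)) he s).symm
    have h := ((gens k q n e f).borelE he).kd_mul ht s s
    have hc : Kinv k q s.succ * K k q s.castSucc = kd (K k q) (Kinv k q) s :=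
      (ht.commute_inv_left _ _).eq
    rw [antipodeLin_E, map_neg, antipodeLin_mul, antipodeLin_mul, antipodeLin_K, antipodeLin_Kinv,
      antipodeLin_E, mul_neg, neg_neg, hc, ← mul_assoc]
    change kd (K k q) (Kinv k q) s * E k q he s * ld (K k q) (Kinv k q) s = _
    have hkl' : kd (K k q) (Kinv k q) s * ld (K k q) (Kinv k q) s = (1 : QAlg k q n e f) := hkl s
    change kd (K k q) (Kinv k q) s * E k q he s = _ • (E k q he s * kd (K k q) (Kinv k q) s) at h
    rw [h, smul_mul_assoc, mul_assoc, hkl', mul_one, qCartan_self]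
    rfl
  · intro hf s
    change antipodeLin (antipodeLin (F k q hf s)) = scaleHom (q ^ 2) (F k q hf s)
    refine Eq.trans ?_ (lift_F ((gens k q n e f).scale (q ^ 2)) hf s).symm
    have h := ((gens k q n e f).borelF hf).kd_mul ht s s
    have hc : K k q s.succ * Kinv k q s.castSucc = ld (K k q) (Kinv k q) s :=
      (ht.commute_inv_left _ _).eq.symm
    rw [antipodeLin_F, map_neg, antipodeLin_mul, antipodeLin_mul, antipodeLin_K, antipodeLin_Kinv,
      antipodeLin_F, neg_mul, neg_neg, hc]
    change kd (K k q) (Kinv k q) s * F k q hf s * ld (K k q) (Kinv k q) s = _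
    have hkl' : kd (K k q) (Kinv k q) s * ld (K k q) (Kinv k q) s = (1 : QAlg k q n e f) := hkl s
    change kd (K k q) (Kinv k q) s * F k q hf s = _ • (F k q hf s * kd (K k q) (Kinv k q) s) at h
    rw [h, smul_mul_assoc, mul_assoc, hkl', mul_one, qCartan_self, inv_zpow]
    rfl

instance : BijectiveAntipode k (QAlg k q n e f) where
  bijective := by
    change Function.Bijective (antipodeLin (k := k) (q := q) (n := n) (e := e) (f := f))
    constructor
    · intro x y h
      have := congrArg antipodeLin h
      rw [antipodeLin_sq, antipodeLin_sq] at this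
      rw [← scaleHom_comp ((q ^ 2)⁻¹) (q ^ 2) (inv_mul_cancel _) x, this,
        scaleHom_comp _ _ (inv_mul_cancel _)]
    · intro x
      refine ⟨antipodeLin (scaleHom ((q ^ 2)⁻¹) x), ?_⟩
      rw [antipodeLin_sq, scaleHom_comp _ _ (mul_inv_cancel _)]

end QAlg

/-- The Hopf algebra `U_q(b_-)`, for `N = n + 1`: generators `K̂_i^{±1}` and `E_s`. -/
abbrev UqMinus (k : Type*) [Field k] (q : kˣ) (n : ℕ) : Type _ := QAlg k q n True False

/-- The Hopf algebra `U_q(b_+)`, for `N = n + 1`: generators `K̂_i^{±1}` and `F_s`. -/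
abbrev UqPlus (k : Type*) [Field k] (q : kˣ) (n : ℕ) : Type _ := QAlg k q n False True

/-- The Hopf algebra `U_q^ext(sl_N)`, for `N = n + 1`: generators `K̂_i^{±1}`, `E_s` and `F_s`. -/
abbrev UqExt (k : Type*) [Field k] (q : kˣ) (n : ℕ) : Type _ := QAlg k q n True True

section Values

open QAlg

variable {k : Type*} [Field k] {q : kˣ} {n : ℕ}

/-- The prescribed values on generators of the form on `U_q(b_+) ⊗ U_q(b_-)`. -/
structure IsBorelForm (z : k) (B : UqPlus k q n →ₗ[k] UqMinus k q n →ₗ[k] k) : Prop where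
  K_K : ∀ i j, B (K k q i) (K k q j) = z * (if i = j then (q : k) else 1)
  Kinv_Kinv : ∀ i j, B (Kinv k q i) (Kinv k q j) = z * (if i = j then (q : k) else 1)
  K_Kinv : ∀ i j, B (K k q i) (Kinv k q j) = z⁻¹ * (if i = j then (q : k)⁻¹ else 1)
  Kinv_K : ∀ i j, B (Kinv k q i) (K k q j) = z⁻¹ * (if i = j then (q : k)⁻¹ else 1)
  K_E : ∀ i s, B (K k q i) (E k q trivial s) = 0
  Kinv_E : ∀ i s, B (Kinv k q i) (E k q trivial s) = 0
  F_K : ∀ s j, B (F k q trivial s) (K k q j) = 0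
  F_Kinv : ∀ s j, B (F k q trivial s) (Kinv k q j) = 0
  F_E : ∀ s t, B (F k q trivial s) (E k q trivial t) =
    ((q : k) - (q : k)⁻¹)⁻¹ * (if s = t then 1 else 0)

/-- The prescribed values on generators of the form on `U_q(b_-) ⊗ U_q(b_-)`. -/
structure IsSelfForm (z : k) (B : UqMinus k q n →ₗ[k] UqMinus k q n →ₗ[k] k) : Prop where
  K_K : ∀ i j, B (K k q i) (K k q j) = z⁻¹ * (if i = j then (q : k)⁻¹ else 1)
  Kinv_Kinv : ∀ i j, B (Kinv k q i) (Kinv k q j) = z⁻¹ * (if i = j then (q : k)⁻¹ else 1)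
  K_Kinv : ∀ i j, B (K k q i) (Kinv k q j) = z * (if i = j then (q : k) else 1)
  Kinv_K : ∀ i j, B (Kinv k q i) (K k q j) = z * (if i = j then (q : k) else 1)
  K_E : ∀ i s, B (K k q i) (E k q trivial s) = 0
  Kinv_E : ∀ i s, B (Kinv k q i) (E k q trivial s) = 0
  E_K : ∀ s j, B (E k q trivial s) (K k q j) = 0
  E_Kinv : ∀ s j, B (E k q trivial s) (Kinv k q j) = 0
  E_E : ∀ s t, B (E k q trivial s) (E k q trivial t) =
    ((q : k) - (q : k)⁻¹)⁻¹ * (if s = t then 1 else 0)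

end Values

end

/-! A pairing of `U` with `V` is the same as an algebra homomorphism from `U` to the convolution
algebra of functionals on `V` that is compatible with the coproduct and counit of `U`
(`HopfPairing.toDual`, `HopfPairing.ofDual`). Since `U_q(b_-)` is presented by generators and
relations, constructing its self-pairing means finding functionals that satisfy these relations. For
`K̂_i` take the character `K̂_j ↦ z⁻¹ q^{-δ_{i,j}}`, `E_t ↦ 0`; the condition `z^N = q⁻¹` makes it
respect `K̂_1 ⋯ K̂_N = 1`, and makes the product of all these characters trivial. For `E_s` take the
corner entry of an upper triangular representation of size two with diagonal `(ε, χ_s)`, where `χ_s`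
is the character paired with `K̂_s K̂_{s+1}⁻¹`. Multiplying triangular matrices shows that this
entry is a skew derivation, `u(xy) = ε(x) u(y) + u(x) χ_s(y)`.

The relations among these functionals need no knowledge of a basis. Conjugates by characters,
commutators and quantum Serre expressions of the skew derivations involved are again skew
derivations (`IsSkewDer.conj`, `IsSkewDer.commutator`, `IsSkewDer.serre`), and a skew derivation is
determined by its values on generators (`UqMinus.eq_of_isSkewDer`). So each relation is checked on
`K̂_j^{±1}` and `E_t`. The same principle gives uniqueness: in any pairing group-like elements act
as characters and `E_s` as a skew derivation, and both are fixed by the prescribed values.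

The map `K̂_i ↦ K̂_i⁻¹`, `F_s ↦ E_s` is an isomorphism of algebras `U_q(b_+) → U_q(b_-)` that
reverses the coproduct. It carries one table of values to the other, so (1) follows from (2); and
since doubles are functorial for isomorphisms that preserve the skew pairing, it also gives the
isomorphism of the two doubles.

For the map onto `U_q^ext(sl_N)`, the candidate `b ⊗ h ↦ bh` is a coalgebra map, and only
multiplicativity is in question. Its graph is the span of the products `a(b) c(h)` in the product of
the double with `U_q^ext(sl_N)`, where `a` and `c` are the pairs of inclusions, and multiplicativity
follows once this span is closed under multiplication. That reduces to rewriting `c(h) a(b)` as a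
sum of terms `a(b') c(h')`. The elements for which this is possible form subalgebras
(`straightening`, `normalizing`, `normalizingMod`), so it is enough to treat pairs of generators,
where the relations in the double and in `U_q^ext(sl_N)` have the same coefficients
(`UqExt.mem_straightening`). -/

noncomputable section

/-! ### Coproduct identities for skew-primitive elements, in a bare algebra -/

section TensorIdentities

variable {k R : Type*} [Field k] [Ring R] [Algebra k R]

lemma map_serre_eq {k R R' : Type*} [CommRing k] [Ring R] [Algebra k R] [Ring R'] [Algebra k R']
    (φ : R →ₐ[k] R') (a : k) (u v : R) :
    φ (u ^ 2 * v - a • (u * v * u) + v * u ^ 2) =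
      φ u ^ 2 * φ v - a • (φ u * φ v * φ u) + φ v * φ u ^ 2 := by
  simp only [map_add, map_sub, map_smul, map_mul, map_pow]

/-- This is the computation behind the fact that conjugating a skew-primitive element by a
group-like one leaves it skew-primitive for the same `c`: `g ⊗ g` acts on each tensor factor
separately, and `g` commutes with `c`. -/
lemma tmul_conj_eq {k R : Type*} [CommRing k] [Ring R] [Algebra k R] (g g' c u : R)
    (hgg : g * g' = 1) (hc : g * c = c * g) :
    (g ⊗ₜ[k] g) * (1 ⊗ₜ[k] u + u ⊗ₜ[k] c) * (g' ⊗ₜ[k] g') =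
      1 ⊗ₜ[k] (g * u * g') + (g * u * g') ⊗ₜ[k] c := by
  simp only [mul_add, add_mul, Algebra.TensorProduct.tmul_mul_tmul, mul_one, hgg, hc]
  rw [mul_assoc c, hgg, mul_one]

/-- The mixed terms `v ⊗ ud`, `v ⊗ du` and `u ⊗ cv`, `u ⊗ vc` cancel by the commutation hypotheses,
so the commutator of two skew-primitive elements is skew-primitive for `cd`. -/
lemma tmul_commutator_eq {k R : Type*} [CommRing k] [Ring R] [Algebra k R] (c d u v : R)
    (hcd : c * d = d * c) (hcv : c * v = v * c) (hdu : d * u = u * d) :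
    (1 ⊗ₜ[k] u + u ⊗ₜ[k] c) * (1 ⊗ₜ[k] v + v ⊗ₜ[k] d) -
        (1 ⊗ₜ[k] v + v ⊗ₜ[k] d) * (1 ⊗ₜ[k] u + u ⊗ₜ[k] c) =
      1 ⊗ₜ[k] (u * v - v * u) + (u * v - v * u) ⊗ₜ[k] (c * d) := by
  simp only [mul_add, add_mul, Algebra.TensorProduct.tmul_mul_tmul, mul_one, one_mul, hcd, hcv, hdu,
    TensorProduct.tmul_sub, TensorProduct.sub_tmul]
  abel

/-- If `x`, `y` `q`-commute with `u`, `v`, the quantum Serre expression is additive. -/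
lemma serre_add_eq (a : k) (ha : a ≠ 0) (x y u v : R) (h1 : x * u = (a ^ (-2 : ℤ)) • (u * x))
    (h2 : x * v = a • (v * x)) (h3 : y * u = a • (u * y)) :
    (x + u) ^ 2 * (y + v) - (a + a⁻¹) • ((x + u) * (y + v) * (x + u)) + (y + v) * (x + u) ^ 2
      = (x ^ 2 * y - (a + a⁻¹) • (x * y * x) + y * x ^ 2) +
        (u ^ 2 * v - (a + a⁻¹) • (u * v * u) + v * u ^ 2) := by
  have h1' : ∀ w, x * (u * w) = (a ^ (-2 : ℤ)) • (u * (x * w)) := fun w => by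
    rw [← mul_assoc, h1, smul_mul_assoc, mul_assoc]
  have h2' : ∀ w, x * (v * w) = a • (v * (x * w)) := fun w => by
    rw [← mul_assoc, h2, smul_mul_assoc, mul_assoc]
  have h3' : ∀ w, y * (u * w) = a • (u * (y * w)) := fun w => by
    rw [← mul_assoc, h3, smul_mul_assoc, mul_assoc]
  -- Every mixed word is rewritten with `u`, `v` to the left of `x`, `y`. Each word contains exactly
  -- one of `y`, `v`, so these two never meet and the three relations suffice; the coefficients of
  -- the mixed words then vanish.
  simp only [pow_two, mul_add, add_mul, mul_assoc, h1, h2, h3, h1', h2', h3', mul_smul_comm,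
    smul_mul_assoc, smul_add]
  match_scalars <;> field_simp <;> ring

/-- The elements `1 ⊗ u`, `1 ⊗ v` `q`-commute with `u ⊗ c`, `v ⊗ d` in the way required by
`serre_add_eq`, so the Serre expression splits into its two pure parts. Hence Serre expressions of
skew-primitive elements are skew-primitive for `c²d`. -/
lemma tmul_serre_eq (a : k) (ha : a ≠ 0) (c d u v : R)
    (hcd : c * d = d * c) (h1 : c * u = (a ^ (2 : ℤ)) • (u * c))
    (h2 : d * u = a⁻¹ • (u * d)) (h3 : c * v = a⁻¹ • (v * c)) :
    (1 ⊗ₜ[k] u + u ⊗ₜ[k] c) ^ 2 * (1 ⊗ₜ[k] v + v ⊗ₜ[k] d) - (a + a⁻¹) •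
        ((1 ⊗ₜ[k] u + u ⊗ₜ[k] c) * (1 ⊗ₜ[k] v + v ⊗ₜ[k] d) * (1 ⊗ₜ[k] u + u ⊗ₜ[k] c)) +
        (1 ⊗ₜ[k] v + v ⊗ₜ[k] d) * (1 ⊗ₜ[k] u + u ⊗ₜ[k] c) ^ 2 =
      1 ⊗ₜ[k] (u ^ 2 * v - (a + a⁻¹) • (u * v * u) + v * u ^ 2) +
        (u ^ 2 * v - (a + a⁻¹) • (u * v * u) + v * u ^ 2) ⊗ₜ[k] (c ^ 2 * d) := by
  rw [serre_add_eq a ha]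
  -- The right tensor factors of the three words are `ccd`, `cdc` and `dcc`; they must agree before
  -- the Serre expression can be factored out on the left.
  · have e1 : c * d * c = c * c * d := by rw [mul_assoc, ← hcd, mul_assoc]
    have e2 : d * (c * c) = c * c * d := by rw [← mul_assoc, ← hcd, e1]
    simp only [pow_two, Algebra.TensorProduct.tmul_mul_tmul, mul_one, TensorProduct.tmul_sub,
      TensorProduct.sub_tmul, TensorProduct.tmul_add, TensorProduct.add_tmul, e1, e2,
      TensorProduct.tmul_smul, TensorProduct.smul_tmul']
  · simp only [Algebra.TensorProduct.tmul_mul_tmul, mul_one, one_mul, h1, TensorProduct.tmul_smul,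
      smul_smul]
    rw [← zpow_add₀ ha]; simp
  · simp only [Algebra.TensorProduct.tmul_mul_tmul, mul_one, one_mul, h2, TensorProduct.tmul_smul,
      smul_smul, mul_inv_cancel₀ ha, one_smul]
  · simp only [Algebra.TensorProduct.tmul_mul_tmul, mul_one, one_mul, h3, TensorProduct.tmul_smul,
      smul_smul, mul_inv_cancel₀ ha, one_smul]

/-- Here `φ` and `ψ` stand for `mulDual` and `tensorDual`. In the abstract form, the statement about
functionals becomes the identity `tmul_serre_eq` inside `R ⊗ R`. -/
lemma map_serre_eq_tmul {R' : Type*} [Ring R'] [Algebra k R'] (φ : R →ₐ[k] R')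
    (ψ : R ⊗[k] R →ₐ[k] R') (a : k) (ha : a ≠ 0) (c d u v : R)
    (hu : φ u = ψ (1 ⊗ₜ u + u ⊗ₜ c)) (hv : φ v = ψ (1 ⊗ₜ v + v ⊗ₜ d))
    (hcd : c * d = d * c) (h1 : c * u = (a ^ (2 : ℤ)) • (u * c))
    (h2 : d * u = a⁻¹ • (u * d)) (h3 : c * v = a⁻¹ • (v * c)) :
    φ (u ^ 2 * v - (a + a⁻¹) • (u * v * u) + v * u ^ 2) =
      ψ (1 ⊗ₜ (u ^ 2 * v - (a + a⁻¹) • (u * v * u) + v * u ^ 2) +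
        (u ^ 2 * v - (a + a⁻¹) • (u * v * u) + v * u ^ 2) ⊗ₜ (c ^ 2 * d)) := by
  rw [map_serre_eq, hu, hv, ← map_serre_eq, tmul_serre_eq a ha c d u v hcd h1 h2 h3]

end TensorIdentities

/-! ### Characters and skew derivations in the dual algebra -/

/-- The convolution algebra of linear functionals on a coalgebra. -/
abbrev ConvDual (k V : Type*) [CommRing k] [AddCommGroup V] [Module k V] [Coalgebra k V] : Type _ :=
  WithConv (V →ₗ[k] k)

namespace ConvDual

variable {k V : Type*} [CommRing k] [Ring V] [Bialgebra k V]

variable (k V) in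
/-- The transpose of the multiplication, `f ↦ (x ⊗ y ↦ f (x y))`. -/
def mulDual : ConvDual k V →ₐ[k] ConvDual k (V ⊗[k] V) :=
  AlgHom.ofLinearMap
    { toFun := fun f => toConv (f.ofConv ∘ₗ (Bialgebra.mulCoalgHom k V).toLinearMap)
      map_add' := fun _ _ => rfl
      map_smul' := fun _ _ => rfl }
    (conv_comp_one _) (fun f g => conv_comp_mul f g _)

variable (k V) in
/-- The canonical map `V* ⊗ V* → (V ⊗ V)*`. -/
def tensorDual : ConvDual k V ⊗[k] ConvDual k V →ₐ[k] ConvDual k (V ⊗[k] V) :=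
  Algebra.TensorProduct.algHomOfLinearMapTensorProduct
    (TensorProduct.lift (LinearMap.mk₂ k
      (fun f g : ConvDual k V => toConv (LinearMap.mul' k k ∘ₗ TensorProduct.map f.ofConv g.ofConv))
      (fun _ _ _ => by ext; simp [add_mul]) (fun _ _ _ => by ext; simp [mul_assoc])
      (fun _ _ _ => by ext; simp [mul_add]) (fun _ _ _ => by ext; simp [mul_left_comm])))
    (fun f f' g g' => (TwoCocycle.conv_map_mul f f' g g').symm)
    (by ext; simp [mul_comm])

lemma tensorDual_tmul (f g : ConvDual k V) (x y : V) :
    (tensorDual k V (f ⊗ₜ g)) (x ⊗ₜ y) = f x * g y := rfl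

lemma mulDual_eq_iff (u : ConvDual k V) (X : ConvDual k V ⊗[k] ConvDual k V) :
    mulDual k V u = tensorDual k V X ↔ ∀ x y, u (x * y) = (tensorDual k V X) (x ⊗ₜ y) := by
  constructor
  · intro h x y
    rw [← h]; rfl
  · intro h
    ext x y
    exact h x y

/-- Evaluation at a group-like element is multiplicative. -/
lemma conv_apply_of_comul {g : V} (h : comul (R := k) g = g ⊗ₜ g) (f f' : ConvDual k V) :
    (f * f') g = f g * f' g := by simp [h]

/-- An algebra homomorphism to the ground ring, viewed in the convolution algebra. -/
def ofAlgHom (φ : V →ₐ[k] k) : ConvDual k V := toConv φ.toLinearMap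

lemma mulDual_ofAlgHom (φ : V →ₐ[k] k) :
    mulDual k V (ofAlgHom φ) = tensorDual k V (ofAlgHom φ ⊗ₜ ofAlgHom φ) :=
  (mulDual_eq_iff _ _).2 fun x y => map_mul φ x y

/-- The convolution product of two characters. -/
def mulChar (φ ψ : V →ₐ[k] k) : V →ₐ[k] k :=
  (Algebra.TensorProduct.lift φ ψ fun _ _ => Commute.all _ _).comp (Bialgebra.comulAlgHom k V)

lemma ofAlgHom_mul (φ ψ : V →ₐ[k] k) : ofAlgHom φ * ofAlgHom ψ = ofAlgHom (mulChar φ ψ) := by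
  ext x
  change LinearMap.mul' k k (TensorProduct.map φ.toLinearMap ψ.toLinearMap (comul x)) =
    Algebra.TensorProduct.lift φ ψ (fun _ _ => Commute.all _ _) (comul x)
  induction comul (R := k) x with
  | zero => simp
  | add x y hx hy => simp only [map_add, hx, hy]
  | tmul a b => simp

/-- `u (x y) = ε(x) u(y) + u(x) c(y)`. -/
def IsSkewDer (c u : ConvDual k V) : Prop :=
  mulDual k V u = tensorDual k V (1 ⊗ₜ u + u ⊗ₜ c)

lemma IsSkewDer.apply_mul {c u : ConvDual k V} (h : IsSkewDer c u) (x y : V) :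
    u (x * y) = counit (R := k) x * u y + u x * c y := by
  rw [(mulDual_eq_iff _ _).1 h]
  simp [tensorDual_tmul]

lemma isSkewDer_iff {c u : ConvDual k V} :
    IsSkewDer c u ↔ ∀ x y, u (x * y) = counit (R := k) x * u y + u x * c y :=
  ⟨fun h => h.apply_mul, fun h => (mulDual_eq_iff _ _).2 fun x y => by
    rw [h]; simp [tensorDual_tmul]⟩

lemma IsSkewDer.smul {c u : ConvDual k V} (h : IsSkewDer c u) (a : k) : IsSkewDer c (a • u) := by
  rw [isSkewDer_iff] at h ⊢
  intro x y
  have := h x y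
  simp [this]; ring

/-- At the pair `(1, 1)` the product rule reads `u(1) = u(1) + u(1)`. -/
lemma IsSkewDer.apply_one {c u : ConvDual k V} (h : IsSkewDer c u) (hc : c 1 = 1) :
    u 1 = 0 := by
  have := h.apply_mul 1 1
  simpa [hc] using this

/-- Conjugation by a character preserves skew derivations. -/
lemma IsSkewDer.conj {c u g g' : ConvDual k V} (h : IsSkewDer c u)
    (hg : mulDual k V g = tensorDual k V (g ⊗ₜ g))
    (hg' : mulDual k V g' = tensorDual k V (g' ⊗ₜ g'))
    (hgg : g * g' = 1) (hc : g * c = c * g) : IsSkewDer c (g * u * g') := by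
  rw [IsSkewDer, map_mul, map_mul, hg, hg', h, ← map_mul, ← map_mul]
  exact congrArg _ (tmul_conj_eq g g' c u hgg hc)

/-- Both `mulDual` and `tensorDual` are algebra homomorphisms, so `tmul_commutator_eq` transfers to
functionals. This allows the commutation of distant root functionals to be tested on generators. -/
lemma IsSkewDer.commutator {c d u v : ConvDual k V} (hu : IsSkewDer c u) (hv : IsSkewDer d v)
    (hcd : c * d = d * c) (hcv : c * v = v * c) (hdu : d * u = u * d) :
    IsSkewDer (c * d) (u * v - v * u) := by
  rw [IsSkewDer, map_sub, map_mul, map_mul, hu, hv, ← map_mul, ← map_mul, ← map_sub]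
  exact congrArg _ (tmul_commutator_eq c d u v hcd hcv hdu)

/-- The quantum Serre expression of two skew derivations is a skew derivation. -/
lemma IsSkewDer.serre {k V : Type*} [Field k] [Ring V] [Bialgebra k V] (a : k)
    (ha : a ≠ 0) {c d u v : ConvDual k V} (hu : IsSkewDer c u) (hv : IsSkewDer d v)
    (hcd : c * d = d * c) (h1 : c * u = (a ^ (2 : ℤ)) • (u * c))
    (h2 : d * u = a⁻¹ • (u * d)) (h3 : c * v = a⁻¹ • (v * c)) :
    IsSkewDer (c ^ 2 * d) (u ^ 2 * v - (a + a⁻¹) • (u * v * u) + v * u ^ 2) :=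
  map_serre_eq_tmul (mulDual k V) (tensorDual k V) a ha c d u v hu hv hcd h1 h2 h3

end ConvDual

/-! ### Functionals on `U_q(b_-)` that satisfy the relations of `U_q(b_-)` -/

/-- The characters of the torus: families of units with product one. -/
def torusChars (k : Type*) [Field k] (n : ℕ) : Subgroup (Fin (n + 1) → kˣ) where
  carrier := {c | ∏ i, c i = 1}
  mul_mem' {c d} hc hd := by
    rw [Set.mem_ofPred_eq] at hc hd ⊢
    simp [Finset.prod_mul_distrib, hc, hd]
  one_mem' := by simp
  inv_mem' {c} hc := by
    rw [Set.mem_ofPred_eq] at hc ⊢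
    simp [hc]

lemma torusChars.prod_eq_one {k : Type*} [Field k] {n : ℕ} (c : torusChars k n) :
    ∏ i, (c.1 i : k) = 1 := by
  rw [← Units.coe_prod, show ∏ i, c.1 i = 1 from c.2, Units.val_one]

namespace UqMinus

open QAlg ConvDual

variable {k : Type*} [Field k] {q : kˣ} {n : ℕ}

section

variable (q)

/-- The one-dimensional representation `K̂_i ↦ c_i`, `E_s ↦ 0`. -/
def charRep (c : torusChars k n) : QRep k q n True False k where
  K i := c.1 i
  Kinv i := ((c.1 i)⁻¹ : kˣ)
  E _ _ := 0
  F h := h.elim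
  torus := ⟨fun _ _ => mul_comm _ _, fun i => by simp, fun i => by simp, by
    rw [List.prod_ofFn, torusChars.prod_eq_one c]⟩
  borelE _ := ⟨by simp, by simp, by simp⟩
  borelF h := h.elim
  cross _ h := h.elim

/-- The character `K̂_i ↦ c_i`, `E_s ↦ 0`. -/
def char (c : torusChars k n) : UqMinus k q n →ₐ[k] k := lift (charRep q c)

lemma char_K (c : torusChars k n) (i : Fin (n + 1)) : char q c (K k q i) = c.1 i := lift_K _ _

lemma char_Kinv (c : torusChars k n) (i : Fin (n + 1)) :
    char q c (Kinv k q i) = ((c.1 i)⁻¹ : kˣ) := lift_Kinv _ _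

lemma char_E (c : torusChars k n) (s : Fin n) : char q c (E k q trivial s) = 0 := lift_E _ _ _

lemma mulChar_char (c d : torusChars k n) : mulChar (char q c) (char q d) = char q (c * d) := by
  have h : ∀ x, mulChar (char q c) (char q d) x =
    Algebra.TensorProduct.lift (char q c) (char q d) (fun _ _ => Commute.all _ _)
      (comulHom k q n True False x) := fun _ => rfl
  apply algHom_ext
  · intro i; simp [h, char_K]
  · intro i; simp [h, char_Kinv, mul_comm]
  · intro _ s; simp [h, char_E]
  · intro hf; exact hf.elim

lemma char_one : char q (1 : torusChars k n) = counitHom k q n True False := by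
  apply algHom_ext
  · intro i; simp [char_K]
  · intro i; simp [char_Kinv]
  · intro _ s; simp [char_E]
  · intro hf; exact hf.elim

/-- The characters of the torus as elements of the dual algebra. -/
def charHom : torusChars k n →* ConvDual k (UqMinus k q n) where
  toFun c := ofAlgHom (char q c)
  map_one' := by rw [char_one]; rfl
  map_mul' c d := by rw [ofAlgHom_mul, mulChar_char]

lemma charHom_apply (c : torusChars k n) (x : UqMinus k q n) : charHom q c x = char q c x := rfl

lemma charHom_comm (c d : torusChars k n) :
    charHom q c * charHom q d = charHom q d * charHom q c := by
  rw [← map_mul, ← map_mul, mul_comm]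

lemma charHom_mul_inv (c : torusChars k n) : charHom q c * charHom q c⁻¹ = 1 := by
  rw [← map_mul, mul_inv_cancel, map_one]

lemma charHom_inv_mul (c : torusChars k n) : charHom q c⁻¹ * charHom q c = 1 := by
  rw [← map_mul, inv_mul_cancel, map_one]

end

/-- The group-like element `K̂_s K̂_{s+1}⁻¹`. -/
def Kd (k : Type*) [Field k] (q : kˣ) {n : ℕ} (s : Fin n) : UqMinus k q n :=
  K k q s.castSucc * Kinv k q s.succ

lemma comul_Kd (s : Fin n) : comul (R := k) (Kd k q s) = Kd k q s ⊗ₜ Kd k q s := by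
  rw [comul_eq, Kd, map_mul, comulHom_K, comulHom_Kinv, Algebra.TensorProduct.tmul_mul_tmul]

lemma conv_apply_one (f g : ConvDual k (UqMinus k q n)) : (f * g) 1 = f 1 * g 1 :=
  conv_apply_of_comul (by simp [Algebra.TensorProduct.one_def]) f g

lemma conv_apply_K (f g : ConvDual k (UqMinus k q n)) (i : Fin (n + 1)) :
    (f * g) (K k q i) = f (K k q i) * g (K k q i) :=
  conv_apply_of_comul (comulHom_K i) f g

lemma conv_apply_Kinv (f g : ConvDual k (UqMinus k q n)) (i : Fin (n + 1)) :
    (f * g) (Kinv k q i) = f (Kinv k q i) * g (Kinv k q i) :=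
  conv_apply_of_comul (comulHom_Kinv i) f g

lemma conv_apply_Kd (f g : ConvDual k (UqMinus k q n)) (s : Fin n) :
    (f * g) (Kd k q s) = f (Kd k q s) * g (Kd k q s) :=
  conv_apply_of_comul (comul_Kd s) f g

/-- The elements `E_s` are the generators at which convolution is not pointwise; the two terms come
from `Δ(E_s) = 1 ⊗ E_s + E_s ⊗ K̂_s K̂_{s+1}⁻¹`. -/
lemma conv_apply_E (f g : ConvDual k (UqMinus k q n)) (s : Fin n) :
    (f * g) (E k q trivial s) = f 1 * g (E k q trivial s) + f (E k q trivial s) * g (Kd k q s) := by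
  change LinearMap.mul' k k (TensorProduct.map f.ofConv g.ofConv (comulHom k q n True False _)) = _
  simp [Kd]

/-- A skew derivation is determined by its values on generators. -/
lemma eq_of_isSkewDer {c u v : ConvDual k (UqMinus k q n)} (hu : IsSkewDer c u)
    (hv : IsSkewDer c v) (hc : c 1 = 1) (hK : ∀ i, u (K k q i) = v (K k q i))
    (hKinv : ∀ i, u (Kinv k q i) = v (Kinv k q i))
    (hE : ∀ s, u (E k q trivial s) = v (E k q trivial s)) : u = v := by
  let S : Subalgebra k (UqMinus k q n) :=
    { carrier := {x | u x = v x}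
      mul_mem' := fun {a b} ha hb => by
        rw [Set.mem_ofPred_eq] at ha hb ⊢
        rw [hu.apply_mul, hv.apply_mul, ha, hb]
      add_mem' := fun {a b} ha hb => by
        rw [Set.mem_ofPred_eq] at ha hb ⊢
        rw [map_add, map_add, ha, hb]
      -- On scalars both functionals vanish, because `c 1 = 1` forces a skew derivation to kill `1`.
      algebraMap_mem' := fun a => by
        rw [Set.mem_ofPred_eq, Algebra.algebraMap_eq_smul_one, map_smul, map_smul,
          hu.apply_one hc, hv.apply_one hc] }
  ext x
  exact mem_of_gens S hK hKinv (fun _ => hE) (fun h => h.elim) x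

/-- This is what lets the powers `q^{-qWeight i s}` define a character, since the product over `i`
has to be one. -/
lemma sum_qWeight (s : Fin n) : ∑ i, qWeight i s = 0 := by
  simp [qWeight, Finset.sum_sub_distrib]

/-- The character `K̂_i ↦ q^{δ_{i,s+1} - δ_{i,s}}`. -/
def weightChar (q : kˣ) (s : Fin n) : torusChars k n :=
  ⟨fun i => q ^ (-qWeight i s), by
    change ∏ i, q ^ (-qWeight i s) = 1
    -- The product of powers of `q` becomes a power with summed exponent, through the homomorphism
    -- from the multiplicative copy of `ℤ` given by powers of `q`.
    have h := map_prod (zpowersHom kˣ q) (fun i => Multiplicative.ofAdd (-qWeight i s)) Finset.univ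
    rw [← ofAdd_sum, Finset.sum_neg_distrib, sum_qWeight] at h
    simpa using h.symm⟩

/-- The representation `K̂_i ↦ diag(1, q^{δ_{i,s+1} - δ_{i,s}})`, `E_t ↦ δ_{s,t} a e₁₂`. -/
def matRep (q : kˣ) (a : k) (s : Fin n) : QRep k q n True False (Matrix (Fin 2) (Fin 2) k) where
  K i := Matrix.diagonal ![1, (weightChar q s).1 i]
  Kinv i := Matrix.diagonal ![1, (((weightChar q s).1 i)⁻¹ : kˣ)]
  E _ t := !![0, if s = t then a else 0; 0, 0]
  F h := h.elim
  torus :=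
    { comm := fun i j => by
        rw [Matrix.diagonal_mul_diagonal, Matrix.diagonal_mul_diagonal]
        congr 1; ext m; exact mul_comm _ _
      mul_inv := fun i => by
        rw [Matrix.diagonal_mul_diagonal, ← Matrix.diagonal_one]
        congr 1; ext m; fin_cases m <;> simp
      inv_mul := fun i => by
        rw [Matrix.diagonal_mul_diagonal, ← Matrix.diagonal_one]
        congr 1; ext m; fin_cases m <;> simp
      prod := by
        have h := map_list_prod (Matrix.diagonalRingHom (Fin 2) k)
          (List.ofFn fun i => ![1, ((weightChar q s).1 i : k)])
        rw [List.map_ofFn] at h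
        refine h.symm.trans ?_
        rw [List.prod_ofFn]
        have : ∏ i, ![1, ((weightChar q s).1 i : k)] = 1 := by
          ext m
          rw [Finset.prod_apply]
          fin_cases m
          · simp
          · exact torusChars.prod_eq_one (weightChar q s)
        rw [this, map_one] }
  borelE _ :=
    { weight := fun i t => by
        ext a b
        fin_cases a <;> fin_cases b <;> simp [Matrix.mul_apply, Fin.sum_univ_two]
        -- Conjugation by `diag(1, χ)` multiplies `e₁₂` by `χ⁻¹`. For `χ = q^{-qWeight i s}` this is
        -- the weight of `E_s`, and for `t ≠ s` the matrix of `E_t` is zero.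
        split_ifs with h
        · subst h
          simp [weightChar, mul_comm]
        · rfl
      -- Products of two strictly upper triangular matrices of size two vanish, so the commutation
      -- and Serre relations hold trivially here.
      comm := fun t t' h => by
        generalize (if s = t then a else 0) = x
        generalize (if s = t' then a else 0) = y
        ext a b
        fin_cases a <;> fin_cases b <;> simp
      serre := fun t t' h => by
        generalize (if s = t then a else 0) = x
        generalize (if s = t' then a else 0) = y
        ext a b
        fin_cases a <;> fin_cases b <;> simp [pow_two] }
  borelF h := h.elim
  cross _ h := h.elim

/-- The generators go to upper triangular matrices, and the diagonal entries of such matrices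
multiply independently. They are therefore the counit and the weight character, and only the corner
entry carries new information. -/
lemma lift_matRep_apply (a : k) (s : Fin n) (x : UqMinus k q n) :
    lift (matRep q a s) x 0 0 = counitHom k q n True False x ∧ lift (matRep q a s) x 1 0 = 0 ∧
      lift (matRep q a s) x 1 1 = char q (weightChar q s) x := by
  let S : Subalgebra k (UqMinus k q n) :=
    { carrier := {x | lift (matRep q a s) x 0 0 = counitHom k q n True False x ∧
        lift (matRep q a s) x 1 0 = 0 ∧ lift (matRep q a s) x 1 1 = char q (weightChar q s) x}
      mul_mem' := fun {a b} ha hb => by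
        rw [Set.mem_ofPred_eq] at ha hb ⊢
        simp [Matrix.mul_apply, Fin.sum_univ_two, ha, hb]
      add_mem' := fun {a b} ha hb => by
        rw [Set.mem_ofPred_eq] at ha hb ⊢
        simp [ha, hb]
      algebraMap_mem' := fun a => by
        rw [Set.mem_ofPred_eq]
        simp [Matrix.algebraMap_matrix_apply] }
  refine mem_of_gens S (fun i => ?_) (fun i => ?_) (fun _ t => ?_) (fun h => h.elim) x
  · change _ ∧ _ ∧ _
    simp [char_K, matRep]
  · change _ ∧ _ ∧ _
    simp [char_Kinv, matRep]
  · change _ ∧ _ ∧ _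
    simp [char_E, matRep]

/-- The functional `⟨E_s, ·⟩`, a skew derivation with value `a` on `E_s`. -/
def rootFun (q : kˣ) (a : k) (s : Fin n) : ConvDual k (UqMinus k q n) :=
  toConv (Matrix.entryLinearMap k k 0 1 ∘ₗ (lift (matRep q a s)).toLinearMap)

lemma rootFun_apply (a : k) (s : Fin n) (x : UqMinus k q n) :
    rootFun q a s x = lift (matRep q a s) x 0 1 := rfl

@[simp] lemma rootFun_K (a : k) (s : Fin n) (i : Fin (n + 1)) : rootFun q a s (K k q i) = 0 := by
  simp [rootFun_apply, matRep]

@[simp] lemma rootFun_Kinv (a : k) (s : Fin n) (i : Fin (n + 1)) :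
    rootFun q a s (Kinv k q i) = 0 := by
  simp [rootFun_apply, matRep]

@[simp] lemma rootFun_E (a : k) (s t : Fin n) :
    rootFun q a s (E k q trivial t) = if s = t then a else 0 := by
  simp [rootFun_apply, matRep]

/-- The corner entry of a product of triangular matrices is `ε(x)` times the corner of `y` plus the
corner of `x` times `χ_s(y)`. -/
lemma isSkewDer_rootFun (a : k) (s : Fin n) :
    IsSkewDer (charHom q (weightChar q s)) (rootFun q a s) := by
  rw [isSkewDer_iff]
  intro x y
  rw [rootFun_apply, map_mul, Matrix.mul_apply, Fin.sum_univ_two, (lift_matRep_apply a s x).1,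
    (lift_matRep_apply a s y).2.2]
  rfl

lemma charHom_one_apply (c : torusChars k n) : charHom q c 1 = 1 := map_one (char q c)

@[simp] lemma rootFun_one (a : k) (s : Fin n) : rootFun q a s 1 = 0 :=
  (isSkewDer_rootFun a s).apply_one (charHom_one_apply _)

@[simp] lemma rootFun_Kd (a : k) (s t : Fin n) : rootFun q a s (Kd k q t) = 0 := by
  rw [Kd, (isSkewDer_rootFun a s).apply_mul]; simp

lemma charHom_Kd (c : torusChars k n) (s : Fin n) :
    charHom q c (Kd k q s) = (c.1 s.castSucc : k) * ((c.1 s.succ)⁻¹ : kˣ) := by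
  rw [charHom_apply, Kd, map_mul, char_K, char_Kinv]

/-- Conjugating `⟨E_s, ·⟩` by a character rescales it. -/
lemma charHom_conj_rootFun (c : torusChars k n) (a : k) (s : Fin n) :
    charHom q c * rootFun q a s * charHom q c⁻¹ =
      (((c.1 s.castSucc)⁻¹ * c.1 s.succ : kˣ) : k) • rootFun q a s := by
  -- Both sides are skew derivations for the same weight character, so only generators matter. On
  -- the torus generators both sides vanish.
  refine eq_of_isSkewDer ((isSkewDer_rootFun a s).conj (mulDual_ofAlgHom _) (mulDual_ofAlgHom _)
    (charHom_mul_inv q c) (charHom_comm q _ _)) ((isSkewDer_rootFun a s).smul _)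
    (charHom_one_apply _) (fun i => ?_) (fun i => ?_) (fun t => ?_)
  · rw [conv_apply_K, conv_apply_K]; simp
  · rw [conv_apply_Kinv, conv_apply_Kinv]; simp
  -- At `E_t` the factor `charHom q c⁻¹` is evaluated at `K̂_t K̂_{t+1}⁻¹`, which produces the
  -- scalar; `rootFun` leaves only `t = s`.
  · rw [conv_apply_E, conv_apply_E, conv_apply_one, charHom_Kd]
    simp only [rootFun_one, rootFun_E, ofConv_smul, LinearMap.smul_apply, charHom_one_apply]
    split_ifs with h
    · subst h; simp; ring
    · simp

lemma charHom_mul_rootFun (c : torusChars k n) (a : k) (s : Fin n) :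
    charHom q c * rootFun q a s =
      (((c.1 s.castSucc)⁻¹ * c.1 s.succ : kˣ) : k) • (rootFun q a s * charHom q c) := by
  rw [← smul_mul_assoc, ← charHom_conj_rootFun, mul_assoc, charHom_inv_mul, mul_one]

/-- These are the `q`-commutation relations demanded by `IsSkewDer.commutator` and
`IsSkewDer.serre`. The exponent is a Cartan matrix entry: `0` for distant indices, `-1` for
neighbours, `2` on the diagonal. -/
lemma weightChar_mul_rootFun (a : k) (s t : Fin n) :
    charHom q (weightChar q s) * rootFun q a t =
      ((q ^ qCartan s t : kˣ) : k) • (rootFun q a t * charHom q (weightChar q s)) := by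
  rw [charHom_mul_rootFun, qCartan_comm]
  congr 3
  simp only [weightChar, qCartan, zpow_neg, inv_inv, zpow_sub]

/-- Functionals satisfying the defining relations of `U_q(b_-)`, from characters for which
`K̂_i ↦ κ_i` is compatible with the weights. -/
def dualRep (q : kˣ) (a : k) (κ : Fin (n + 1) → torusChars k n) (hκ : ∏ i, κ i = 1)
    (hw : ∀ i (t : Fin n), ((κ i).1 t.castSucc)⁻¹ * (κ i).1 t.succ = q ^ qWeight i t) :
    QRep k q n True False (ConvDual k (UqMinus k q n)) where
  K i := charHom q (κ i)
  Kinv i := charHom q (κ i)⁻¹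
  E _ s := rootFun q a s
  F h := h.elim
  torus :=
    { comm := fun i j => charHom_comm q _ _
      mul_inv := fun i => charHom_mul_inv q _
      inv_mul := fun i => charHom_inv_mul q _
      prod := by
        have h := map_list_prod (charHom q) (List.ofFn κ)
        rw [List.map_ofFn] at h
        refine h.symm.trans ?_
        rw [List.prod_ofFn, hκ, map_one] }
  borelE _ :=
    { weight := fun i t => by rw [charHom_conj_rootFun, hw]
      comm := fun s t h => by
        rw [← sub_eq_zero]
        have hst := weightChar_mul_rootFun (q := q) a s t
        have hts := weightChar_mul_rootFun (q := q) a t s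
        rw [qCartan_far h, zpow_zero, Units.val_one, one_smul] at hst
        rw [qCartan_comm, qCartan_far h, zpow_zero, Units.val_one, one_smul] at hts
        -- The commutator is compared with the zero functional, which is a skew derivation for every
        -- `c`.
        refine eq_of_isSkewDer ((isSkewDer_rootFun a t).commutator (isSkewDer_rootFun a s)
          (charHom_comm q _ _) hts hst) (isSkewDer_iff.2 fun _ _ => by simp) ?_ ?_ ?_ ?_
        · rw [← map_mul, charHom_one_apply]
        all_goals intro i
        all_goals rw [ofConv_sub, LinearMap.sub_apply]
        · simp only [conv_apply_K]; simp
        · simp only [conv_apply_Kinv]; simp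
        -- A product of two root functionals vanishes at every `E` generator, since root functionals
        -- vanish both at `1` and at the elements `Kd`.
        · simp only [conv_apply_E]; simp
      serre := fun s t h => by
        have hss := weightChar_mul_rootFun (q := q) a s s
        have hst := weightChar_mul_rootFun (q := q) a s t
        have hts := weightChar_mul_rootFun (q := q) a t s
        rw [qCartan_self, Units.val_zpow_eq_zpow_val] at hss
        rw [qCartan_near h, zpow_neg_one, Units.val_inv_eq_inv_val] at hst
        rw [qCartan_comm, qCartan_near h, zpow_neg_one, Units.val_inv_eq_inv_val] at hts
        -- Again a comparison with zero, now for the Serre expression, whose character is `χ_s²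
        -- χ_t`.
        refine eq_of_isSkewDer (IsSkewDer.serre (q : k) q.ne_zero (isSkewDer_rootFun a s)
          (isSkewDer_rootFun a t) (charHom_comm q _ _) hss hts hst)
          (isSkewDer_iff.2 fun _ _ => by simp) ?_ ?_ ?_ ?_
        · rw [← map_pow, ← map_mul, charHom_one_apply]
        all_goals intro i
        all_goals rw [ofConv_add, ofConv_sub, ofConv_smul, LinearMap.add_apply, LinearMap.sub_apply,
          LinearMap.smul_apply, pow_two]
        · simp only [conv_apply_K]; simp
        · simp only [conv_apply_Kinv]; simp
        · simp only [conv_apply_E, conv_apply_one, conv_apply_Kd]; simp }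
  borelF h := h.elim
  cross _ h := h.elim

end UqMinus

/-! ### Pairings as homomorphisms to the dual algebra -/

namespace HopfPairing

open ConvDual

variable {k U V : Type*} [CommRing k] [Ring U] [Ring V] [Bialgebra k U] [Bialgebra k V]

lemma ext_form {p p' : HopfPairing k U V} (h : p.form = p'.form) : p = p' := by
  cases p; cases p'; cases h; rfl

/-- A pairing as an algebra homomorphism to the dual algebra. -/
def toDual (p : HopfPairing k U V) : U →ₐ[k] ConvDual k V :=
  AlgHom.ofLinearMap ((WithConv.linearEquiv k _).symm.toLinearMap ∘ₗ p.form)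
    (by ext x; exact p.one_left x) (fun m m' => by ext x; exact p.mul_left m m' x)

lemma toDual_apply (p : HopfPairing k U V) (m : U) (x : V) : p.toDual m x = p.form m x := rfl

lemma ext_toDual {p p' : HopfPairing k U V} (h : p.toDual = p'.toDual) : p = p' :=
  ext_form (by ext m x; rw [← toDual_apply, h]; rfl)

/-- The character of `V` given by a group-like element of `U`. -/
def char (p : HopfPairing k U V) (g : U) (h1 : counit (R := k) g = 1)
    (h2 : comul (R := k) g = g ⊗ₜ g) : V →ₐ[k] k :=
  AlgHom.ofLinearMap (p.form g) (by rw [p.one_right, h1]) (fun x y => by simp [p.mul_right, h2])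

/-- Multiplication on the right is paired with the coproduct on the left, so a skew-primitive
element on the left acts on the right as a skew derivation. The uniqueness of the pairing rests on
this. -/
lemma isSkewDer (p : HopfPairing k U V) {m g : U} (h : comul (R := k) m = 1 ⊗ₜ m + m ⊗ₜ g) :
    IsSkewDer (p.toDual g) (p.toDual m) := by
  rw [isSkewDer_iff]
  intro x y
  simp only [toDual_apply, p.mul_right, h]
  simp [p.one_left]

/-- A pairing from an algebra homomorphism to the dual algebra. -/
def ofDual (φ : U →ₐ[k] ConvDual k V) (hmul : ∀ m, mulDual k V (φ m) =
      tensorDual k V (TensorProduct.map φ.toLinearMap φ.toLinearMap (comul (R := k) m)))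
    (hone : ∀ m, φ m 1 = counit (R := k) m) : HopfPairing k U V where
  form := (WithConv.linearEquiv k _).toLinearMap ∘ₗ φ.toLinearMap
  mul_left m m' x := by
    change (φ (m * m')) x = (φ m * φ m') x
    rw [map_mul]
  mul_right m x y := by
    refine ((mulDual_eq_iff _ _).1 (hmul m) x y).trans ?_
    induction comul (R := k) m with
    | zero => simp
    | add X Y hX hY =>
      rw [map_add, map_add, map_add, map_add, ← hX, ← hY]
      rfl
    | tmul a b => rfl
  one_left x := by
    change (φ 1) x = _
    rw [map_one]
    rfl
  one_right m := hone m

end HopfPairing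

/-! ### The self-duality of `U_q(b_-)` -/

namespace UqMinus

open QAlg ConvDual

variable {k : Type*} [Field k] {q : kˣ} {n : ℕ}

/-- The elements `K̂_i^{±1}` act through characters of the right-hand algebra, which are fixed by
their values on generators. Then `E_s` acts through a skew derivation for a character already known
to be common to both pairings, so its values on generators fix it as well. -/
lemma eq_of_isSelfForm {z : k} {p p' : HopfPairing k (UqMinus k q n) (UqMinus k q n)}
    (h : IsSelfForm z p.form) (h' : IsSelfForm z p'.form) : p = p' := by
  have hK : ∀ i, p.toDual (K k q i) = p'.toDual (K k q i) := fun i => by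
    have : p.char (K k q i) (counitHom_K i) (comulHom_K i) =
        p'.char (K k q i) (counitHom_K i) (comulHom_K i) :=
      algHom_ext (fun j => (h.K_K i j).trans (h'.K_K i j).symm)
        (fun j => (h.K_Kinv i j).trans (h'.K_Kinv i j).symm)
        (fun _ s => (h.K_E i s).trans (h'.K_E i s).symm) (fun h => h.elim)
    ext x
    exact DFunLike.congr_fun this x
  have hK' : ∀ i, p.toDual (Kinv k q i) = p'.toDual (Kinv k q i) := fun i => by
    have : p.char (Kinv k q i) (counitHom_Kinv i) (comulHom_Kinv i) =
        p'.char (Kinv k q i) (counitHom_Kinv i) (comulHom_Kinv i) :=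
      algHom_ext (fun j => (h.Kinv_K i j).trans (h'.Kinv_K i j).symm)
        (fun j => (h.Kinv_Kinv i j).trans (h'.Kinv_Kinv i j).symm)
        (fun _ s => (h.Kinv_E i s).trans (h'.Kinv_E i s).symm) (fun h => h.elim)
    ext x
    exact DFunLike.congr_fun this x
  have hd : ∀ s : Fin n, p.toDual (Kd k q s) = p'.toDual (Kd k q s) := fun s => by
    rw [Kd, map_mul, map_mul, hK, hK']
  refine HopfPairing.ext_toDual (algHom_ext hK hK' (fun _ s => ?_) (fun h => h.elim))
  -- The second skew derivation is transported along `hd`, so that both refer to the same character;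
  -- `Kd` has counit one, which supplies the normalization still to be shown.
  refine eq_of_isSkewDer (p.isSkewDer (comulHom_E trivial s))
    ((hd s).symm ▸ p'.isSkewDer (comulHom_E trivial s)) ?_
    (fun j => (h.E_K s j).trans (h'.E_K s j).symm)
    (fun j => (h.E_Kinv s j).trans (h'.E_Kinv s j).symm)
    (fun t => (h.E_E s t).trans (h'.E_E s t).symm)
  rw [p.toDual_apply, p.one_right]
  change counit (R := k) (Kd k q s) = 1
  rw [counit_eq, Kd, map_mul, counitHom_K, counitHom_Kinv, mul_one]

section Existence

variable (a : k) (κ : Fin (n + 1) → torusChars k n) (hκ : ∏ i, κ i = 1)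
    (hw : ∀ i (t : Fin n), ((κ i).1 t.castSucc)⁻¹ * (κ i).1 t.succ = q ^ qWeight i t)

/-- The algebra homomorphism `U_q(b_-) → U_q(b_-)*` attached to a family of characters. -/
def dualHom : UqMinus k q n →ₐ[k] ConvDual k (UqMinus k q n) := lift (dualRep q a κ hκ hw)

/-- The self-pairing of `U_q(b_-)` attached to a family of characters. -/
def selfPairing (hd : ∀ s : Fin n, κ s.castSucc * (κ s.succ)⁻¹ = weightChar q s) :
    HopfPairing k (UqMinus k q n) (UqMinus k q n) :=
  HopfPairing.ofDual (dualHom a κ hκ hw)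
    (fun m => by
      let φ := dualHom a κ hκ hw
      -- Both sides of the compatibility with the coproduct are algebra homomorphisms in `m`, so
      -- generators suffice: characters for the torus, the skew derivation rule for `E_s`.
      have : (mulDual k _).comp φ = (tensorDual k _).comp
          ((Algebra.TensorProduct.map φ φ).comp (comulHom k q n True False)) := by
        apply algHom_ext
        · intro i
          simp only [AlgHom.comp_apply, comulHom_K, Algebra.TensorProduct.map_tmul]
          simp only [φ, dualHom, lift_K]
          exact mulDual_ofAlgHom _
        · intro i
          simp only [AlgHom.comp_apply, comulHom_Kinv, Algebra.TensorProduct.map_tmul]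
          simp only [φ, dualHom, lift_Kinv]
          exact mulDual_ofAlgHom _
        · intro _ s
          simp only [AlgHom.comp_apply, comulHom_E, map_add, Algebra.TensorProduct.map_tmul,
            map_one, map_mul]
          simp only [φ, dualHom, lift_E, lift_K, lift_Kinv]
          -- The hypothesis `hd` enters here: the character in the product rule of the functional of
          -- `E_s` must be the image of `K̂_s K̂_{s+1}⁻¹`.
          have h := isSkewDer_rootFun (q := q) a s
          rw [← hd, map_mul, IsSkewDer, map_add] at h
          exact h
        · intro h; exact h.elim
      exact DFunLike.congr_fun this m)
    (fun m => by
      let S : Subalgebra k (UqMinus k q n) :=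
        { carrier := {m | dualHom a κ hκ hw m 1 = counitHom k q n True False m}
          mul_mem' := fun {a b} ha hb => by
            rw [Set.mem_ofPred_eq] at ha hb ⊢
            rw [map_mul, conv_apply_one, ha, hb, map_mul]
          add_mem' := fun {a b} ha hb => by
            rw [Set.mem_ofPred_eq] at ha hb ⊢
            rw [map_add, map_add, ← ha, ← hb]
            rfl
          algebraMap_mem' := fun c => by
            rw [Set.mem_ofPred_eq, AlgHom.commutes, AlgHom.commutes, LinearMap.convAlgebraMap_apply]
            simp }
      refine mem_of_gens S (fun i => ?_) (fun i => ?_) (fun _ s => ?_) (fun h => h.elim) m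
      · change dualHom a κ hκ hw _ 1 = _
        rw [dualHom, lift_K, counitHom_K]
        exact charHom_one_apply _
      · change dualHom a κ hκ hw _ 1 = _
        rw [dualHom, lift_Kinv, counitHom_Kinv]
        exact charHom_one_apply _
      · change dualHom a κ hκ hw _ 1 = _
        rw [dualHom, lift_E, counitHom_E]
        exact rootFun_one a s)

variable (hd : ∀ s : Fin n, κ s.castSucc * (κ s.succ)⁻¹ = weightChar q s)

lemma selfPairing_K (i : Fin (n + 1)) (x : UqMinus k q n) :
    (selfPairing a κ hκ hw hd).form (K k q i) x = charHom q (κ i) x :=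
  congrArg (fun f : ConvDual k _ => f x) (lift_K (dualRep q a κ hκ hw) i)

lemma selfPairing_Kinv (i : Fin (n + 1)) (x : UqMinus k q n) :
    (selfPairing a κ hκ hw hd).form (Kinv k q i) x = charHom q (κ i)⁻¹ x :=
  congrArg (fun f : ConvDual k _ => f x) (lift_Kinv (dualRep q a κ hκ hw) i)

lemma selfPairing_E (s : Fin n) (x : UqMinus k q n) :
    (selfPairing a κ hκ hw hd).form (E k q trivial s) x = rootFun q a s x :=
  congrArg (fun f : ConvDual k _ => f x) (lift_E (dualRep q a κ hκ hw) trivial s)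

end Existence

/-- The character `K̂_j ↦ z⁻¹ q^{-δ_{i,j}}`. -/
def fundChar (q z : kˣ) (hz : z ^ (n + 1) = q⁻¹) (i : Fin (n + 1)) : torusChars k n :=
  ⟨fun j => z⁻¹ * (if i = j then q⁻¹ else 1), by
    change ∏ j, z⁻¹ * (if i = j then q⁻¹ else 1) = 1
    rw [Finset.prod_mul_distrib, Finset.prod_ite_eq, Finset.prod_const]
    -- The product is `z^{-(n+1)} q⁻¹ = q q⁻¹ = 1`; this is the role of the root condition on `z`.
    simp [inv_pow, hz]⟩

/-- The table `z⁻¹ q^{-δ_{i,j}}` is symmetric in `i` and `j`, so the root condition on `z` serves a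
second time: it gives `K̂_1 ⋯ K̂_N = 1` in the dual algebra. -/
lemma prod_fundChar (z : kˣ) (hz : z ^ (n + 1) = q⁻¹) : ∏ i, fundChar q z hz i = 1 := by
  ext j
  rw [Subgroup.val_finsetProd, Finset.prod_apply]
  simp only [fundChar]
  rw [Finset.prod_mul_distrib, Finset.prod_ite_eq', Finset.prod_const]
  simp [inv_pow, hz]

lemma qWeight_zpow (q : kˣ) (i : Fin (n + 1)) (s : Fin n) : q ^ qWeight i s =
    (if i = s.castSucc then q else 1) * (if i = s.succ then q⁻¹ else 1) := by
  rw [qWeight, zpow_sub]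
  split_ifs <;> simp

/-- The powers of `z` cancel in the ratio. This is the condition under which conjugation by the
functional of `K̂_i` scales the functional of `E_t` as the presentation requires. -/
lemma fundChar_weight (z : kˣ) (hz : z ^ (n + 1) = q⁻¹) (i : Fin (n + 1)) (t : Fin n) :
    ((fundChar q z hz i).1 t.castSucc)⁻¹ * (fundChar q z hz i).1 t.succ = q ^ qWeight i t := by
  rw [qWeight_zpow]
  simp only [fundChar, mul_inv, inv_inv]
  rw [mul_comm z, mul_assoc, mul_inv_cancel_left]
  split_ifs <;> simp

/-- With `z` cancelled, `K̂_s K̂_{s+1}⁻¹` pairs as the weight character, which is the one in the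
product rule of the functional of `E_s`. -/
lemma fundChar_div (z : kˣ) (hz : z ^ (n + 1) = q⁻¹) (s : Fin n) :
    fundChar q z hz s.castSucc * (fundChar q z hz s.succ)⁻¹ = weightChar q s := by
  apply Subtype.ext
  funext i
  simp only [fundChar, weightChar, Subgroup.coe_mul, Subgroup.coe_inv, Pi.mul_apply, Pi.inv_apply,
    zpow_neg, qWeight_zpow, mul_inv, inv_inv]
  rw [mul_mul_mul_comm, inv_mul_cancel, one_mul]
  simp only [eq_comm (b := i)]
  split_ifs <;> simp

theorem existsUnique_selfPairing (z : k) (hz : z ^ (n + 1) = (q : k)⁻¹) :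
    ∃! p : HopfPairing k (UqMinus k q n) (UqMinus k q n), IsSelfForm z p.form := by
  have hz0 : z ≠ 0 := fun h => by
    rw [h, zero_pow (Nat.succ_ne_zero n)] at hz
    exact inv_ne_zero q.ne_zero hz.symm
  lift z to kˣ using hz0.isUnit
  have hz' : z ^ (n + 1) = q⁻¹ := Units.ext (by push_cast; exact hz)
  -- The construction works for every scalar `a` as the value at `(E_s, E_s)`; the prescribed one is
  -- inserted here.
  refine existsUnique_of_exists_of_unique ⟨selfPairing ((q : k) - (q : k)⁻¹)⁻¹ (fundChar q z hz') (prod_fundChar z hz')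
    (fundChar_weight z hz') (fundChar_div z hz'), ?_⟩
    fun _ _ => eq_of_isSelfForm
  constructor
  all_goals intro i j
  all_goals simp only [selfPairing_K, selfPairing_Kinv, selfPairing_E, charHom_apply, char_K,
    char_Kinv, char_E, rootFun_K, rootFun_Kinv, rootFun_E]
  all_goals try simp only [fundChar, Subgroup.coe_inv, Pi.inv_apply, mul_inv, inv_inv]
  all_goals split_ifs <;> simp

end UqMinus

/-! ### Inverting the torus generators -/

lemma ofFn_prod_mul_ofFn_prod {A : Type*} [Monoid A] : ∀ (m : ℕ) (a b : Fin m → A),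
    (∀ i j, Commute (a i) (b j)) → (∀ i, a i * b i = 1) →
    (List.ofFn a).prod * (List.ofFn b).prod = 1
  | 0, a, b, _, _ => by simp
  | m + 1, a, b, hc, h => by
    have hc' : Commute (List.ofFn fun i : Fin m => a i.succ).prod (b 0) :=
      Commute.list_prod_left _ _ fun x hx => by
        obtain ⟨i, rfl⟩ := (List.mem_ofFn' _ _).1 hx
        exact hc _ _
    simp only [List.ofFn_succ, List.prod_cons]
    rw [mul_assoc, ← mul_assoc _ (b 0), hc'.eq, mul_assoc (b 0),
      ofFn_prod_mul_ofFn_prod m _ _ (fun i j => hc _ _) (fun i => h _), mul_one, h]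

section Families

variable {k : Type*} [Field k] {n : ℕ} {A : Type*} [Ring A] [Algebra k A]
  {K Kinv : Fin (n + 1) → A}

/-- Only the last clause needs an argument: the product of the inverses, multiplied by the product
of the `K i`, gives one, and the latter product is itself one. -/
lemma IsTorus.inv (hK : IsTorus K Kinv) : IsTorus Kinv K where
  comm i j := (hK.commute_inv i j).eq
  mul_inv := hK.inv_mul
  inv_mul := hK.mul_inv
  prod := by
    have h := ofFn_prod_mul_ofFn_prod (n + 1) K Kinv
      (fun i j => (hK.commute_inv_left j i).symm) hK.mul_inv
    rwa [hK.prod, one_mul] at h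

/-- Exchanging `K` and `Kinv` inverts the weights, while the Serre relation depends only on `q +
q⁻¹`. -/
lemma IsBorel.inv {q : kˣ} {X : Fin n → A} (hK : IsTorus K Kinv) (hX : IsBorel q K Kinv X) :
    IsBorel q⁻¹ Kinv K X where
  weight i t := by
    rw [hX.Kinv_mul hK, smul_mul_assoc, mul_assoc, hK.inv_mul, mul_one, inv_zpow, zpow_neg]
  comm := hX.comm
  serre s t h := by
    have := hX.serre s t h
    rw [add_comm (q : k)] at this
    simpa using this

end Families

/-! ### Functoriality of cocycle twists and of the double -/

namespace CocycleTwist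

variable {k A A' : Type*} [CommRing k] [Ring A] [Bialgebra k A] [Ring A'] [Bialgebra k A']
  {τ : TwoCocycle k A} {τ' : TwoCocycle k A'}

/-- Pulling back along a coalgebra map respects convolution, so the pullback of `τ'.inv` is a
convolution inverse of `τ.form`, and such inverses are unique. -/
lemma inv_comp_map (f : A →ₐc[k] A')
    (hf : τ'.form ∘ₗ TensorProduct.map f.toCoalgHom.toLinearMap f.toCoalgHom.toLinearMap = τ.form) :
    τ'.inv ∘ₗ TensorProduct.map f.toCoalgHom.toLinearMap f.toCoalgHom.toLinearMap = τ.inv := by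
  have h := conv_comp_mul (toConv τ'.form) (toConv τ'.inv)
    (Coalgebra.TensorProduct.map f.toCoalgHom f.toCoalgHom)
  rw [τ'.mul_inv, conv_comp_one] at h
  have h' : toConv τ.form *
      toConv (τ'.inv ∘ₗ TensorProduct.map f.toCoalgHom.toLinearMap f.toCoalgHom.toLinearMap) = 1 := by
    rw [← hf]; exact h.symm
  exact (toConv_injective (left_inv_eq_right_inv τ.inv_mul h')).symm

/-- The twisted multiplication is the convolution product `τ * m * τ⁻¹`. Applying `f` after it, or
`f ⊗ f` before its analogue for `τ'`, gives the same three factors. -/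
lemma map_mulMap (f : A →ₐc[k] A')
    (hf : τ'.form ∘ₗ TensorProduct.map f.toCoalgHom.toLinearMap f.toCoalgHom.toLinearMap = τ.form)
    (x y : A) : f (τ.mulMap (x ⊗ₜ y)) = τ'.mulMap (f x ⊗ₜ f y) := by
  let φ := Coalgebra.TensorProduct.map f.toCoalgHom f.toCoalgHom
  have h1 := comp_conj τ.form τ.inv (LinearMap.mul' k A) f.toCoalgHom.toLinearMap
  have h2 := conv_comp_mul (convScalar A' τ'.form * toConv (LinearMap.mul' k A'))
    (convScalar A' τ'.inv) φ
  rw [conv_comp_mul (convScalar A' τ'.form)] at h2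
  have e1 : toConv ((convScalar A' τ'.form).ofConv ∘ₗ φ.toLinearMap) = convScalar A' τ.form := by
    rw [← hf]; rfl
  have e2 : toConv ((convScalar A' τ'.inv).ofConv ∘ₗ φ.toLinearMap) = convScalar A' τ.inv := by
    rw [← inv_comp_map f hf]; rfl
  have e3 : toConv (LinearMap.mul' k A' ∘ₗ φ.toLinearMap) =
      toConv (f.toCoalgHom.toLinearMap ∘ₗ LinearMap.mul' k A) := by
    congr 1
    ext x y
    exact (map_mul f x y).symm
  rw [e1, e2, e3] at h2
  exact LinearMap.congr_fun (h1.trans (toConv_injective h2).symm) (x ⊗ₜ y)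

/-- Functoriality of the twisted bialgebra. -/
def mapHom (f : A →ₐc[k] A')
    (hf : τ'.form ∘ₗ TensorProduct.map f.toCoalgHom.toLinearMap f.toCoalgHom.toLinearMap = τ.form) :
    CocycleTwist τ →ₐc[k] CocycleTwist τ' where
  toCoalgHom := (f.toCoalgHom : A →ₗc[k] A')
  map_one' := map_one f
  map_mul' x y := map_mulMap f hf x y

end CocycleTwist

namespace GenDouble

variable {k B B' H : Type*} [CommRing k] [Ring B] [Ring B'] [Ring H] [HopfAlgebra k B]
  [HopfAlgebra k B'] [HopfAlgebra k H] {p : SkewPairing k B H} {p' : SkewPairing k B' H}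

/-- The cocycle is built from the counits and the skew pairing, and `f` preserves both. -/
lemma form_comp_map (f : B →ₐc[k] B') (hf : ∀ b h, p'.val (f b) h = p.val b h) :
    p'.cocycle.form ∘ₗ TensorProduct.map
      (Bialgebra.TensorProduct.map f (BialgHom.id k H)).toCoalgHom.toLinearMap
      (Bialgebra.TensorProduct.map f (BialgHom.id k H)).toCoalgHom.toLinearMap =
    p.cocycle.form := by
  ext b h b' h'
  change SkewPairing.tauForm p'.val ((f b ⊗ₜ h) ⊗ₜ (f b' ⊗ₜ h')) =
    SkewPairing.tauForm p.val ((b ⊗ₜ h) ⊗ₜ (b' ⊗ₜ h'))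
  rw [SkewPairing.tauForm_tmul, SkewPairing.tauForm_tmul, hf, CoalgHomClass.counit_comp_apply]

/-- Functoriality of the double in its first argument. -/
def mapLeft (f : B →ₐc[k] B') (hf : ∀ b h, p'.val (f b) h = p.val b h) :
    GenDouble p →ₐc[k] GenDouble p' :=
  CocycleTwist.mapHom (Bialgebra.TensorProduct.map f (BialgHom.id k H)) (form_comp_map f hf)

lemma mapLeft_tmul (f : B →ₐc[k] B') (hf : ∀ b h, p'.val (f b) h = p.val b h) (b : B) (h : H) :
    mapLeft f hf (tmul p b h) = tmul p' (f b) h := rfl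

lemma mapLeft_mapLeft (f : B →ₐc[k] B') (hf : ∀ b h, p'.val (f b) h = p.val b h)
    (g : B' →ₐc[k] B) (hg : ∀ b h, p.val (g b) h = p'.val b h) (hgf : ∀ b, g (f b) = b)
    (x : GenDouble p) : mapLeft g hg (mapLeft f hf x) = x := by
  obtain ⟨x, rfl⟩ := (CocycleTwist.of p.cocycle).surjective x
  induction x with
  | zero => simp
  | add x y hx hy => rw [map_add, map_add, map_add, hx, hy]
  | tmul b h =>
    change mapLeft g hg (mapLeft f hf (tmul p b h)) = tmul p b h
    rw [mapLeft_tmul, mapLeft_tmul, hgf]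

/-- An isomorphism compatible with the skew pairings induces an isomorphism of doubles. -/
def congrLeft (f : B ≃ₐc[k] B') (hf : ∀ b h, p'.val (f b) h = p.val b h) :
    GenDouble p ≃ₐc[k] GenDouble p' :=
  have hg : ∀ b h, p.val (f.symm b) h = p'.val b h := fun b h => by
    rw [← hf, BialgEquiv.apply_symm_apply]
  BialgEquiv.ofBialgHom (mapLeft (f : B →ₐc[k] B') hf) (mapLeft (f.symm : B' →ₐc[k] B) hg)
    (BialgHom.ext fun x => mapLeft_mapLeft _ hg _ hf f.apply_symm_apply x)
    (BialgHom.ext fun x => mapLeft_mapLeft _ hf _ hg f.symm_apply_apply x)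

lemma congrLeft_tmul (f : B ≃ₐc[k] B') (hf : ∀ b h, p'.val (f b) h = p.val b h) (b : B) (h : H) :
    congrLeft f hf (tmul p b h) = tmul p' (f b) h := rfl

end GenDouble

/-! ### Exchanging the two Borel algebras: duality (1) and the isomorphism of doubles -/

/-- Pulling a pairing back along a bialgebra homomorphism. -/
def HopfPairing.comp {k U U' V : Type*} [CommRing k] [Ring U] [Ring U'] [Ring V] [Bialgebra k U]
    [Bialgebra k U'] [Bialgebra k V] (p : HopfPairing k U V) (f : U' →ₐc[k] U) :
    HopfPairing k U' V where
  form := p.form ∘ₗ f.toCoalgHom.toLinearMap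
  mul_left m m' x := by
    change p.form (f (m * m')) x = _
    rw [map_mul, p.mul_left]
    rfl
  mul_right m x y := by
    change p.form (f m) (x * y) = _
    rw [p.mul_right, ← CoalgHomClass.map_comp_comul_apply]
    induction comul (R := k) m with
    | zero => simp
    | add X Y hX hY => simp only [map_add, hX, hY]
    | tmul a b => rfl
  one_left x := by
    change p.form (f 1) x = _
    rw [map_one, p.one_left]
  one_right m := by
    change p.form (f m) 1 = _
    rw [p.one_right, CoalgHomClass.counit_comp_apply]

namespace UqPlus

open QAlg

variable {k : Type*} [Field k] {q : kˣ} {n : ℕ}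

/-- The isomorphism of algebras `K̂_i ↦ K̂_i⁻¹`, `F_s ↦ E_s`. -/
def toMinus : UqPlus k q n →ₐ[k] UqMinus k q n := lift
  { K := Kinv k q
    Kinv := K k q
    E := fun h => h.elim
    F := fun _ => E k q trivial
    torus := (gens k q n True False).torus.inv
    borelE := fun h => h.elim
    -- The `F` family is required to satisfy the Borel relations with `q⁻¹`, and this is what the
    -- `E` family satisfies after the torus has been inverted.
    borelF := fun _ => ((gens k q n True False).borelE trivial).inv (gens k q n True False).torus
    cross := fun h => h.elim }

/-- The isomorphism of algebras `K̂_i ↦ K̂_i⁻¹`, `E_s ↦ F_s`. -/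
def ofMinus : UqMinus k q n →ₐ[k] UqPlus k q n := lift
  { K := Kinv k q
    Kinv := K k q
    E := fun _ => F k q trivial
    F := fun h => h.elim
    torus := (gens k q n False True).torus.inv
    borelE := fun _ => inv_inv q ▸
      ((gens k q n False True).borelF trivial).inv (gens k q n False True).torus
    borelF := fun h => h.elim
    cross := fun _ h => h.elim }

@[simp] lemma toMinus_K (i : Fin (n + 1)) : toMinus (K k q i) = Kinv k q i := lift_K _ _
@[simp] lemma toMinus_Kinv (i : Fin (n + 1)) : toMinus (Kinv k q i) = K k q i := lift_Kinv _ _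
@[simp] lemma toMinus_F (s : Fin n) : toMinus (F k q trivial s) = E k q trivial s := lift_F _ _ _
@[simp] lemma ofMinus_K (i : Fin (n + 1)) : ofMinus (K k q i) = Kinv k q i := lift_K _ _
@[simp] lemma ofMinus_Kinv (i : Fin (n + 1)) : ofMinus (Kinv k q i) = K k q i := lift_Kinv _ _
@[simp] lemma ofMinus_E (s : Fin n) : ofMinus (E k q trivial s) = F k q trivial s := lift_E _ _ _

lemma ofMinus_toMinus (x : UqPlus k q n) : ofMinus (toMinus x) = x := by
  have : (ofMinus (k := k) (q := q) (n := n)).comp toMinus = AlgHom.id k _ := by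
    apply algHom_ext
    · intro i; simp
    · intro i; simp
    · intro h; exact h.elim
    · intro _ s; simp
  exact DFunLike.congr_fun this x

lemma toMinus_ofMinus (x : UqMinus k q n) : toMinus (ofMinus x) = x := by
  have : (toMinus (k := k) (q := q) (n := n)).comp ofMinus = AlgHom.id k _ := by
    apply algHom_ext
    · intro i; simp
    · intro i; simp
    · intro _ s; simp
    · intro h; exact h.elim
  exact DFunLike.congr_fun this x

lemma counit_toMinus (x : UqPlus k q n) : counit (R := k) (toMinus x) = counit (R := k) x := by
  have : (counitHom k q n True False).comp toMinus = counitHom k q n False True := by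
    apply algHom_ext
    · intro i; simp
    · intro i; simp
    · intro h; exact h.elim
    · intro _ s; simp
  exact DFunLike.congr_fun this x

/-- `toMinus` reverses the comultiplication. -/
lemma comul_toMinus (x : UqPlus k q n) : comul (R := k) (toMinus x) =
    TensorProduct.comm k _ _ (TensorProduct.map toMinus.toLinearMap toMinus.toLinearMap
      (comul (R := k) x)) := by
  have : (comulHom k q n True False).comp toMinus =
      (Algebra.TensorProduct.comm k _ _).toAlgHom.comp
        ((Algebra.TensorProduct.map toMinus toMinus).comp (comulHom k q n False True)) := by
    apply algHom_ext
    · intro i; simp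
    · intro i; simp
    · intro h; exact h.elim
    · intro _ s
      -- The image of `K̂_{s+1} K̂_s⁻¹` has its factors in the opposite order to the one in
      -- `Δ(E_s)`.
      have : (Kinv k q s.succ * K k q s.castSucc : UqMinus k q n) =
        K k q s.castSucc * Kinv k q s.succ := ((gens k q n True False).torus.commute_inv_left _ _).eq
      simp [this]
  exact DFunLike.congr_fun this x

end UqPlus

namespace Cop

variable {k A B : Type*} [CommRing k] [Ring A] [Ring B] [Bialgebra k A] [Bialgebra k B]

/-- A homomorphism of algebras that reverses the comultiplication, as a map `A^cop → B`. -/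
def lift (f : A →ₐ[k] B) (h1 : ∀ x, counit (R := k) (f x) = counit (R := k) x)
    (h2 : ∀ x, comul (R := k) (f x) = TensorProduct.comm k B B
      (TensorProduct.map f.toLinearMap f.toLinearMap (comul (R := k) x))) : Cop A →ₐc[k] B :=
  BialgHom.ofAlgHom (f.comp (of k (A := A)).symm.toAlgHom)
    (AlgHom.ext h1)
    (AlgHom.ext fun x => by
      obtain ⟨x, rfl⟩ := (of k (A := A)).surjective x
      refine Eq.trans ?_ (h2 x).symm
      change Algebra.TensorProduct.map _ _ (comul (R := k) (of k x)) = _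
      rw [comul_of]
      induction comul (R := k) x with
      | zero => simp
      | add X Y hX hY => simp only [map_add, hX, hY]
      | tmul a b => rfl)

/-- A homomorphism of algebras that reverses the comultiplication, as a map `A → B^cop`. -/
def corestrict (f : A →ₐ[k] B) (h1 : ∀ x, counit (R := k) (f x) = counit (R := k) x)
    (h2 : ∀ x, comul (R := k) (f x) = TensorProduct.comm k B B
      (TensorProduct.map f.toLinearMap f.toLinearMap (comul (R := k) x))) : A →ₐc[k] Cop B :=
  BialgHom.ofAlgHom ((of k (A := B)).toAlgHom.comp f)
    (AlgHom.ext h1)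
    (AlgHom.ext fun x => by
      change _ = comul (R := k) (of k (f x))
      rw [comul_of, h2]
      change Algebra.TensorProduct.map _ _ (comul (R := k) x) = _
      induction comul (R := k) x with
      | zero => simp
      | add X Y hX hY => simp only [map_add, hX, hY]
      | tmul a b => rfl)

end Cop

namespace UqPlus

open QAlg

variable {k : Type*} [Field k] {q : kˣ} {n : ℕ}

lemma bijective_toMinus : Function.Bijective (toMinus (k := k) (q := q) (n := n)) :=
  ⟨Function.LeftInverse.injective ofMinus_toMinus,
    Function.RightInverse.surjective toMinus_ofMinus⟩

variable (k q n) in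
/-- The isomorphism `U_q(b_+)^cop ≅ U_q(b_-)`. -/
def copEquiv : Cop (UqPlus k q n) ≃ₐc[k] UqMinus k q n :=
  BialgEquiv.ofBijective (Cop.lift toMinus counit_toMinus comul_toMinus) bijective_toMinus

/-- The isomorphism `U_q(b_+) ≅ U_q(b_-)^cop`. -/
def equivCop : UqPlus k q n ≃ₐc[k] Cop (UqMinus k q n) :=
  BialgEquiv.ofBijective (Cop.corestrict toMinus counit_toMinus comul_toMinus) bijective_toMinus

lemma copEquiv_of (x : UqPlus k q n) : copEquiv k q n (Cop.of k x) = toMinus x := rfl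

lemma equivCop_apply (x : UqPlus k q n) : equivCop x = Cop.of k (toMinus x) := rfl

lemma copEquiv_symm (x : UqMinus k q n) : (copEquiv k q n).symm x = Cop.of k (ofMinus x) := by
  rw [← BialgEquiv.symm_apply_apply (copEquiv k q n) (Cop.of k (ofMinus x)), copEquiv_of,
    toMinus_ofMinus]

/-- Replacing `K̂_i` by its inverse on the left exchanges the values `z q^{δ_{i,j}}` and `z⁻¹
q^{-δ_{i,j}}`, and `F_s` takes the place of `E_s`; the two tables then coincide. -/
lemma isBorelForm_comp {z : k} {p : HopfPairing k (UqMinus k q n) (UqMinus k q n)}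
    (hp : IsSelfForm z p.form) :
    IsBorelForm z ((p.comp (copEquiv k q n : Cop (UqPlus k q n) →ₐc[k] UqMinus k q n)).form ∘ₗ
      (Cop.of k (A := UqPlus k q n)).toLinearMap) := by
  have h : ∀ x y, ((p.comp (copEquiv k q n : Cop (UqPlus k q n) →ₐc[k] UqMinus k q n)).form ∘ₗ
      (Cop.of k (A := UqPlus k q n)).toLinearMap) x y = p.form (toMinus x) y := fun _ _ => rfl
  constructor
  all_goals intro i j
  all_goals simp only [h, toMinus_K, toMinus_Kinv, toMinus_F, hp.K_K, hp.K_Kinv, hp.Kinv_K,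
    hp.Kinv_Kinv, hp.K_E, hp.Kinv_E, hp.E_K, hp.E_Kinv, hp.E_E]

lemma isSelfForm_comp {z : k} {p : SkewPairing k (UqPlus k q n) (UqMinus k q n)}
    (hp : IsBorelForm z p.val) :
    IsSelfForm z (p.comp ((copEquiv k q n).symm : UqMinus k q n →ₐc[k] Cop (UqPlus k q n))).form := by
  have h : ∀ x y, (p.comp ((copEquiv k q n).symm : UqMinus k q n →ₐc[k] Cop (UqPlus k q n))).form x y =
      p.val (ofMinus x) y := fun x y => by
    change p.form ((copEquiv k q n).symm x) y = _
    rw [copEquiv_symm]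
    rfl
  constructor
  all_goals intro i j
  all_goals simp only [h, ofMinus_K, ofMinus_Kinv, ofMinus_E, hp.K_K, hp.K_Kinv, hp.Kinv_K,
    hp.Kinv_Kinv, hp.K_E, hp.Kinv_E, hp.F_K, hp.F_Kinv, hp.F_E]

/-- Pulled back along the inverse of `copEquiv`, `p` becomes a self-pairing with the same prescribed
values as `p'`, and there is only one such. This yields both the uniqueness in (1) and the
compatibility needed to compare the doubles. -/
lemma val_eq {z : k} {p : SkewPairing k (UqPlus k q n) (UqMinus k q n)}
    {p' : HopfPairing k (UqMinus k q n) (UqMinus k q n)} (hp : IsBorelForm z p.val)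
    (hp' : IsSelfForm z p'.form) (b : UqPlus k q n) (h : UqMinus k q n) :
    p.val b h = p'.form (toMinus b) h := by
  rw [← UqMinus.eq_of_isSelfForm (isSelfForm_comp hp) hp']
  change _ = p.form ((copEquiv k q n).symm (toMinus b)) h
  rw [copEquiv_symm, ofMinus_toMinus]
  rfl

/-- Existence and uniqueness are both transported from the self-pairing along `U_q(b_+)^cop ≅
U_q(b_-)`. -/
theorem existsUnique_pairing (z : k) (hz : z ^ (n + 1) = (q : k)⁻¹) :
    ∃! p : HopfPairing k (Cop (UqPlus k q n)) (UqMinus k q n),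
      IsBorelForm z (p.form ∘ₗ (Cop.of k (A := UqPlus k q n)).toLinearMap) := by
  obtain ⟨p', hp', -⟩ := UqMinus.existsUnique_selfPairing (q := q) z hz
  refine existsUnique_of_exists_of_unique ⟨_, isBorelForm_comp hp'⟩ fun p₁ p₂ h₁ h₂ => ?_
  refine HopfPairing.ext_form ?_
  ext b h
  obtain ⟨b, rfl⟩ := (Cop.of k).surjective b
  exact (val_eq (p := p₁) h₁ hp' b h).trans (val_eq (p := p₂) h₂ hp' b h).symm

theorem exists_double_equiv {z : k} {p : SkewPairing k (UqPlus k q n) (UqMinus k q n)}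
    {p' : HopfPairing k (UqMinus k q n) (UqMinus k q n)} (hp : IsBorelForm z p.val)
    (hp' : IsSelfForm z p'.form) :
    ∃ Φ : GenDouble p ≃ₐc[k] GenDouble p'.toSkew,
      (∀ i, Φ (GenDouble.inl p (K k q i)) =
        GenDouble.inl p'.toSkew (Cop.of k (Kinv k q i))) ∧
      (∀ s, Φ (GenDouble.inl p (F k q trivial s)) =
        GenDouble.inl p'.toSkew (Cop.of k (E k q trivial s))) ∧
      (∀ h, Φ (GenDouble.inr p h) = GenDouble.inr p'.toSkew h) := by
  -- Thus `equivCop` preserves the skew pairings, and functoriality of the double in its first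
  -- argument applies.
  have hval : ∀ b h, p'.toSkew.val (equivCop b) h = p.val b h := fun b h => (val_eq hp hp' b h).symm
  have hl : ∀ b, GenDouble.congrLeft equivCop hval (GenDouble.inl p b) =
      GenDouble.inl p'.toSkew (equivCop b) := fun b => GenDouble.congrLeft_tmul _ _ b 1
  refine ⟨GenDouble.congrLeft equivCop hval, fun i => ?_, fun s => ?_, fun h => ?_⟩
  · rw [hl, equivCop_apply, toMinus_K]
  · rw [hl, equivCop_apply, toMinus_F]
  · refine (GenDouble.congrLeft_tmul equivCop hval 1 h).trans ?_
    rw [map_one]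
    rfl

end UqPlus

/-! ### Straightening products of two subalgebras -/

section Products

variable {k B H D : Type*} [CommRing k] [Ring B] [Ring H] [Ring D] [Algebra k B] [Algebra k H]
  [Algebra k D] (a : B →ₐ[k] D) (c : H →ₐ[k] D)

/-- The linear map `b ⊗ h ↦ a(b) c(h)`. -/
def mulTensor : B ⊗[k] H →ₗ[k] D :=
  LinearMap.mul' k D ∘ₗ TensorProduct.map a.toLinearMap c.toLinearMap

@[simp] lemma mulTensor_tmul (b : B) (h : H) : mulTensor a c (b ⊗ₜ h) = a b * c h := rfl

lemma mul_mem_range_mulTensor (b : B) {d : D} (hd : d ∈ LinearMap.range (mulTensor a c)) :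
    a b * d ∈ LinearMap.range (mulTensor a c) := by
  obtain ⟨t, rfl⟩ := hd
  induction t with
  | zero => simp
  | add x y hx hy => rw [map_add, mul_add]; exact add_mem hx hy
  | tmul b' h => exact ⟨(b * b') ⊗ₜ h, by simp [mul_assoc]⟩

lemma range_mulTensor_mul_mem (h : H) {d : D} (hd : d ∈ LinearMap.range (mulTensor a c)) :
    d * c h ∈ LinearMap.range (mulTensor a c) := by
  obtain ⟨t, rfl⟩ := hd
  induction t with
  | zero => simp
  | add x y hx hy => rw [map_add, add_mul]; exact add_mem hx hy
  | tmul b' h' => exact ⟨b' ⊗ₜ (h' * h), by simp [mul_assoc]⟩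

/-- The elements `b` that can be moved to the left of the image of `H`. -/
def straightening : Subalgebra k B where
  carrier := {b | ∀ h, c h * a b ∈ LinearMap.range (mulTensor a c)}
  mul_mem' {b b'} hb hb' h := by
    rw [map_mul, ← mul_assoc]
    obtain ⟨t, ht⟩ := hb h
    rw [← ht]
    clear ht
    -- After `b` has been moved to the left, arbitrary elements `h₀` stand in front of `b'`; for
    -- this reason membership is required for all `h` at once.
    induction t with
    | zero => simp
    | add x y hx hy => rw [map_add, add_mul]; exact add_mem hx hy
    | tmul b₀ h₀ =>
      rw [mulTensor_tmul, mul_assoc]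
      exact mul_mem_range_mulTensor a c _ (hb' h₀)
  add_mem' {b b'} hb hb' h := by
    rw [map_add, mul_add]
    exact add_mem (hb h) (hb' h)
  algebraMap_mem' r h := ⟨algebraMap k B r ⊗ₜ h, by
    rw [mulTensor_tmul, AlgHom.commutes, Algebra.commutes]⟩

/-- In `a(b) c(h) a(b') c(h')` only the middle product is out of order, and the span of the products
`a(b) c(h)` absorbs `a` on the left and `c` on the right. -/
lemma mul_mem_range_mulTensor_of_straightening (hs : ∀ b, b ∈ straightening a c) (s t : B ⊗[k] H) :
    mulTensor a c s * mulTensor a c t ∈ LinearMap.range (mulTensor a c) := by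
  induction s with
  | zero => simp
  | add x y hx hy => rw [map_add, add_mul]; exact add_mem hx hy
  | tmul b h =>
    induction t with
    | zero => simp
    | add x y hx hy => rw [map_add, mul_add]; exact add_mem hx hy
    | tmul b' h' =>
      have : a b * c h * (a b' * c h') = a b * (c h * a b') * c h' := by simp only [mul_assoc]
      rw [mulTensor_tmul, mulTensor_tmul, this]
      exact range_mulTensor_mul_mem a c _ (mul_mem_range_mulTensor a c _ (hs b' h))

/-- The elements of `H` that can be moved past `x`. -/
def normalizing (x : D) : Subalgebra k H where
  carrier := {h | ∃ h', c h * x = x * c h'}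
  mul_mem' := by
    rintro g h ⟨g', hg⟩ ⟨h', hh⟩
    exact ⟨g' * h', by rw [map_mul, mul_assoc, hh, ← mul_assoc, hg, mul_assoc, map_mul]⟩
  add_mem' := by
    rintro g h ⟨g', hg⟩ ⟨h', hh⟩
    exact ⟨g' + h', by rw [map_add, add_mul, hh, hg, map_add, mul_add]⟩
  algebraMap_mem' r := ⟨algebraMap k H r, by rw [AlgHom.commutes, Algebra.commutes]⟩

/-- The elements of `H` that can be moved past `y` up to terms in `x c(H)` and `c(H)`. -/
def normalizingMod (x y : D) (hx : ∀ h, h ∈ normalizing c x) : Subalgebra k H where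
  carrier := {h | ∃ h₁ h₂ h₃, c h * y = y * c h₁ + x * c h₂ + c h₃}
  mul_mem' := by
    rintro g h ⟨g₁, g₂, g₃, hg⟩ ⟨h₁, h₂, h₃, hh⟩
    obtain ⟨g', hg'⟩ := hx g
    -- The witnesses come from moving `g` through `y h₁ + x h₂ + h₃`. Moving it past `x` turns it
    -- into `g'`, which is why `x` is required to be normalized.
    refine ⟨g₁ * h₁, g₂ * h₁ + g' * h₂, g₃ * h₁ + g * h₃, ?_⟩
    rw [map_mul, mul_assoc, hh, mul_add, mul_add, ← mul_assoc, hg, ← mul_assoc, hg']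
    simp only [map_add, map_mul, add_mul, mul_add, mul_assoc]
    abel
  add_mem' := by
    rintro g h ⟨g₁, g₂, g₃, hg⟩ ⟨h₁, h₂, h₃, hh⟩
    refine ⟨g₁ + h₁, g₂ + h₂, g₃ + h₃, ?_⟩
    simp only [map_add, add_mul, mul_add, hg, hh]
    abel
  algebraMap_mem' r := ⟨algebraMap k H r, 0, 0, by
    rw [AlgHom.commutes, Algebra.commutes]; simp⟩

end Products

/-! ### Commutation relations in the double, and homomorphisms out of it -/

namespace GenDouble

variable {k B H : Type*} [CommRing k] [Ring B] [Ring H] [HopfAlgebra k B] [HopfAlgebra k H]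
  (p : SkewPairing k B H)

/-- The relation `℘(b₂,h₂) (1 ⊗ h₁)(b₁ ⊗ 1) = ℘(b₁,h₁) b₂ ⊗ h₂` in the double. -/
lemma sum_inr_mul_inl {ι κ : Type*} {h : H} {b : B} (R : Coalgebra.Repr k h ι)
    (S : Coalgebra.Repr k b κ) :
    ∑ i ∈ R.index, ∑ j ∈ S.index, p.val (S.right j) (R.right i) •
        (inr p (R.left i) * inl p (S.left j)) =
      ∑ i ∈ R.index, ∑ j ∈ S.index, p.val (S.left j) (R.left i) •
        (inl p (S.right j) * inr p (R.right i)) := by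
  let φ := Coalgebra.TensorProduct.map (TwoCocycle.oneTmul k B H) (TwoCocycle.tmulOne k B H)
  let τ := p.cocycle
  have h1 := conv_comp_mul (convScalar (B ⊗[k] H) τ.form * toConv (LinearMap.mul' k (B ⊗[k] H)))
    (convScalar (B ⊗[k] H) τ.inv) φ
  have h2 := conv_comp_mul (convScalar (B ⊗[k] H) τ.inv) (convScalar (B ⊗[k] H) τ.form) φ
  rw [τ.scalar_inv_mul, conv_comp_one] at h2
  rw [conv_comp_mul (convScalar (B ⊗[k] H) τ.form)] at h1
  -- Convolving `τ * m * τ⁻¹` with `τ` on the right removes the inverse, and leaves a relation that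
  -- involves only the pairing itself.
  have h3 := congrArg (· * toConv ((convScalar (B ⊗[k] H) τ.form).ofConv ∘ₗ φ.toLinearMap)) h1
  simp only [mul_assoc] at h3
  rw [← h2, mul_one] at h3
  have hφ : ∀ h b, φ (h ⊗ₜ b) = (1 ⊗ₜ h) ⊗ₜ (b ⊗ₜ 1) := fun _ _ => rfl
  have hform : ∀ h b, τ.form (φ (h ⊗ₜ b)) = p.val b h := fun h b => by
    rw [hφ]
    change SkewPairing.tauForm p.val _ = _
    rw [SkewPairing.tauForm_tmul]
    simp
  have h4 := congrArg (fun f : WithConv (H ⊗[k] B →ₗ[k] B ⊗[k] H) => f (h ⊗ₜ b)) h3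
  simp only [LinearMap.convMul_apply, TensorProduct.comul_tmul, ← R.eq, ← S.eq,
    TensorProduct.sum_tmul, TensorProduct.tmul_sum, map_sum,
    TensorProduct.AlgebraTensorModule.tensorTensorTensorComm_tmul, TensorProduct.map_tmul,
    LinearMap.mul'_apply] at h4
  have e1 : ∀ h b, ((convScalar (B ⊗[k] H) τ.form).ofConv ∘ₗ φ.toLinearMap) (h ⊗ₜ b) =
      algebraMap k _ (p.val b h) := fun h b => congrArg (algebraMap k (B ⊗[k] H)) (hform h b)
  have e2 : ∀ h b, ((convScalar (B ⊗[k] H) τ.form * (toConv (LinearMap.mul' k (B ⊗[k] H)) *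
      convScalar (B ⊗[k] H) τ.inv)).ofConv ∘ₗ φ.toLinearMap) (h ⊗ₜ b) =
        (CocycleTwist.of τ).symm (inr p h * inl p b) := fun h b => by
    rw [← mul_assoc]; rfl
  have e3 : ∀ h b, (LinearMap.mul' k (B ⊗[k] H) ∘ₗ φ.toLinearMap) (h ⊗ₜ b) = b ⊗ₜ h :=
    fun h b => by
      change ((1 : B) ⊗ₜ[k] h) * (b ⊗ₜ[k] (1 : H)) = _
      rw [Algebra.TensorProduct.tmul_mul_tmul, one_mul, mul_one]
  simp only [e1, e2, e3, ← Algebra.commutes, ← Algebra.smul_def] at h4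
  have h5 := congrArg (CocycleTwist.of τ) h4
  simp only [map_sum, map_smul, LinearEquiv.apply_symm_apply] at h5
  rw [Finset.sum_comm, h5, Finset.sum_comm]
  simp only [inl_mul_inr]
  rfl

section Relations

variable {g e : H} {b y l : B}

/-- The factor `℘(b, g)` stays on both sides because it need not be cancellable over a commutative
ring; it is removed later, where it is a nonzero element of a field. -/
lemma inr_mul_inl_of_groupLike (hg : comul (R := k) g = g ⊗ₜ g) (hb : comul (R := k) b = b ⊗ₜ b) :
    p.val b g • (inr p g * inl p b) = p.val b g • (inl p b * inr p g) := by
  simpa using sum_inr_mul_inl p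
    (⟨Finset.univ, fun _ => g, fun _ => g, by simp [hg]⟩ : Coalgebra.Repr k g Unit)
    (⟨Finset.univ, fun _ => b, fun _ => b, by simp [hb]⟩ : Coalgebra.Repr k b Unit)

/-- The terms with coefficient `℘(b, e)` drop out, one on each side of `sum_inr_mul_inl`. -/
lemma inr_mul_inl_of_groupLike_right (he : comul (R := k) e = 1 ⊗ₜ e + e ⊗ₜ g)
    (hb : comul (R := k) b = b ⊗ₜ b) (hb' : counit (R := k) b = 1) (hbe : p.val b e = 0) :
    p.val b g • (inr p e * inl p b) = inl p b * inr p e := by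
  have h := sum_inr_mul_inl p
    (⟨Finset.univ, ![1, e], ![e, g], by simp [he]⟩ : Coalgebra.Repr k e (Fin 2))
    (⟨Finset.univ, fun _ => b, fun _ => b, by simp [hb]⟩ : Coalgebra.Repr k b Unit)
  simpa [hbe, p.val_one_right, hb'] using h

/-- The terms with coefficient `℘(y, g)` drop out, one on each side of `sum_inr_mul_inl`. -/
lemma inr_mul_inl_of_groupLike_left (hg : comul (R := k) g = g ⊗ₜ g)
    (hg' : counit (R := k) g = 1) (hy : comul (R := k) y = y ⊗ₜ 1 + l ⊗ₜ y)
    (hyg : p.val y g = 0) :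
    inr p g * inl p y = p.val l g • (inl p y * inr p g) := by
  have h := sum_inr_mul_inl p
    (⟨Finset.univ, fun _ => g, fun _ => g, by simp [hg]⟩ : Coalgebra.Repr k g Unit)
    (⟨Finset.univ, ![y, l], ![1, y], by simp [hy]⟩ : Coalgebra.Repr k y (Fin 2))
  simpa [hyg, p.val_one_left, hg'] using h

/-- Of the four terms on each side two survive. Rearranged, `ey - ye = ℘(y, e)(g - l)`, which for `e
= E_t` and `y = F_s` is the shape of the cross relation of `U_q^ext(sl_N)`. -/
lemma inr_mul_inl_of_skewPrimitive (he : comul (R := k) e = 1 ⊗ₜ e + e ⊗ₜ g)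
    (he' : counit (R := k) e = 0) (hg' : counit (R := k) g = 1)
    (hy : comul (R := k) y = y ⊗ₜ 1 + l ⊗ₜ y) (hy' : counit (R := k) y = 0)
    (hl' : counit (R := k) l = 1) (hyg : p.val y g = 0) (hle : p.val l e = 0) :
    p.val y e • inl p l + inr p e * inl p y = inl p y * inr p e + p.val y e • inr p g := by
  have h := sum_inr_mul_inl p
    (⟨Finset.univ, ![1, e], ![e, g], by simp [he]⟩ : Coalgebra.Repr k e (Fin 2))
    (⟨Finset.univ, ![y, l], ![1, y], by simp [hy]⟩ : Coalgebra.Repr k y (Fin 2))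
  simpa [hyg, hle, p.val_one_left, p.val_one_right, he', hg', hy', hl'] using h

end Relations

variable {p} {D : Type*} [Ring D] [Bialgebra k D] (α : B →ₐc[k] D) (β : H →ₐc[k] D)

/-- The coalgebra map `b ⊗ h ↦ α(b) β(h)`. -/
def mulCoalgHom : B ⊗[k] H →ₗc[k] D :=
  (Bialgebra.mulCoalgHom k D).comp (Coalgebra.TensorProduct.map α.toCoalgHom β.toCoalgHom)

/-- Two bialgebra homomorphisms extend to the double if their images satisfy the straightening
relations of the double. -/
def lift (hs : ∀ b, b ∈ straightening ((inl p).prod (α : B →ₐ[k] D))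
    ((inr p).prod (β : H →ₐ[k] D))) : GenDouble p →ₐc[k] D where
  toCoalgHom := (mulCoalgHom α β : B ⊗[k] H →ₗc[k] D)
  map_one' := by
    change α 1 * β 1 = 1
    rw [map_one, map_one, mul_one]
  map_mul' x y := by
    obtain ⟨s, rfl⟩ := (CocycleTwist.of p.cocycle).surjective x
    obtain ⟨t, rfl⟩ := (CocycleTwist.of p.cocycle).surjective y
    -- The range of `μ` is the graph of `b ⊗ h ↦ α(b) β(h)` over the double. If `μ u = μ s * μ t`,
    -- the first component identifies `u` with the product in the double, and the second is then
    -- multiplicativity.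
    let μ := mulTensor ((inl p).prod (α : B →ₐ[k] D)) ((inr p).prod (β : H →ₐ[k] D))
    have hμ : ∀ s, μ s = (CocycleTwist.of p.cocycle s, mulCoalgHom α β s) := fun s => by
      induction s with
      | zero => simp only [map_zero, Prod.mk_zero_zero]
      | add x y hx hy => simp only [map_add, hx, hy, Prod.mk_add_mk]
      | tmul b h => exact Prod.ext (inl_mul_inr p b h) rfl
    obtain ⟨u, hu⟩ := mul_mem_range_mulTensor_of_straightening _ _ hs s t
    change μ u = μ s * μ t at hu
    rw [hμ, hμ, hμ, Prod.mk_mul_mk, Prod.mk.injEq] at hu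
    rw [← hu.1]
    exact hu.2

lemma lift_inl (hs : ∀ b, b ∈ straightening ((inl p).prod (α : B →ₐ[k] D))
    ((inr p).prod (β : H →ₐ[k] D))) (b : B) : lift α β hs (inl p b) = α b := by
  change α b * β 1 = α b
  rw [map_one, mul_one]

lemma lift_inr (hs : ∀ b, b ∈ straightening ((inl p).prod (α : B →ₐ[k] D))
    ((inr p).prod (β : H →ₐ[k] D))) (h : H) : lift α β hs (inr p h) = β h := by
  change α 1 * β h = β h
  rw [map_one, one_mul]

end GenDouble

/-! ### The inclusions of the Borel algebras -/

namespace QAlg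

variable {k : Type*} [Field k] {q : kˣ} {n : ℕ}

/-- The homomorphism between two of the algebras that is the identity on generators. -/
def incl {e f e' f' : Prop} (he : e → e') (hf : f → f') : QAlg k q n e f →ₐ[k] QAlg k q n e' f' :=
  lift
    { K := K k q
      Kinv := Kinv k q
      E := fun h => E k q (he h)
      F := fun h => F k q (hf h)
      torus := (gens k q n e' f').torus
      borelE := fun h => (gens k q n e' f').borelE (he h)
      borelF := fun h => (gens k q n e' f').borelF (hf h)
      cross := fun h h' => (gens k q n e' f').cross (he h) (hf h') }

section

variable {e f e' f' : Prop} (he : e → e') (hf : f → f')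

@[simp] lemma incl_K (i : Fin (n + 1)) : incl he hf (K k q i) = K k q i := lift_K _ _
@[simp] lemma incl_Kinv (i : Fin (n + 1)) : incl he hf (Kinv k q i) = Kinv k q i := lift_Kinv _ _
@[simp] lemma incl_E (h : e) (s : Fin n) : incl he hf (E k q h s) = E k q (he h) s := lift_E _ _ _
@[simp] lemma incl_F (h : f) (s : Fin n) : incl he hf (F k q h s) = F k q (hf h) s := lift_F _ _ _

/-- `incl` as a homomorphism of bialgebras. -/
def inclHom : QAlg k q n e f →ₐc[k] QAlg k q n e' f' :=
  BialgHom.ofAlgHom (incl he hf)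
    (by
      change (counitHom k q n e' f').comp _ = counitHom k q n e f
      apply algHom_ext <;> intros <;> simp)
    (by
      change _ = (comulHom k q n e' f').comp _
      change (Algebra.TensorProduct.map _ _).comp (comulHom k q n e f) = _
      apply algHom_ext <;> intros <;> simp)

end

end QAlg

/-! ### The homomorphism from the double onto `U_q^ext(sl_N)` -/

namespace UqExt

open QAlg

variable {k : Type*} [Field k] {q : kˣ} {n : ℕ}

lemma val_qWeight (q : kˣ) (i : Fin (n + 1)) (s : Fin n) : ((q ^ qWeight i s : kˣ) : k) =
    (if i = s.castSucc then (q : k) else 1) * (if i = s.succ then (q : k)⁻¹ else 1) := by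
  rw [UqMinus.qWeight_zpow]
  split_ifs <;> simp

lemma val_neg_qWeight (q : kˣ) (i : Fin (n + 1)) (s : Fin n) : ((q ^ (-qWeight i s) : kˣ) : k) =
    (if i = s.castSucc then (q : k)⁻¹ else 1) * (if i = s.succ then (q : k) else 1) := by
  rw [zpow_neg, UqMinus.qWeight_zpow]
  split_ifs <;> simp

variable {z : k} {p : SkewPairing k (UqPlus k q n) (UqMinus k q n)}

section Values

lemma val_groupLike_Kd {b : UqPlus k q n} (hb : comul (R := k) b = b ⊗ₜ b) (t : Fin n) :
    p.val b (UqMinus.Kd k q t) = p.val b (Kinv k q t.succ) * p.val b (K k q t.castSucc) := by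
  rw [UqMinus.Kd, p.val_mul_right, hb]
  simp

/-- The factors `z` and `z⁻¹` cancel and leave the weight of `E_t` under `K̂_i`. Hence the
commutation coefficient in the double is the one in `U_q^ext(sl_N)`. -/
lemma val_K_Kd (hz : z ≠ 0) (hp : IsBorelForm z p.val) (i : Fin (n + 1)) (t : Fin n) :
    p.val (K k q i) (UqMinus.Kd k q t) = ((q ^ qWeight i t : kˣ) : k) := by
  rw [val_groupLike_Kd (comulHom_K i), hp.K_Kinv, hp.K_K, val_qWeight, mul_mul_mul_comm,
    inv_mul_cancel₀ hz, one_mul, mul_comm]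

lemma val_Kinv_Kd (hz : z ≠ 0) (hp : IsBorelForm z p.val) (i : Fin (n + 1)) (t : Fin n) :
    p.val (Kinv k q i) (UqMinus.Kd k q t) = ((q ^ (-qWeight i t) : kˣ) : k) := by
  rw [val_groupLike_Kd (comulHom_Kinv i), hp.Kinv_Kinv, hp.Kinv_K, val_neg_qWeight,
    mul_mul_mul_comm, mul_inv_cancel₀ hz, one_mul, mul_comm]

variable (k q) in
/-- The group-like element `K̂_{s+1} K̂_s⁻¹` of `U_q(b_+)`. -/
def Ld (s : Fin n) : UqPlus k q n := K k q s.succ * Kinv k q s.castSucc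

lemma val_Ld_groupLike {g : UqMinus k q n} (hg : comul (R := k) g = g ⊗ₜ g) (s : Fin n) :
    p.val (Ld k q s) g = p.val (K k q s.succ) g * p.val (Kinv k q s.castSucc) g := by
  rw [Ld, p.val_mul_left, hg]
  simp

/-- This is the weight of `F_s` under `K̂_j`, so that `inr_mul_inl_of_groupLike_left` reproduces the
relation between `K̂_j` and `F_s`. -/
lemma val_Ld_K (hz : z ≠ 0) (hp : IsBorelForm z p.val) (s : Fin n) (j : Fin (n + 1)) :
    p.val (Ld k q s) (K k q j) = ((q ^ (-qWeight j s) : kˣ) : k) := by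
  rw [val_Ld_groupLike (comulHom_K j), hp.K_K, hp.Kinv_K, val_neg_qWeight, mul_mul_mul_comm,
    mul_inv_cancel₀ hz, one_mul, mul_comm]
  simp only [eq_comm (b := j)]

lemma val_Ld_Kinv (hz : z ≠ 0) (hp : IsBorelForm z p.val) (s : Fin n) (j : Fin (n + 1)) :
    p.val (Ld k q s) (Kinv k q j) = ((q ^ qWeight j s : kˣ) : k) := by
  rw [val_Ld_groupLike (comulHom_Kinv j), hp.K_Kinv, hp.Kinv_Kinv, val_qWeight, mul_mul_mul_comm,
    inv_mul_cancel₀ hz, one_mul, mul_comm]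
  simp only [eq_comm (b := j)]

lemma val_Ld_E (hp : IsBorelForm z p.val) (s t : Fin n) :
    p.val (Ld k q s) (E k q trivial t) = 0 := by
  rw [Ld, p.val_mul_left, comul_eq, comulHom_E]
  simp [hp.K_E, hp.Kinv_E]

lemma val_F_Kd (hp : IsBorelForm z p.val) (s t : Fin n) :
    p.val (F k q trivial s) (UqMinus.Kd k q t) = 0 := by
  rw [UqMinus.Kd, p.val_mul_right, comul_eq, comulHom_F]
  simp [hp.F_K, hp.F_Kinv]

end Values

/-- The inclusions of `U_q(b_+)` into the double and into `U_q^ext(sl_N)`. -/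
def plusPair (p : SkewPairing k (UqPlus k q n) (UqMinus k q n)) :
    UqPlus k q n →ₐ[k] GenDouble p × UqExt k q n :=
  (GenDouble.inl p).prod (inclHom False.elim id : UqPlus k q n →ₐc[k] UqExt k q n)

/-- The inclusions of `U_q(b_-)` into the double and into `U_q^ext(sl_N)`. -/
def minusPair (p : SkewPairing k (UqPlus k q n) (UqMinus k q n)) :
    UqMinus k q n →ₐ[k] GenDouble p × UqExt k q n :=
  (GenDouble.inr p).prod (inclHom id False.elim : UqMinus k q n →ₐc[k] UqExt k q n)

lemma plusPair_apply (b : UqPlus k q n) :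
    plusPair p b = (GenDouble.inl p b, incl False.elim id b) := rfl

lemma minusPair_apply (h : UqMinus k q n) :
    minusPair p h = (GenDouble.inr p h, incl id False.elim h) := rfl

/-- A group-like element of `U_q(b_+)` normalizes `U_q(b_-)` if it does so on generators. -/
lemma mem_normalizing {b : UqPlus k q n} (hb : comul (R := k) b = b ⊗ₜ b)
    (hb' : counit (R := k) b = 1) (hK : ∀ j, p.val b (K k q j) ≠ 0)
    (hKinv : ∀ j, p.val b (Kinv k q j) ≠ 0) (hE : ∀ t, p.val b (E k q trivial t) = 0)
    (eK : ∀ j, K k q j * incl False.elim id b = incl False.elim id b * (K k q j : UqExt k q n))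
    (eKinv : ∀ j, Kinv k q j * incl False.elim id b =
      incl False.elim id b * (Kinv k q j : UqExt k q n))
    (eE : ∀ t, p.val b (UqMinus.Kd k q t) • (E k q trivial t * incl False.elim id b) =
      incl False.elim id b * (E k q trivial t : UqExt k q n))
    (h : UqMinus k q n) : h ∈ normalizing (minusPair p) (plusPair p b) := by
  refine mem_of_gens (normalizing (minusPair p) (plusPair p b)) (fun j => ⟨K k q j, ?_⟩)
    (fun j => ⟨Kinv k q j, ?_⟩)
    -- In the double `℘(b, Kd t) E_t b = b E_t`, so the scalar has to be inverted; it is nonzero as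
    -- a product of two values assumed nonzero.
    (fun _ t => ⟨(p.val b (UqMinus.Kd k q t))⁻¹ • E k q trivial t, ?_⟩) (fun h => h.elim) h
  · simp only [plusPair_apply, minusPair_apply, Prod.mk_mul_mk, incl_K, eK]
    rw [smul_right_injective _ (hK j)
      (GenDouble.inr_mul_inl_of_groupLike p (comulHom_K j) hb)]
  · simp only [plusPair_apply, minusPair_apply, Prod.mk_mul_mk, incl_Kinv, eKinv]
    rw [smul_right_injective _ (hKinv j)
      (GenDouble.inr_mul_inl_of_groupLike p (comulHom_Kinv j) hb)]
  · have hne : p.val b (UqMinus.Kd k q t) ≠ 0 := by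
      rw [val_groupLike_Kd hb]
      exact mul_ne_zero (hKinv _) (hK _)
    rw [map_smul, mul_smul_comm, eq_inv_smul_iff₀ hne]
    simp only [plusPair_apply, minusPair_apply, Prod.mk_mul_mk, incl_E, Prod.smul_mk, eE]
    rw [← GenDouble.inr_mul_inl_of_groupLike_right p (comulHom_E trivial t) hb hb' (hE t)]
    rfl

/-- The weight relation holds in both components with the same scalar, by `val_K_Kd`; one and the
same witness therefore serves the double and `U_q^ext(sl_N)`. -/
lemma K_mem_normalizing (hz : z ≠ 0) (hp : IsBorelForm z p.val) (i : Fin (n + 1))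
    (h : UqMinus k q n) : h ∈ normalizing (minusPair p) (plusPair p (K k q i)) := by
  have ht := (gens k q n True True).torus
  refine mem_normalizing (comulHom_K i) (counitHom_K i) (fun j => ?_) (fun j => ?_) (hp.K_E i)
    (fun j => ?_) (fun j => ?_) (fun t => ?_) h
  · rw [hp.K_K]; split_ifs <;> simp [hz]
  · rw [hp.K_Kinv]; split_ifs <;> simp [hz]
  · rw [incl_K]; exact ht.comm j i
  · rw [incl_K]; exact (ht.commute_inv_left j i).eq
  · rw [incl_K, val_K_Kd hz hp]
    exact (((gens k q n True True).borelE trivial).K_mul ht i t).symm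

lemma Kinv_mem_normalizing (hz : z ≠ 0) (hp : IsBorelForm z p.val) (i : Fin (n + 1))
    (h : UqMinus k q n) : h ∈ normalizing (minusPair p) (plusPair p (Kinv k q i)) := by
  have ht := (gens k q n True True).torus
  refine mem_normalizing (comulHom_Kinv i) (counitHom_Kinv i) (fun j => ?_) (fun j => ?_)
    (hp.Kinv_E i) (fun j => ?_) (fun j => ?_) (fun t => ?_) h
  · rw [hp.Kinv_K]; split_ifs <;> simp [hz]
  · rw [hp.Kinv_Kinv]; split_ifs <;> simp [hz]
  · rw [incl_Kinv]; exact (ht.commute_inv_left i j).eq.symm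
  · rw [incl_Kinv]; exact (ht.commute_inv j i).eq
  · rw [incl_Kinv, val_Kinv_Kd hz hp]
    exact (((gens k q n True True).borelE trivial).Kinv_mul ht i t).symm

lemma Ld_mem_normalizing (hz : z ≠ 0) (hp : IsBorelForm z p.val) (s : Fin n)
    (h : UqMinus k q n) : h ∈ normalizing (minusPair p) (plusPair p (Ld k q s)) := by
  obtain ⟨h', e⟩ := K_mem_normalizing hz hp s.succ h
  obtain ⟨h'', e'⟩ := Kinv_mem_normalizing hz hp s.castSucc h'
  exact ⟨h'', by rw [Ld, map_mul, ← mul_assoc, e, mul_assoc, e', mul_assoc]⟩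

/-- This puts the cross relation in the form of `inr_mul_inl_of_skewPrimitive`, with scalar `℘(F_s,
E_t)`. The two torus elements carry different indices, which is harmless since the scalar vanishes
for `s ≠ t`. -/
lemma E_mul_F (s t : Fin n) : (E k q trivial t * F k q trivial s : UqExt k q n) =
    F k q trivial s * E k q trivial t + (((q : k) - (q : k)⁻¹)⁻¹ * (if s = t then 1 else 0)) •
      (K k q t.castSucc * Kinv k q t.succ - K k q s.succ * Kinv k q s.castSucc) := by
  have h := (gens k q n True True).cross_eq trivial trivial t s
  rw [← sub_eq_iff_eq_add']
  refine h.trans ?_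
  simp only [eq_comm (a := t)]
  split_ifs with hst
  · subst hst
    rw [mul_one, ld, ((gens k q n True True).torus.commute_inv_left _ _).eq]
    rfl
  · simp

/-- Moving `E_t` past `F_s` leaves one term in `K̂_{s+1} K̂_s⁻¹`, which lies in `U_q(b_+)` and
normalizes `U_q(b_-)`, and one term inside `U_q(b_-)`; these are the two corrections that
`normalizingMod` allows. -/
lemma F_mem_normalizingMod (hz : z ≠ 0) (hp : IsBorelForm z p.val) (s : Fin n)
    (h : UqMinus k q n) : h ∈ normalizingMod (minusPair p) (plusPair p (Ld k q s))
      (plusPair p (F k q trivial s)) (Ld_mem_normalizing hz hp s) := by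
  have ht := (gens k q n True True).torus
  have hF := (gens k q n True True).borelF trivial
  have hL : counit (R := k) (Ld k q s) = 1 := by
    rw [counit_eq, Ld, map_mul, counitHom_K, counitHom_Kinv, mul_one]
  have hKd : ∀ t : Fin n, counit (R := k) (UqMinus.Kd k q t) = 1 := fun t => by
    rw [counit_eq, UqMinus.Kd, map_mul, counitHom_K, counitHom_Kinv, mul_one]
  refine mem_of_gens (normalizingMod (minusPair p) (plusPair p (Ld k q s))
      (plusPair p (F k q trivial s)) (Ld_mem_normalizing hz hp s))
    (fun j => ⟨((q ^ (-qWeight j s) : kˣ) : k) • K k q j, 0, 0, ?_⟩)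
    (fun j => ⟨((q ^ qWeight j s : kˣ) : k) • Kinv k q j, 0, 0, ?_⟩)
    -- The witnesses are read off from `E_t F_s = F_s E_t - ℘(F_s, E_t) Ld s + ℘(F_s, E_t) Kd t`.
    (fun _ t => ⟨E k q trivial t, (-p.val (F k q trivial s) (E k q trivial t)) • 1,
      p.val (F k q trivial s) (E k q trivial t) • UqMinus.Kd k q t, ?_⟩) (fun h => h.elim) h
  · rw [map_zero, mul_zero, add_zero, add_zero, map_smul, mul_smul_comm]
    refine Prod.ext ?_ ?_
    · refine (GenDouble.inr_mul_inl_of_groupLike_left p (comulHom_K j) (counitHom_K j)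
        (comulHom_F trivial s) (hp.F_K s j)).trans ?_
      rw [← Ld, val_Ld_K hz hp]
      rfl
    · simp only [plusPair_apply, minusPair_apply, Prod.mk_mul_mk, Prod.smul_mk, incl_K, incl_F]
      have := hF.K_mul ht j s
      rw [inv_zpow, ← zpow_neg] at this
      exact this
  · rw [map_zero, mul_zero, add_zero, add_zero, map_smul, mul_smul_comm]
    refine Prod.ext ?_ ?_
    · refine (GenDouble.inr_mul_inl_of_groupLike_left p (comulHom_Kinv j) (counitHom_Kinv j)
        (comulHom_F trivial s) (hp.F_Kinv s j)).trans ?_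
      rw [← Ld, val_Ld_Kinv hz hp]
      rfl
    · simp only [plusPair_apply, minusPair_apply, Prod.mk_mul_mk, Prod.smul_mk, incl_Kinv, incl_F]
      have := hF.Kinv_mul ht j s
      rw [inv_zpow, zpow_neg, inv_inv] at this
      exact this
  · rw [map_smul, map_smul, map_one, mul_smul_comm, mul_one, neg_smul]
    refine Prod.ext ?_ ?_
    · have h := GenDouble.inr_mul_inl_of_skewPrimitive p (comulHom_E trivial t)
        (counitHom_E trivial t) (hKd t) (comulHom_F trivial s) (counitHom_F trivial s) hL
        (val_F_Kd hp s t) (val_Ld_E hp s t)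
      rw [← eq_sub_iff_add_eq'] at h
      refine h.trans ?_
      change _ = GenDouble.inl p _ * GenDouble.inr p _ + -(_ • GenDouble.inl p _) +
        _ • GenDouble.inr p _
      rw [sub_eq_add_neg, add_right_comm]
      rfl
    · simp only [plusPair_apply, minusPair_apply, Prod.mk_mul_mk, Prod.smul_mk, Prod.neg_mk,
        Prod.mk_add_mk, incl_E, incl_F, Ld, UqMinus.Kd, map_mul, incl_K, incl_Kinv, hp.F_E]
      rw [E_mul_F, smul_sub]
      abel

/-- Elements that can be straightened form a subalgebra, so only `K̂_i^{±1}` and `F_s` matter; for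
these the normalizing lemmas express `c(h) a(b)` explicitly as the image of a tensor. -/
lemma mem_straightening (hz : z ≠ 0) (hp : IsBorelForm z p.val) (b : UqPlus k q n) :
    b ∈ straightening (plusPair p) (minusPair p) := by
  refine mem_of_gens (straightening (plusPair p) (minusPair p)) (fun i h => ?_) (fun i h => ?_)
    (fun h => h.elim) (fun _ s h => ?_) b
  · obtain ⟨h', e⟩ := K_mem_normalizing hz hp i h
    exact ⟨K k q i ⊗ₜ h', e.symm⟩
  · obtain ⟨h', e⟩ := Kinv_mem_normalizing hz hp i h
    exact ⟨Kinv k q i ⊗ₜ h', e.symm⟩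
  · obtain ⟨h₁, h₂, h₃, e⟩ := F_mem_normalizingMod hz hp s h
    refine ⟨F k q trivial s ⊗ₜ h₁ + Ld k q s ⊗ₜ h₂ + 1 ⊗ₜ h₃, ?_⟩
    rw [e, map_add, map_add, mulTensor_tmul, mulTensor_tmul, mulTensor_tmul, map_one, one_mul]

theorem exists_surjective_double_hom (hz : z ≠ 0) (hp : IsBorelForm z p.val) :
    ∃ f : GenDouble p →ₐc[k] UqExt k q n, Function.Surjective f ∧
      (∀ i, f (GenDouble.inl p (K k q i)) = K k q i) ∧
      (∀ s, f (GenDouble.inl p (F k q trivial s)) = F k q trivial s) ∧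
      (∀ i, f (GenDouble.inr p (K k q i)) = K k q i) ∧
      (∀ s, f (GenDouble.inr p (E k q trivial s)) = E k q trivial s) := by
  let f := GenDouble.lift (p := p) (inclHom False.elim id) (inclHom id False.elim)
    (mem_straightening hz hp)
  have hl : ∀ b, f (GenDouble.inl p b) = incl False.elim id b := GenDouble.lift_inl _ _ _
  have hr : ∀ h, f (GenDouble.inr p h) = incl id False.elim h := GenDouble.lift_inr _ _ _
  refine ⟨f, fun x => ?_, fun i => by rw [hl, incl_K], fun s => by rw [hl, incl_F],
    fun i => by rw [hr, incl_K], fun s => by rw [hr, incl_E]⟩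
  -- The range is a subalgebra that contains all generators, the inverses `K̂_i⁻¹` included.
  exact mem_of_gens (f : GenDouble p →ₐ[k] UqExt k q n).range
    (fun i => ⟨GenDouble.inl p (K k q i), by exact (hl _).trans (incl_K _ _ i)⟩)
    (fun i => ⟨GenDouble.inl p (Kinv k q i), by exact (hl _).trans (incl_Kinv _ _ i)⟩)
    (fun _ s => ⟨GenDouble.inr p (E k q trivial s), by exact (hr _).trans (incl_E _ _ _ s)⟩)
    (fun _ s => ⟨GenDouble.inl p (F k q trivial s), by exact (hl _).trans (incl_F _ _ _ s)⟩) x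

end UqExt

end

theorem mainTheorem10 {k : Type*} [Field k] (n : ℕ) (q : kˣ) (hq : (q : k) ^ 2 ≠ 1)
    (z : k) (hz : z ^ (n + 1) = (q : k)⁻¹) :
    -- the form on `U_q(b_+) ⊗ U_q(b_-)` is a duality between `U_q(b_+)^cop` and `U_q(b_-)`
    (∃! p : HopfPairing k (Cop (UqPlus k q n)) (UqMinus k q n),
      IsBorelForm z (p.form ∘ₗ (Cop.of k (A := UqPlus k q n)).toLinearMap)) ∧
    -- `U_q(b_-)` is self-dual
    (∃! p : HopfPairing k (UqMinus k q n) (UqMinus k q n), IsSelfForm z p.form) ∧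
    -- the generalized quantum doubles defined by these dualities
    ∀ (p : SkewPairing k (UqPlus k q n) (UqMinus k q n))
      (p' : HopfPairing k (UqMinus k q n) (UqMinus k q n)),
      IsBorelForm z p.val → IsSelfForm z p'.form →
      -- `U_q^ext(sl_N)` is a factor of `D(U_q(b_+), U_q(b_-))`
      (∃ f : GenDouble p →ₐc[k] UqExt k q n, Function.Surjective f ∧
        (∀ i, f (GenDouble.inl p (QAlg.K k q i)) = QAlg.K k q i) ∧
        (∀ s, f (GenDouble.inl p (QAlg.F k q trivial s)) = QAlg.F k q trivial s) ∧
        (∀ i, f (GenDouble.inr p (QAlg.K k q i)) = QAlg.K k q i) ∧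
        (∀ s, f (GenDouble.inr p (QAlg.E k q trivial s)) = QAlg.E k q trivial s)) ∧
      -- `D(U_q(b_+), U_q(b_-))` and `D(U_q(b_-)^cop, U_q(b_-))` are isomorphic Hopf algebras
      (∃ Φ : GenDouble p ≃ₐc[k] GenDouble p'.toSkew,
        (∀ i, Φ (GenDouble.inl p (QAlg.K k q i)) =
          GenDouble.inl p'.toSkew (Cop.of k (QAlg.Kinv k q i))) ∧
        (∀ s, Φ (GenDouble.inl p (QAlg.F k q trivial s)) =
          GenDouble.inl p'.toSkew (Cop.of k (QAlg.E k q trivial s))) ∧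
        (∀ h, Φ (GenDouble.inr p h) = GenDouble.inr p'.toSkew h)) := by
  -- The power `z^(n+1)` equals the nonzero scalar `q⁻¹`, and the exponent is positive.
  have hz0 : z ≠ 0 := fun h => by
    rw [h, zero_pow (Nat.succ_ne_zero n)] at hz
    exact inv_ne_zero q.ne_zero hz.symm
  exact ⟨UqPlus.existsUnique_pairing z hz, UqMinus.existsUnique_selfPairing z hz,
    fun _ _ hp hp' => ⟨UqExt.exists_surjective_double_hom hz0 hp,
      UqPlus.exists_double_equiv hp hp'⟩⟩
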